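/- Let $d\ge 1$ and $0\le r\le d-1$. A *polytope* in $\mathbb R^d$ is a finite union of $d$-dimensional simplices with disjoint interiors (it need not be convex or connected); lower-dimensional polytopes are understood in the same way inside their affine hulls. A *facet* of a $k$-dimensional polytope $P$ is the closure of a connected component of the set of those $x\in P$ near which $P$ coincides, inside its affine hull, with a closed half-space of the affine hull whose bounding hyperplane contains $x$. The *$r$-flag in standard position* $\Phi_r$ consists of the subspaces $$V_j=\{x\in\mathbb R^d:\ x_{j+1}=\dots=x_d=0\}\quad (r\le j\le d),$$ where, for $r\le j\le d-1$, the half-space $V_{j+1}\cap\{x_{j+1}<0\}$ of $V_{j+1}$ determined by $V_j$ is called positive and $V_{j+1}\cap\{x_{j+1}>0\}$ is called negative. For a polytope $A\subset\mathbb R^d$ the *flag measure* is the signed measure $$\mu_{A,\Phi_r}=\sum \varepsilon_r\varepsilon_{r+1}\cdots\varepsilon_{d-1}\,\mathrm{Vol}_r|_{F_r},$$ where the sum runs over all sequences $F_r\subset F_{r+1}\subset\dots\subset F_d=A$ in which $F_j$ is a facet of $F_{j+1}$ and the affine hull of $F_j$ is a translate of $V_j$ $(r\le j\le d-1)$; here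 $\varepsilon_j=+1$ if $F_{j+1}$ adjoins $F_j$ from the side of the positive half-space of $V_{j+1}$ and $\varepsilon_j=-1$ otherwise, and $\mathrm{Vol}_r$ is the $r$-dimensional volume (the counting measure if $r=0$). Put $$\widehat{\mathbf 1}_A(\xi)=\int_A e^{-2\pi i\langle\xi,x\rangle}\,dx,\qquad \widehat\mu_{A,\Phi_r}(\xi)=\int e^{-2\pi i\langle\xi,x\rangle}\,d\mu_{A,\Phi_r}(x).$$ For $L>0$ and $0<2\delta<\alpha<1$ let $K(r,\alpha,L,\delta)$ be the set of all $\xi\in\mathbb R^d$ such that $$|\xi_j|\le\alpha|\xi_{r+1}|\ (1\le j\le r),\qquad L\le|\xi_{r+1}|,\qquad |\xi_j|\le2\delta|\xi_{j+1}|\ (r+1\le j\le d-1).$$ **Theorem.** Let $A$ be a polytope in $\mathbb R^d$ and let $\Phi_r$ be an $r$-flag in standard position, $0\le r\le d-1$. Then there exists $\alpha\in(0,1)$ such that for every $\eta>0$ there exist $\delta$ and $L$ with $0<2\delta<\alpha$ and $L>0$ such that $$\Big|\,\widehat{\mathbf 1}_A(\xi)\prod_{j=r+1}^{d}(-2\pi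 i\xi_j)-\widehat\mu_{A,\Phi_r}(\xi)\Big|<\eta\qquad\text{for all }\xi\in K(r,\alpha,L,\delta).$$ -/

import Mathlib

open MeasureTheory Filter Topology
open scoped RealInnerProductSpace FourierTransform

namespace FlagMeasures

section Faces

variable {X : Type*} [NormedAddCommGroup X] [InnerProductSpace ℝ X]

/-- The points of `P` at which the relative boundary of `P` is smooth: near such a point, and inside
the affine hull of `P`, the set `P` coincides with a closed half-space whose bounding
hyperplane passes through the point. -/
def regularBoundary (P : Set X) : Set X :=
  {x | x ∈ P ∧ ∃ n ∈ (affineSpan ℝ P).direction, n ≠ 0 ∧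
    ∀ᶠ y in 𝓝[(affineSpan ℝ P : Set X)] x, (y ∈ P ↔ 0 ≤ ⟪n, y - x⟫)}

/-- `F` is a face of codimension one of the (possibly non-convex) polytope `P` of arbitrary
dimension: the closure of a connected component of the smooth part of the relative boundary. -/
def IsFacet (P F : Set X) : Prop :=
  ∃ x ∈ regularBoundary P, F = closure (connectedComponentIn (regularBoundary P) x)

/-- `P` adjoins its facet `F` from the side of the half-space `H` (an open half-space of the
direction of `P`): near a point of the facet, `P` is the translate of the closed half-space. -/
def AdjoinsFrom (P F H : Set X) : Prop :=
  ∃ x ∈ F, ∀ᶠ y in 𝓝[(affineSpan ℝ P : Set X)] x, (y ∈ P ↔ y - x ∈ closure H)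

end Faces

/-- A polytope: a finite union of `d`-dimensional simplices with disjoint interiors. -/
def IsPolytope {d : ℕ} (A : Set (EuclideanSpace ℝ (Fin d))) : Prop :=
  ∃ (N : ℕ) (p : Fin N → Fin (d + 1) → EuclideanSpace ℝ (Fin d)),
    (∀ k, AffineIndependent ℝ (p k)) ∧
    (∀ k l, k ≠ l → Disjoint (interior (convexHull ℝ (Set.range (p k))))
      (interior (convexHull ℝ (Set.range (p l))))) ∧
    A = ⋃ k, convexHull ℝ (Set.range (p k))

/-- An `r`-flag in `ℝᵈ`: nested subspaces `V r ⊂ V (r+1) ⊂ ⋯ ⊂ V d = ℝᵈ` with `dim V j = j`,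
and, for `r ≤ j < d`, a choice `pos j` of one of the two (open) half-spaces into which
`V j` divides `V (j+1)`. Values at other indices carry no information. -/
structure Flag (d r : ℕ) where
  V : ℕ → Submodule ℝ (EuclideanSpace ℝ (Fin d))
  pos : ℕ → Set (EuclideanSpace ℝ (Fin d))
  finrank_V : ∀ j, r ≤ j → j ≤ d → Module.finrank ℝ (V j) = j
  V_le : ∀ j, r ≤ j → j < d → V j ≤ V (j + 1)
  pos_half : ∀ j, r ≤ j → j < d → ∃ n ∈ V (j + 1),
    (∀ x ∈ V (j + 1), ⟪n, x⟫ = 0 ↔ x ∈ V j) ∧ pos j = {x | x ∈ V (j + 1) ∧ 0 < ⟪n, x⟫}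

/-- Standard position. The `j`-th coordinate (counted from one) of `x` is `x i` with
`(i : ℕ) + 1 = j`. -/
def Flag.IsStandard {d r : ℕ} (Φ : Flag d r) : Prop :=
  (∀ j, r ≤ j → j < d → ∀ x, x ∈ Φ.V j ↔ ∀ i : Fin d, j ≤ (i : ℕ) → x i = 0) ∧
  (∀ j, r ≤ j → ∀ hj : j < d, Φ.pos j = {x | x ∈ Φ.V (j + 1) ∧ x ⟨j, hj⟩ < 0})

/-- The sequences `F r ⊂ F (r+1) ⊂ ⋯ ⊂ F d = A` of faces of `A` (each one a facet of the next)
that are parallel to the flag. The sequence is indexed by `ℕ` and is normalized to be empty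
at the indices outside `[r, d]`. -/
def parallelSequences {d r : ℕ} (A : Set (EuclideanSpace ℝ (Fin d))) (Φ : Flag d r) :
    Set (ℕ → Set (EuclideanSpace ℝ (Fin d))) :=
  {F | F d = A ∧
    (∀ j, r ≤ j → j < d → IsFacet (F (j + 1)) (F j)) ∧
    (∀ j, r ≤ j → j < d → (affineSpan ℝ (F j)).direction = Φ.V j) ∧
    (∀ j, j < r ∨ d < j → F j = ∅)}

open Classical in
/-- The coefficient `ε_j = ±1` of a sequence of faces. -/
noncomputable def eps {d r : ℕ} (Φ : Flag d r) (F : ℕ → Set (EuclideanSpace ℝ (Fin d))) (j : ℕ) :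
    ℝ :=
  if AdjoinsFrom (F (j + 1)) (F j) (Φ.pos j) then 1 else -1

open Classical in
/-- The `r`-dimensional volume restricted to `F`, as a signed measure. `μHE[r]` is the Hausdorff
measure normalized to be the Lebesgue measure on `r`-dimensional subspaces, and the counting measure
for `r = 0`. (The volume is finite for every `r`-dimensional face of a polytope.) -/
noncomputable def volOn {d : ℕ} (r : ℕ) (F : Set (EuclideanSpace ℝ (Fin d))) :
    SignedMeasure (EuclideanSpace ℝ (Fin d)) :=
  if _h : IsFiniteMeasure ((μHE[r] : Measure (EuclideanSpace ℝ (Fin d))).restrict F) then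
    ((μHE[r] : Measure (EuclideanSpace ℝ (Fin d))).restrict F).toSignedMeasure
  else 0

/-- The flag measure. -/
noncomputable def flagMeasure {d r : ℕ} (A : Set (EuclideanSpace ℝ (Fin d))) (Φ : Flag d r) :
    SignedMeasure (EuclideanSpace ℝ (Fin d)) :=
  ∑ᶠ F ∈ parallelSequences A Φ, (∏ j ∈ Finset.Ico r d, eps Φ F j) • volOn r (F r)

/-- The Fourier transform `∫ exp (-2πi⟨ξ, x⟩) dμ(x)` of a signed measure. -/
noncomputable def fourierMeasure {d : ℕ} (μ : SignedMeasure (EuclideanSpace ℝ (Fin d)))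
    (ξ : EuclideanSpace ℝ (Fin d)) : ℂ :=
  ∫ᵛ x, Complex.exp (-(2 * (Real.pi : ℂ) * Complex.I * ((⟪ξ, x⟫ : ℝ) : ℂ))) ∂<•μ

/-- The Fourier transform of the indicator function of a set. -/
noncomputable def fourierIndicator {d : ℕ} (A : Set (EuclideanSpace ℝ (Fin d)))
    (ξ : EuclideanSpace ℝ (Fin d)) : ℂ :=
  𝓕 (A.indicator (fun _ => (1 : ℂ))) ξ

/-- The region `K(r, α, L, δ)`; the coordinate `ξ_{r+1}` (counted from one) is `ξ ⟨r, hr⟩`. -/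
def coneRegion {d : ℕ} (r : ℕ) (hr : r < d) (α L δ : ℝ) : Set (EuclideanSpace ℝ (Fin d)) :=
  {ξ | (∀ j : Fin d, (j : ℕ) < r → |ξ j| ≤ α * |ξ ⟨r, hr⟩|) ∧
    L ≤ |ξ ⟨r, hr⟩| ∧
    (∀ i j : Fin d, r ≤ (i : ℕ) → (j : ℕ) = (i : ℕ) + 1 → |ξ i| ≤ 2 * δ * |ξ j|)}

end FlagMeasures

/-! Integration by parts turns a factor `-2πiξ_j` into the passage from a face to its facets. For a
simplex whose direction is the flag space of dimension `k + 1`, the divergence theorem along the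
last coordinate vector of that space (`simplexExp_facets`) gives a signed sum over facets. A facet
parallel to the flag enters with its volume and a sign, and the argument continues on it. Every
other facet is negligible in the cone region. Iterating down to dimension `r` leaves a combination
of `r`-dimensional simplices plus a small error (`exists_reduction`).

The error estimate rests on pivots, the positions of the last nonzero coordinates of the vectors of
a direction space. If `m` is the largest pivot and `w` a vector ending at coordinate `m`, then `|⟪ξ,
w⟫|` is comparable to `|ξ_m|` in the cone. One integration by parts along `w` therefore gains
`1/|ξ_m|`, and a facet loses at most one pivot. By induction the integral over a simplex is bounded
by the inverse product of the frequencies at its pivots from `r` on (`exists_bound_simplexChar`). A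
facet not parallel to the flag has the top index as a pivot and misses at most one smaller index;
compared with the accumulated frequency factors this wins a ratio of at most `2δ` or `1/L`.

It remains to identify the limiting combination with the flag measure, which is defined through the
facets of the possibly non-convex `A` and not through a triangulation. Both are expressed by jumps.
Fix the arrangement of the hyperplanes spanned by the facets of the simplices. At generic points the
signed sum of the parallel facets of a union of cells is the one-sided limit of its indicator from
below minus the limit from above (`finsum_facets_eq_jump`), so the signed sum over face sequences is
an iterated jump (`finsum_chains_eq_iterJump`). Jumps are linear, the indicator of `A` is
generically the sum of the indicators of its simplices, and the jump of a simplex is again a signed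
sum of its parallel facets (`jump_simplex`). Non-generic points form a null set in every translate
of the coordinate subspace of dimension `r`, so the integrals agree (`sum_setIntegral_congr`).

Coordinates are counted from zero: `stdVec d k` is the vector of the coordinate `x_{k+1}`. -/

namespace FlagMeasures

/-! ### Hyperplane arrangements, cellular functions and their jumps -/

section Cells

variable {X : Type*} [NormedAddCommGroup X] [InnerProductSpace ℝ X] {ι : Type*}

/-- Two points lie in the same cell of the arrangement of hyperplanes `ℓ i = 0`. -/
def SameCell (ℓ : ι → X →ᵃ[ℝ] ℝ) (x y : X) : Prop :=
  ∀ i, SignType.sign (ℓ i x) = SignType.sign (ℓ i y)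

/-- A function that is constant on the cells of an arrangement. -/
def Cellular (ℓ : ι → X →ᵃ[ℝ] ℝ) (f : X → ℝ) : Prop :=
  ∀ ⦃x y⦄, SameCell ℓ x y → f x = f y

/-- A union of cells of an arrangement. -/
def CellularSet (ℓ : ι → X →ᵃ[ℝ] ℝ) (P : Set X) : Prop :=
  ∀ ⦃x y⦄, SameCell ℓ x y → x ∈ P → y ∈ P

/-- The hyperplanes of the arrangement through `x` are all parallel to `W`. -/
def Generic (ℓ : ι → X →ᵃ[ℝ] ℝ) (W : Submodule ℝ X) (x : X) : Prop :=
  ∀ i, ℓ i x = 0 → ∀ w ∈ W, (ℓ i).linear w = 0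

variable {ℓ : ι → X →ᵃ[ℝ] ℝ} {x y z : X} {P : Set X}

lemma affine_add (f : X →ᵃ[ℝ] ℝ) (x v : X) : f (x + v) = f x + f.linear v := by
  rw [add_comm x v, ← vadd_eq_add, f.map_vadd, vadd_eq_add, add_comm]

lemma SameCell.symm (h : SameCell ℓ x y) : SameCell ℓ y x := fun i => (h i).symm

lemma CellularSet.mem_iff (hP : CellularSet ℓ P) (h : SameCell ℓ x y) : x ∈ P ↔ y ∈ P :=
  ⟨hP h, hP h.symm⟩

lemma CellularSet.indicator (hP : CellularSet ℓ P) : Cellular ℓ (P.indicator 1) := by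
  intro x y h
  by_cases hx : x ∈ P
  · rw [Set.indicator_of_mem hx, Set.indicator_of_mem (hP h hx)]; rfl
  · rw [Set.indicator_of_notMem hx, Set.indicator_of_notMem (fun hy => hx (hP h.symm hy))]

/-- Cells are convex, hence connected; this is what makes connected components of cellular sets
cellular. -/
lemma SameCell.segment (h : SameCell ℓ x y) (hz : z ∈ segment ℝ x y) : SameCell ℓ x z := by
  obtain ⟨a, b, ha, hb, hab, rfl⟩ := hz
  intro i
  have e : ℓ i (a • x + b • y) = a * ℓ i x + b * ℓ i y := by
    simpa using Convex.combo_affine_apply hab (f := ℓ i) (x := x) (y := y)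
  have h' := h i
  rcases lt_trichotomy (ℓ i x) 0 with hx | hx | hx
  · rw [sign_neg hx] at h'
    have hy : ℓ i y < 0 := sign_eq_neg_one_iff.1 h'.symm
    rw [sign_neg hx, e, eq_comm, sign_eq_neg_one_iff]
    rcases ha.eq_or_lt with rfl | ha
    · have : b = 1 := by linarith
      subst this; linarith
    · nlinarith [mul_neg_of_pos_of_neg ha hx, mul_nonpos_of_nonneg_of_nonpos hb hy.le]
  · rw [hx, sign_zero] at h'
    have hy : ℓ i y = 0 := sign_eq_zero_iff.1 h'.symm
    rw [e, hx, hy]; simp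
  · rw [sign_pos hx] at h'
    have hy : 0 < ℓ i y := sign_eq_one_iff.1 h'.symm
    rw [sign_pos hx, e, eq_comm, sign_eq_one_iff]
    rcases ha.eq_or_lt with rfl | ha
    · have : b = 1 := by linarith
      subst this; linarith
    · nlinarith [mul_pos ha hx, mul_nonneg hb hy.le]

lemma CellularSet.segment_subset (hP : CellularSet ℓ P) (h : SameCell ℓ x y) (hx : x ∈ P) :
    segment ℝ x y ⊆ P :=
  fun _ hz => hP (h.segment hz) hx

/-- A union of cells is determined by its set of sign vectors. All faces that occur are cellular, so
the sums over faces are finite. -/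
lemma finite_cellularSet [Finite ι] : {P : Set X | CellularSet ℓ P}.Finite := by
  let σ : X → ι → SignType := fun x i => SignType.sign (ℓ i x)
  refine Set.Finite.subset
    (Set.finite_range fun S : Set (ι → SignType) => (σ ⁻¹' S : Set X)) ?_
  intro P hP
  refine ⟨σ '' P, ?_⟩
  ext x
  constructor
  · rintro ⟨y, hy, hxy⟩
    exact hP (fun i => congrFun hxy i) hy
  · exact fun hx => ⟨x, hx, rfl⟩

lemma tendsto_smul_nhdsGT (u : X) : Tendsto (fun t : ℝ => t • u) (𝓝[>] 0) (𝓝 0) := by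
  have h : Tendsto (fun t : ℝ => t • u) (𝓝 0) (𝓝 ((0 : ℝ) • u)) :=
    Continuous.tendsto (by fun_prop) 0
  rw [zero_smul] at h
  exact h.mono_left nhdsWithin_le_nhds

/-- The one-sided limit of `f` at `x` in the direction `u`. -/
noncomputable def side (f : X → ℝ) (x u : X) : ℝ :=
  limUnder (𝓝[>] (0 : ℝ)) fun t => f (x + t • u)

lemma side_eq {f : X → ℝ} {u : X} {a : ℝ} (h : ∀ᶠ t in 𝓝[>] (0 : ℝ), f (x + t • u) = a) :
    side f x u = a :=
  Tendsto.limUnder_eq (tendsto_const_nhds.congr' (h.mono fun _ ht => ht.symm))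

variable [FiniteDimensional ℝ X] [Finite ι]

lemma eventually_sign (ℓ : ι → X →ᵃ[ℝ] ℝ) (x : X) :
    ∀ᶠ v in 𝓝 (0 : X), ∀ i, ℓ i x ≠ 0 →
      SignType.sign (ℓ i (x + v)) = SignType.sign (ℓ i x) := by
  rw [eventually_all]
  intro i
  have hc : ContinuousAt (fun v => ℓ i (x + v)) 0 :=
    ((ℓ i).continuous_of_finiteDimensional.comp (continuous_const.add continuous_id)).continuousAt
  have h0 : ℓ i (x + 0) = ℓ i x := by rw [add_zero]
  rcases lt_trichotomy (ℓ i x) 0 with hx | hx | hx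
  · filter_upwards [hc.eventually_lt_const (by simpa using hx)] with v hv _
    rw [sign_neg hx, sign_neg hv]
  · exact Eventually.of_forall fun v hv => absurd hx hv
  · filter_upwards [hc.eventually_const_lt (by simpa using hx)] with v hv _
    rw [sign_pos hx, sign_pos hv]

/-- The arrangement looks the same near two points of one cell: functionals nonzero there keep their
sign, and those that vanish take the value of their linear part at `v` on both sides. Every locally
defined notion below is cellular for this reason. -/
lemma SameCell.eventually_add (h : SameCell ℓ x y) :
    ∀ᶠ v in 𝓝 (0 : X), SameCell ℓ (x + v) (y + v) := by
  filter_upwards [eventually_sign ℓ x, eventually_sign ℓ y] with v hx hy i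
  by_cases h0 : ℓ i x = 0
  · have h1 : ℓ i y = 0 := by
      have := h i
      rw [h0, sign_zero] at this
      exact sign_eq_zero_iff.1 this.symm
    rw [affine_add, affine_add, h0, h1]
  · have h1 : ℓ i y ≠ 0 := by
      intro h1
      have := h i
      rw [h1, sign_zero] at this
      exact h0 (sign_eq_zero_iff.1 this)
    rw [hx i h0, hy i h1, h i]

lemma CellularSet.closure (hP : CellularSet ℓ P) : CellularSet ℓ (closure P) := by
  intro x y h hx
  rw [mem_closure_iff_frequently] at hx ⊢
  have hev : ∀ᶠ z in 𝓝 x, SameCell ℓ z (z + (y - x)) := by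
    have h1 : Tendsto (fun z => z - x) (𝓝 x) (𝓝 0) := by
      have : ContinuousAt (fun z => z - x) x := by fun_prop
      simpa [ContinuousAt] using this
    filter_upwards [h1.eventually h.eventually_add] with z hz
    have e1 : x + (z - x) = z := by abel
    have e2 : y + (z - x) = z + (y - x) := by abel
    rwa [e1, e2] at hz
  have h2 : Tendsto (fun z => z + (y - x)) (𝓝 x) (𝓝 y) := by
    have : ContinuousAt (fun z => z + (y - x)) x := by fun_prop
    simpa [ContinuousAt] using this
  refine h2.frequently ?_
  exact (hx.and_eventually hev).mono fun z hz => hP hz.2 hz.1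

/-- In a neighbourhood of a generic point, the cells are determined by the position
relative to the hyperplane spanned by `W`. -/
lemma Generic.eventually_sameCell {W : Submodule ℝ X} (hx : Generic ℓ W x) (e : X) :
    ∀ᶠ v in 𝓝 (0 : X), ∀ᶠ t in 𝓝[>] (0 : ℝ), ∀ w ∈ W, ∀ s : ℝ, v = w + s • e →
      (s < 0 → SameCell ℓ (x + v) (x + t • -e)) ∧ (s = 0 → SameCell ℓ (x + v) x) ∧
      (0 < s → SameCell ℓ (x + v) (x + t • e)) := by
  have hU := eventually_sign ℓ x
  have hT : ∀ u : X, Tendsto (fun t : ℝ => t • u) (𝓝[>] 0) (𝓝 0) := tendsto_smul_nhdsGT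
  filter_upwards [hU] with v hv
  filter_upwards [(hT e).eventually hU, (hT (-e)).eventually hU, self_mem_nhdsWithin]
    with t ht1 ht2 ht0 w hw s hvs
  have ht0 : 0 < t := ht0
  -- Only functionals vanishing at `x` can change sign nearby, and genericity makes these blind to
  -- the component of `v` in `W`.
  have key : ∀ i, ℓ i x = 0 → ℓ i (x + v) = s * (ℓ i).linear e := by
    intro i hi
    rw [affine_add, hi, hvs, map_add, hx i hi w hw, map_smul]
    simp
  refine ⟨fun hs i => ?_, fun hs i => ?_, fun hs i => ?_⟩
  · by_cases hi : ℓ i x = 0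
    · rw [key i hi, affine_add, hi, map_smul, map_neg, zero_add, smul_eq_mul, mul_neg, ← neg_mul,
        sign_mul, sign_mul, sign_neg hs, sign_neg (by linarith : -t < 0)]
    · rw [hv i hi, ht2 i hi]
  · by_cases hi : ℓ i x = 0
    · rw [key i hi, hi, hs, zero_mul]
    · rw [hv i hi]
  · by_cases hi : ℓ i x = 0
    · rw [key i hi, affine_add, hi, map_smul, zero_add, smul_eq_mul,
        sign_mul, sign_mul, sign_pos hs, sign_pos ht0]
    · rw [hv i hi, ht1 i hi]

/-- The jump of `f` at `x` in the direction `e`: the limit from below minus the limit from above. -/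
noncomputable def jump (e : X) (f : X → ℝ) (x : X) : ℝ := side f x (-e) - side f x e

/-- Every point is generic for the zero subspace. Hence a short ray stays in one cell, and the limit
defining `side` exists for cellular functions. -/
lemma eventually_ray (ℓ : ι → X →ᵃ[ℝ] ℝ) (x u : X) : ∀ᶠ t in 𝓝[>] (0 : ℝ),
    ∀ᶠ t' in 𝓝[>] (0 : ℝ), SameCell ℓ (x + t • u) (x + t' • u) := by
  have hx : Generic ℓ (⊥ : Submodule ℝ X) x := by
    intro i _ w hw
    rw [(Submodule.mem_bot ℝ).1 hw, map_zero]
  have h := hx.eventually_sameCell u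
  have hT := tendsto_smul_nhdsGT u
  filter_upwards [hT.eventually h, self_mem_nhdsWithin] with t ht ht0
  filter_upwards [ht] with t' ht'
  exact (ht' 0 (Submodule.zero_mem _) t (by simp)).2.2 ht0

lemma Cellular.eventually_side {f : X → ℝ} (hf : Cellular ℓ f) (x u : X) :
    ∀ᶠ t in 𝓝[>] (0 : ℝ), f (x + t • u) = side f x u := by
  filter_upwards [eventually_ray ℓ x u] with t ht
  exact (side_eq (ht.mono fun t' h => (hf h).symm)).symm

lemma Cellular.side {f : X → ℝ} (hf : Cellular ℓ f) (u : X) :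
    Cellular ℓ (fun x => side f x u) := by
  intro x y h
  have hT := tendsto_smul_nhdsGT u
  refine side_eq ?_
  filter_upwards [hf.eventually_side y u, hT.eventually h.eventually_add] with t h1 h2
  rw [hf h2, h1]

lemma Cellular.jump {f : X → ℝ} (hf : Cellular ℓ f) (e : X) : Cellular ℓ (jump e f) := by
  intro x y h
  have h1 := hf.side (-e) h
  have h2 := hf.side e h
  simp only [FlagMeasures.jump]
  simp only at h1 h2
  rw [h1, h2]

omit [FiniteDimensional ℝ X] [Finite ι] in
lemma Cellular.sum {κ : Type*} (s : Finset κ) {f : κ → X → ℝ} (c : κ → ℝ)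
    (hf : ∀ k ∈ s, Cellular ℓ (f k)) : Cellular ℓ (fun x => ∑ k ∈ s, c k * f k x) := by
  intro x y h
  exact Finset.sum_congr rfl fun k hk => by rw [hf k hk h]

lemma side_sum {κ : Type*} (s : Finset κ) {f : κ → X → ℝ} (c : κ → ℝ)
    (hf : ∀ k ∈ s, Cellular ℓ (f k)) (x u : X) :
    side (fun x => ∑ k ∈ s, c k * f k x) x u = ∑ k ∈ s, c k * side (f k) x u := by
  refine side_eq ?_
  have : ∀ᶠ t in 𝓝[>] (0 : ℝ), ∀ k ∈ s, f k (x + t • u) = side (f k) x u := by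
    rw [Filter.eventually_all_finset]
    exact fun k hk => (hf k hk).eventually_side x u
  filter_upwards [this] with t ht
  exact Finset.sum_congr rfl fun k hk => by rw [ht k hk]

lemma jump_sum {κ : Type*} (s : Finset κ) {f : κ → X → ℝ} (c : κ → ℝ)
    (hf : ∀ k ∈ s, Cellular ℓ (f k)) (e : X) :
    jump e (fun x => ∑ k ∈ s, c k * f k x) = fun x => ∑ k ∈ s, c k * jump e (f k) x := by
  funext x
  simp only [jump]
  rw [side_sum s c hf, side_sum s c hf, ← Finset.sum_sub_distrib]
  exact Finset.sum_congr rfl fun k _ => by ring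

/-- A hyperplane through `x + t • u` for small `t > 0` also passes through `x`, hence contains the
direction `e` in addition to `W`. -/
lemma Generic.eventually_generic {W W' : Submodule ℝ X} {e : X}
    (hW : ∀ w ∈ W', ∃ v ∈ W, ∃ s : ℝ, w = v + s • e) (hx : Generic ℓ W x) {u : X}
    (hu : u = e ∨ u = -e) : ∀ᶠ t in 𝓝[>] (0 : ℝ), Generic ℓ W' (x + t • u) := by
  have hT := tendsto_smul_nhdsGT u
  filter_upwards [hT.eventually (eventually_sign ℓ x), self_mem_nhdsWithin] with t ht ht0
  have ht0 : 0 < t := ht0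
  intro i hi w hw
  have hix : ℓ i x = 0 := by
    by_contra h
    have := ht i h
    rw [hi, sign_zero] at this
    exact h (sign_eq_zero_iff.1 this.symm)
  have hie : (ℓ i).linear e = 0 := by
    rw [affine_add, hix, zero_add, map_smul, smul_eq_mul] at hi
    have := (mul_eq_zero.1 hi).resolve_left ht0.ne'
    rcases hu with rfl | rfl
    · exact this
    · simpa using this
  obtain ⟨v, hv, s, rfl⟩ := hW w hw
  rw [map_add, map_smul, hie, hx i hix v hv]
  simp

/-- A jump at `x` only samples points moved off `x` along `e`, and these are generic for the larger
space `W'`. Thus exceptional sets may be ignored before taking a jump. -/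
lemma jump_congr {W W' : Submodule ℝ X} {e : X}
    (hW : ∀ w ∈ W', ∃ v ∈ W, ∃ s : ℝ, w = v + s • e) {f g : X → ℝ} (hg : Cellular ℓ g)
    (hfg : ∀ x, Generic ℓ W' x → f x = g x) (hx : Generic ℓ W x) : jump e f x = jump e g x := by
  have h : ∀ u, (u = e ∨ u = -e) → side f x u = side g x u := by
    intro u hu
    refine side_eq ?_
    filter_upwards [hx.eventually_generic hW hu, hg.eventually_side x u] with t h1 h2
    rw [hfg _ h1, h2]
  rw [jump, jump, h e (Or.inl rfl), h (-e) (Or.inr rfl)]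

end Cells

/-! ### Facets of a cellular set as the jump of its indicator -/

section Facets

variable {X : Type*} [NormedAddCommGroup X] [InnerProductSpace ℝ X] {ι : Type*}
  {ℓ : ι → X →ᵃ[ℝ] ℝ} {x y z : X} {P F : Set X} {W W₀ : Submodule ℝ X}

lemma eventually_affineSpan_iff (hx : x ∈ P) {Q : X → Prop} :
    (∀ᶠ y in 𝓝[(affineSpan ℝ P : Set X)] x, Q y) ↔
      ∀ᶠ v in 𝓝 (0 : X), v ∈ (affineSpan ℝ P).direction → Q (x + v) := by
  have hx' : x ∈ affineSpan ℝ P := subset_affineSpan ℝ P hx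
  rw [eventually_nhdsWithin_iff, ← map_add_left_nhds_zero x, eventually_map]
  refine eventually_congr (Eventually.of_forall fun v => ?_)
  have : x + v ∈ (affineSpan ℝ P : Set X) ↔ v ∈ (affineSpan ℝ P).direction := by
    rw [SetLike.mem_coe, add_comm, ← vadd_eq_add,
      AffineSubspace.vadd_mem_iff_mem_direction v hx']
  rw [this]

lemma sub_mem_direction (hx : x ∈ P) (hy : y ∈ P) : y - x ∈ (affineSpan ℝ P).direction :=
  AffineSubspace.vsub_mem_direction (subset_affineSpan ℝ P hy) (subset_affineSpan ℝ P hx)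

lemma mem_regularBoundary_iff : x ∈ regularBoundary P ↔ x ∈ P ∧
    ∃ n ∈ (affineSpan ℝ P).direction, n ≠ 0 ∧
      ∀ᶠ v in 𝓝 (0 : X), v ∈ (affineSpan ℝ P).direction → (x + v ∈ P ↔ 0 ≤ ⟪n, v⟫) := by
  refine and_congr_right fun hx => ?_
  refine exists_congr fun n => and_congr_right fun _ => and_congr_right fun _ => ?_
  rw [eventually_affineSpan_iff hx]
  simp only [add_sub_cancel_left]

lemma regularBoundary_subset : regularBoundary P ⊆ P := fun _ h => h.1

lemma IsFacet.subset (hF : IsFacet P F) (hP : IsClosed P) : F ⊆ P := by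
  obtain ⟨x, _, rfl⟩ := hF
  exact closure_minimal ((connectedComponentIn_subset _ _).trans regularBoundary_subset) hP

lemma IsFacet.isClosed (hF : IsFacet P F) : IsClosed F := by
  obtain ⟨x, _, rfl⟩ := hF
  exact isClosed_closure

/-- Adding points of the closure keeps a connected set connected, so a component is closed relative
to the regular boundary. -/
lemma mem_component_of_mem_closure (hx : x ∈ regularBoundary P)
    (hy : y ∈ closure (connectedComponentIn (regularBoundary P) x))
    (hyr : y ∈ regularBoundary P) : y ∈ connectedComponentIn (regularBoundary P) x := by
  have h : IsPreconnected (insert y (connectedComponentIn (regularBoundary P) x)) :=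
    isPreconnected_connectedComponentIn.subset_closure (Set.subset_insert _ _)
      (Set.insert_subset hy subset_closure)
  exact h.subset_connectedComponentIn (Set.mem_insert_of_mem _ (mem_connectedComponentIn hx))
    (Set.insert_subset hyr (connectedComponentIn_subset _ _)) (Set.mem_insert _ _)

/-- A regular boundary point is not an interior point. -/
lemma not_forall_mem_of_mem_regularBoundary (hx : x ∈ regularBoundary P)
    (h : ∀ᶠ v in 𝓝 (0 : X), v ∈ (affineSpan ℝ P).direction → x + v ∈ P) : False := by
  obtain ⟨_, m, hm, hm0, hgerm⟩ := mem_regularBoundary_iff.1 hx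
  -- Moving from `x` against the inner normal `m` leaves the half-space at once.
  obtain ⟨t, ht, ht0⟩ := (((tendsto_smul_nhdsGT (-m)).eventually (h.and hgerm)).and
    self_mem_nhdsWithin).exists
  have ht0 : 0 < t := ht0
  have hmem : t • -m ∈ (affineSpan ℝ P).direction :=
    Submodule.smul_mem _ _ (Submodule.neg_mem _ hm)
  have := (ht.2 hmem).1 (ht.1 hmem)
  rw [inner_smul_right, inner_neg_right] at this
  have hpos : 0 < ⟪m, m⟫ := real_inner_self_pos.2 hm0
  nlinarith

/-- At a nearby point strictly inside the half-space, `P` fills a relative neighbourhood, so that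
point is not in the regular boundary. -/
lemma eventually_inner_eq_zero {n : X}
    (hn : ∀ᶠ v in 𝓝 (0 : X), v ∈ (affineSpan ℝ P).direction → (z + v ∈ P ↔ 0 ≤ ⟪n, v⟫)) :
    ∀ᶠ u in 𝓝 (0 : X), u ∈ (affineSpan ℝ P).direction → z + u ∈ regularBoundary P →
      ⟪n, u⟫ = 0 := by
  filter_upwards [eventually_eventually_nhds.2 hn] with u hu huW hur
  have h0 : 0 ≤ ⟪n, u⟫ := (hu.self_of_nhds huW).1 hur.1
  by_contra hne
  have hpos : 0 < ⟪n, u⟫ := lt_of_le_of_ne h0 (Ne.symm hne)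
  refine not_forall_mem_of_mem_regularBoundary hur ?_
  have hc : ContinuousAt (fun v => ⟪n, u + v⟫) 0 := by fun_prop
  have h1 : ∀ᶠ v in 𝓝 (0 : X), 0 < ⟪n, u + v⟫ := hc.eventually_const_lt (by simpa using hpos)
  rw [← map_add_left_nhds_zero u, eventually_map] at hu
  filter_upwards [hu, h1] with v hv hv1 hvW
  rw [add_assoc]
  exact (hv (Submodule.add_mem _ huW hvW)).2 hv1.le

/-- Nearby regular points lie on the bounding hyperplane, and translating a half-space along its
boundary does not change it. The predicate `R` is arbitrary so that it can be an inner product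
inequality or membership in `closure H`. -/
lemma germ_eventually_const (hz : z ∈ regularBoundary P) (R : X → Prop) :
    ∀ᶠ y in 𝓝 z, y ∈ regularBoundary P →
      ((∀ᶠ v in 𝓝 (0 : X), v ∈ (affineSpan ℝ P).direction → (z + v ∈ P ↔ R v)) ↔
       (∀ᶠ v in 𝓝 (0 : X), v ∈ (affineSpan ℝ P).direction → (y + v ∈ P ↔ R v))) := by
  obtain ⟨hzP, n, hn, hn0, hgerm⟩ := mem_regularBoundary_iff.1 hz
  rw [← map_add_left_nhds_zero z, eventually_map]
  filter_upwards [eventually_inner_eq_zero hgerm, eventually_eventually_nhds.2 hgerm]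
    with u hu hu' hur
  have huW : u ∈ (affineSpan ℝ P).direction := by
    simpa using sub_mem_direction hzP hur.1
  have h0 := hu huW hur
  rw [← map_add_left_nhds_zero u, eventually_map] at hu'
  have hg : ∀ᶠ v in 𝓝 (0 : X), v ∈ (affineSpan ℝ P).direction → (z + u + v ∈ P ↔ 0 ≤ ⟪n, v⟫) := by
    filter_upwards [hu'] with v hv hvW
    rw [add_assoc, hv (Submodule.add_mem _ huW hvW), inner_add_right, h0, zero_add]
  constructor
  · intro h
    filter_upwards [h, hgerm, hg] with v h1 h2 h3 hvW
    rw [h3 hvW, ← h2 hvW, h1 hvW]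
  · intro h
    filter_upwards [h, hgerm, hg] with v h1 h2 h3 hvW
    rw [h2 hvW, ← h3 hvW, h1 hvW]

lemma germ_const {C : Set X} (hC : IsPreconnected C) (hCr : C ⊆ regularBoundary P)
    (hx : x ∈ C) (hy : y ∈ C) {R : X → Prop}
    (h : ∀ᶠ v in 𝓝 (0 : X), v ∈ (affineSpan ℝ P).direction → (x + v ∈ P ↔ R v)) :
    ∀ᶠ v in 𝓝 (0 : X), v ∈ (affineSpan ℝ P).direction → (y + v ∈ P ↔ R v) := by
  refine (hC.induction₂ (fun a b =>
    (∀ᶠ v in 𝓝 (0 : X), v ∈ (affineSpan ℝ P).direction → (a + v ∈ P ↔ R v)) ↔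
    (∀ᶠ v in 𝓝 (0 : X), v ∈ (affineSpan ℝ P).direction → (b + v ∈ P ↔ R v))) ?_ ?_ ?_ hx hy).1 h
  · intro a ha
    rw [eventually_nhdsWithin_iff]
    filter_upwards [germ_eventually_const (hCr ha) R] with b hb hbC
    exact hb (hCr hbC)
  · intro a b c _ _ _ hab hbc
    exact hab.trans hbc
  · intro a b _ _ hab
    exact hab.symm

/-- The normal is the same all along the component by `germ_const`, so the component never leaves
its hyperplane. -/
lemma inner_const {C : Set X} (hC : IsPreconnected C) (hCr : C ⊆ regularBoundary P)
    (hx : x ∈ C) (hy : y ∈ C) {n : X}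
    (h : ∀ᶠ v in 𝓝 (0 : X), v ∈ (affineSpan ℝ P).direction → (x + v ∈ P ↔ 0 ≤ ⟪n, v⟫)) :
    ⟪n, y - x⟫ = 0 := by
  refine hC.induction₂ (fun a b => ⟪n, b - a⟫ = 0) ?_ ?_ ?_ hx hy
  · intro a ha
    rw [eventually_nhdsWithin_iff, ← map_add_left_nhds_zero a, eventually_map]
    filter_upwards [eventually_inner_eq_zero (germ_const hC hCr hx ha h)] with u hu huC
    have huW : u ∈ (affineSpan ℝ P).direction := by
      simpa using sub_mem_direction (hCr ha).1 (hCr huC).1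
    simpa using hu huW (hCr huC)
  · intro a b c _ _ _ hab hbc
    have : c - a = (c - b) + (b - a) := by abel
    rw [this, inner_add_right, hab, hbc, add_zero]
  · intro a b _ _ hab
    have : a - b = -(b - a) := by abel
    rw [this, inner_neg_right, hab, neg_zero]

lemma mem_connectedComponentIn_of_sameCell {S : Set X} (hS : CellularSet ℓ S)
    (hy : y ∈ connectedComponentIn S x) (h : SameCell ℓ y z) :
    z ∈ connectedComponentIn S x := by
  have hyS : y ∈ S := connectedComponentIn_subset _ _ hy
  rw [connectedComponentIn_eq hy]
  exact (convex_segment y z).isPreconnected.subset_connectedComponentIn (left_mem_segment ℝ y z)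
    (hS.segment_subset h hyS) (right_mem_segment ℝ y z)

lemma side_indicator_of_mem {u : X} (h : ∀ᶠ t in 𝓝[>] (0 : ℝ), x + t • u ∈ P) :
    side (P.indicator 1) x u = 1 :=
  side_eq (h.mono fun t ht => by rw [Set.indicator_of_mem ht]; rfl)

lemma side_indicator_of_notMem {u : X} (h : ∀ᶠ t in 𝓝[>] (0 : ℝ), x + t • u ∉ P) :
    side (P.indicator 1) x u = 0 :=
  side_eq (h.mono fun t ht => by rw [Set.indicator_of_notMem ht])

variable [FiniteDimensional ℝ X] [Finite ι]

lemma CellularSet.regularBoundary (hP : CellularSet ℓ P) :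
    CellularSet ℓ (regularBoundary P) := by
  intro x y h hx
  obtain ⟨hxP, n, hn, hn0, hgerm⟩ := mem_regularBoundary_iff.1 hx
  refine mem_regularBoundary_iff.2 ⟨hP h hxP, n, hn, hn0, ?_⟩
  filter_upwards [hgerm, h.eventually_add] with v h1 h2 hv
  rw [← hP.mem_iff h2, h1 hv]

lemma IsFacet.cellularSet (hF : IsFacet P F) (hP : CellularSet ℓ P) : CellularSet ℓ F := by
  obtain ⟨x, hx, rfl⟩ := hF
  refine CellularSet.closure ?_
  intro y z h hy
  exact mem_connectedComponentIn_of_sameCell hP.regularBoundary hy h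

lemma Generic.eventually_sameCell_self (hx : Generic ℓ W₀ x) :
    ∀ᶠ v in 𝓝 (0 : X), v ∈ W₀ → SameCell ℓ (x + v) x := by
  filter_upwards [hx.eventually_sameCell 0] with v hv hvW
  obtain ⟨t, ht⟩ := hv.exists
  exact (ht v hvW 0 (by simp)).2.1 rfl

/-- A priori `x` only lies in the closure of the component. A component point near `x` differs from
it by a vector of `W₀`, hence by genericity lies in the cell of `x`, and the component is a union of
cells. In particular at most one facet of direction `W₀` passes through `x`. -/
lemma IsFacet.eq_closure_component (hF : IsFacet P F) (hP : CellularSet ℓ P)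
    (hdir : (affineSpan ℝ F).direction = W₀) (hx : Generic ℓ W₀ x) (hxF : x ∈ F) :
    x ∈ FlagMeasures.regularBoundary P ∧
      F = closure (connectedComponentIn (FlagMeasures.regularBoundary P) x) := by
  obtain ⟨x₀, hx₀, hFe⟩ := id hF
  have hxc : x ∈ closure (connectedComponentIn (FlagMeasures.regularBoundary P) x₀) := hFe ▸ hxF
  rw [mem_closure_iff_frequently, ← map_add_left_nhds_zero x, frequently_map] at hxc
  obtain ⟨v, hv, hv'⟩ := (hxc.and_eventually hx.eventually_sameCell_self).exists
  have hvF : x + v ∈ F := hFe ▸ subset_closure hv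
  have hvW : v ∈ W₀ := by
    rw [← hdir]
    simpa using sub_mem_direction hxF hvF
  have hxC := mem_connectedComponentIn_of_sameCell hP.regularBoundary hv (hv' hvW)
  refine ⟨connectedComponentIn_subset _ _ hxC, ?_⟩
  rw [hFe, connectedComponentIn_eq hxC]

/-- The component stays in the hyperplane through `x` orthogonal to `n`; conversely, small
displacements of `x` within `W₀` stay in its cell and so in the component. -/
lemma direction_component {n : X} (hP : CellularSet ℓ P)
    (hW : (affineSpan ℝ P).direction = W)
    (hW₀ : ∀ w, w ∈ W₀ ↔ w ∈ W ∧ ⟪n, w⟫ = 0) (hx : Generic ℓ W₀ x)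
    (hxr : x ∈ FlagMeasures.regularBoundary P)
    (h : ∀ᶠ v in 𝓝 (0 : X), v ∈ W → (x + v ∈ P ↔ 0 ≤ ⟪n, v⟫)) :
    (affineSpan ℝ (closure (connectedComponentIn (FlagMeasures.regularBoundary P) x))).direction
      = W₀ := by
  subst hW
  have hxC := mem_connectedComponentIn hxr
  apply le_antisymm
  · have hsub : closure (connectedComponentIn (FlagMeasures.regularBoundary P) x) ⊆
        (AffineSubspace.mk' x W₀ : Set X) := by
      refine closure_minimal ?_ (AffineSubspace.closed_of_finiteDimensional _)
      intro y hy
      rw [SetLike.mem_coe, AffineSubspace.mem_mk', vsub_eq_sub, hW₀]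
      exact ⟨sub_mem_direction hxr.1 (connectedComponentIn_subset _ _ hy).1,
        inner_const isPreconnected_connectedComponentIn (connectedComponentIn_subset _ _)
          hxC hy h⟩
    have := AffineSubspace.direction_le (affineSpan_le.2 hsub)
    rwa [AffineSubspace.direction_mk'] at this
  · intro w hw
    have hT : Tendsto (fun t : ℝ => t • - -w) (𝓝[>] 0) (𝓝 0) := tendsto_smul_nhdsGT (- -w)
    obtain ⟨t, ht, ht0⟩ := ((hT.eventually hx.eventually_sameCell_self).and
      self_mem_nhdsWithin).exists
    have ht0 : 0 < t := ht0
    rw [neg_neg] at ht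
    have hmem := mem_connectedComponentIn_of_sameCell hP.regularBoundary hxC
      (ht (Submodule.smul_mem _ _ hw)).symm
    have := sub_mem_direction (subset_closure hxC) (subset_closure hmem)
    rw [add_sub_cancel_left] at this
    exact (Submodule.smul_mem_iff _ ht0.ne').1 this

lemma CellularSet.ray_dichotomy (hP : CellularSet ℓ P) (x u : X) :
    (∀ᶠ t in 𝓝[>] (0 : ℝ), x + t • u ∈ P) ∨ (∀ᶠ t in 𝓝[>] (0 : ℝ), x + t • u ∉ P) := by
  obtain ⟨t, ht⟩ := (eventually_ray ℓ x u).exists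
  by_cases h : x + t • u ∈ P
  · exact Or.inl (ht.mono fun t' ht' => (hP.mem_iff ht').1 h)
  · exact Or.inr (ht.mono fun t' ht' h' => h ((hP.mem_iff ht').2 h'))

open Classical in
/-- The signed sum of the facets of `P` parallel to `W₀` is the jump of `P` in the direction
orthogonal to `W₀`, at generic points. -/
theorem finsum_facets_eq_jump {e : X} {H : Set X} (hP : CellularSet ℓ P) (hPc : IsClosed P)
    (hW : (affineSpan ℝ P).direction = W) (heW : e ∈ W) (he : ‖e‖ = 1)
    (hW₀ : ∀ w, w ∈ W₀ ↔ w ∈ W ∧ ⟪e, w⟫ = 0)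
    (hH : closure H = {w | w ∈ W ∧ ⟪e, w⟫ ≤ 0}) (hx : Generic ℓ W₀ x) :
    ∑ᶠ F ∈ {F | IsFacet P F ∧ (affineSpan ℝ F).direction = W₀},
      (if AdjoinsFrom P F H then (1 : ℝ) else -1) * F.indicator 1 x =
      jump e (P.indicator 1) x := by
  have hee : ⟪e, e⟫ = 1 := by rw [real_inner_self_eq_norm_sq, he]; norm_num
  have he0 : e ≠ 0 := by rintro rfl; simp at he
  -- The outcome where no facet contributes at `x`.
  have hempty : ∀ hjump : jump e (P.indicator 1) x = 0,
      (∀ F, IsFacet P F → (affineSpan ℝ F).direction = W₀ → x ∉ F) →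
      ∑ᶠ F ∈ {F | IsFacet P F ∧ (affineSpan ℝ F).direction = W₀},
      (if AdjoinsFrom P F H then (1 : ℝ) else -1) * F.indicator 1 x =
      jump e (P.indicator 1) x := by
    intro hjump h
    rw [hjump]
    refine finsum_mem_eq_zero_of_forall_eq_zero fun F hF => ?_
    rw [Set.indicator_of_notMem (h F hF.1 hF.2), mul_zero]
  by_cases hxP : x ∉ P
  · refine hempty ?_ fun F hF _ hxF => hxP (hF.subset hPc hxF)
    have h1 : ∀ᶠ v in 𝓝 (0 : X), x + v ∉ P := by
      have := hPc.isOpen_compl.mem_nhds hxP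
      rw [← map_add_left_nhds_zero x, mem_map] at this
      exact this
    have h2 := (tendsto_smul_nhdsGT (-e)).eventually h1
    have h3 := (tendsto_smul_nhdsGT (- -e)).eventually h1
    rw [neg_neg] at h3
    rw [jump, side_indicator_of_notMem h2, side_indicator_of_notMem h3, sub_zero]
  push Not at hxP
  -- the shape of `P` near `x`
  have hgerm : ∀ᶠ v in 𝓝 (0 : X), v ∈ W →
      (⟪e, v⟫ < 0 → ∀ᶠ t in 𝓝[>] (0 : ℝ), (x + v ∈ P ↔ x + t • -e ∈ P)) ∧
      (⟪e, v⟫ = 0 → x + v ∈ P) ∧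
      (0 < ⟪e, v⟫ → ∀ᶠ t in 𝓝[>] (0 : ℝ), (x + v ∈ P ↔ x + t • e ∈ P)) := by
    filter_upwards [hx.eventually_sameCell e] with v hv hvW
    have hmem : v - ⟪e, v⟫ • e ∈ W₀ := by
      rw [hW₀]
      refine ⟨W.sub_mem hvW (W.smul_mem _ heW), ?_⟩
      rw [inner_sub_right, inner_smul_right, hee, mul_one, sub_self]
    have hv' := hv.mono fun t ht => ht _ hmem ⟪e, v⟫ (by simp)
    refine ⟨fun h => hv'.mono fun t ht => hP.mem_iff (ht.1 h), fun h => ?_,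
      fun h => hv'.mono fun t ht => hP.mem_iff (ht.2.2 h)⟩
    obtain ⟨t, ht⟩ := hv'.exists
    exact (hP.mem_iff (ht.2.1 h)).2 hxP
  have hfacet : ∀ F, IsFacet P F → (affineSpan ℝ F).direction = W₀ → x ∈ F →
      x ∈ FlagMeasures.regularBoundary P ∧
        F = closure (connectedComponentIn (FlagMeasures.regularBoundary P) x) :=
    fun F hF hdir hxF => hF.eq_closure_component hP hdir hx hxF
  -- The outcome where `P` is a half-space near `x`: exactly one facet contributes, and only its
  -- sign remains to be compared.
  have hsingle : ∀ (n : X), n = e ∨ n = -e →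
      (∀ᶠ v in 𝓝 (0 : X), v ∈ W → (x + v ∈ P ↔ 0 ≤ ⟪n, v⟫)) →
      (if AdjoinsFrom P (closure (connectedComponentIn (FlagMeasures.regularBoundary P) x)) H
        then (1 : ℝ) else -1) = jump e (P.indicator 1) x →
      ∑ᶠ F ∈ {F | IsFacet P F ∧ (affineSpan ℝ F).direction = W₀},
      (if AdjoinsFrom P F H then (1 : ℝ) else -1) * F.indicator 1 x =
      jump e (P.indicator 1) x := by
    intro n hn h hval
    have hnW : n ∈ W := by
      rcases hn with rfl | rfl
      · exact heW
      · exact W.neg_mem heW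
    have hn0 : n ≠ 0 := by rcases hn with rfl | rfl <;> simpa using he0
    have hxr : x ∈ FlagMeasures.regularBoundary P :=
      mem_regularBoundary_iff.2 ⟨hxP, n, hW ▸ hnW, hn0, by rwa [hW]⟩
    have hW₀' : ∀ w, w ∈ W₀ ↔ w ∈ W ∧ ⟪n, w⟫ = 0 := by
      rcases hn with rfl | rfl
      · exact hW₀
      · simpa using hW₀
    set F₀ := closure (connectedComponentIn (FlagMeasures.regularBoundary P) x) with hF₀
    have hF₀f : IsFacet P F₀ := ⟨x, hxr, rfl⟩
    have hF₀d : (affineSpan ℝ F₀).direction = W₀ := direction_component hP hW hW₀' hx hxr h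
    have hxF₀ : x ∈ F₀ := subset_closure (mem_connectedComponentIn hxr)
    rw [← hval]
    have : ∑ᶠ F ∈ {F | IsFacet P F ∧ (affineSpan ℝ F).direction = W₀},
        (if AdjoinsFrom P F H then (1 : ℝ) else -1) * F.indicator 1 x =
        ∑ᶠ F ∈ ({F₀} : Set (Set X)),
        (if AdjoinsFrom P F H then (1 : ℝ) else -1) * F.indicator 1 x := by
      refine finsum_mem_inter_support_eq' _ _ _ fun F hF => ?_
      have hxF : x ∈ F := by
        by_contra hxF
        refine hF ?_
        simp only
        rw [Set.indicator_of_notMem hxF, mul_zero]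
      rw [Set.mem_singleton_iff]
      constructor
      · exact fun h => (hfacet F h.1 h.2 hxF).2
      · rintro rfl
        exact ⟨hF₀f, hF₀d⟩
    rw [this, finsum_mem_singleton, Set.indicator_of_mem hxF₀]
    simp
  have hexists : ∀ {p : Prop} {u : X}, (∀ᶠ t in 𝓝[>] (0 : ℝ), (p ↔ x + t • u ∈ P)) →
      (∀ᶠ t in 𝓝[>] (0 : ℝ), x + t • u ∈ P) → p := by
    intro p u h1 h2
    obtain ⟨t, h3, h4⟩ := (h1.and h2).exists
    exact h3.2 h4
  have hexists' : ∀ {p : Prop} {u : X}, (∀ᶠ t in 𝓝[>] (0 : ℝ), (p ↔ x + t • u ∈ P)) →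
      (∀ᶠ t in 𝓝[>] (0 : ℝ), x + t • u ∉ P) → ¬ p := by
    intro p u h1 h2 hp
    obtain ⟨t, h3, h4⟩ := (h1.and h2).exists
    exact h4 (h3.1 hp)
  have hcone : ∀ v, v ∈ closure H ↔ v ∈ W ∧ ⟪e, v⟫ ≤ 0 := fun v => by rw [hH]; rfl
  -- `hm` and `hp` record whether `P` contains the points just below and just above `x`. A facet of
  -- direction `W₀` passes through `x` only when exactly one of the two sides is filled.
  rcases hP.ray_dichotomy x (-e) with hm | hm <;> rcases hP.ray_dichotomy x e with hp | hp
  · refine hempty ?_ fun F hF hdir hxF => ?_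
    · rw [jump, side_indicator_of_mem hm, side_indicator_of_mem hp, sub_self]
    · refine not_forall_mem_of_mem_regularBoundary (hfacet F hF hdir hxF).1 ?_
      rw [hW]
      filter_upwards [hgerm] with v hv hvW
      obtain ⟨h1, h2, h3⟩ := hv hvW
      rcases lt_trichotomy ⟪e, v⟫ 0 with h | h | h
      · exact hexists (h1 h) hm
      · exact h2 h
      · exact hexists (h3 h) hp
  · have hg : ∀ᶠ v in 𝓝 (0 : X), v ∈ W → (x + v ∈ P ↔ ⟪e, v⟫ ≤ 0) := by
      filter_upwards [hgerm] with v hv hvW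
      obtain ⟨h1, h2, h3⟩ := hv hvW
      rcases lt_trichotomy ⟪e, v⟫ 0 with h | h | h
      · exact ⟨fun _ => h.le, fun _ => hexists (h1 h) hm⟩
      · exact ⟨fun _ => h.le, fun _ => h2 h⟩
      · exact ⟨fun h' => absurd h' (hexists' (h3 h) hp), fun h' => absurd h (not_lt.2 h')⟩
    have hg' : ∀ᶠ v in 𝓝 (0 : X), v ∈ W → (x + v ∈ P ↔ 0 ≤ ⟪-e, v⟫) := by
      filter_upwards [hg] with v hv hvW
      rw [hv hvW, inner_neg_left, Left.nonneg_neg_iff]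
    refine hsingle (-e) (Or.inr rfl) hg' ?_
    rw [jump, side_indicator_of_mem hm, side_indicator_of_notMem hp, sub_zero, if_pos]
    have hxr : x ∈ FlagMeasures.regularBoundary P :=
      mem_regularBoundary_iff.2 ⟨hxP, -e, hW ▸ W.neg_mem heW, neg_ne_zero.2 he0, by rwa [hW]⟩
    refine ⟨x, subset_closure (mem_connectedComponentIn hxr), ?_⟩
    rw [eventually_affineSpan_iff hxP, hW]
    filter_upwards [hg] with v hv hvW
    rw [hv hvW, add_sub_cancel_left, hcone]
    exact ⟨fun h => ⟨hvW, h⟩, fun h => h.2⟩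
  · have hg : ∀ᶠ v in 𝓝 (0 : X), v ∈ W → (x + v ∈ P ↔ 0 ≤ ⟪e, v⟫) := by
      filter_upwards [hgerm] with v hv hvW
      obtain ⟨h1, h2, h3⟩ := hv hvW
      rcases lt_trichotomy ⟪e, v⟫ 0 with h | h | h
      · exact ⟨fun h' => absurd h' (hexists' (h1 h) hm), fun h' => absurd h (not_lt.2 h')⟩
      · exact ⟨fun _ => h.ge, fun _ => h2 h⟩
      · exact ⟨fun _ => h.le, fun _ => hexists (h3 h) hp⟩
    refine hsingle e (Or.inl rfl) hg ?_
    rw [jump, side_indicator_of_notMem hm, side_indicator_of_mem hp, zero_sub, if_neg]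
    -- The adjoining side may be witnessed at another point `y` of the closed facet. The half-space
    -- germ there makes `y` regular, so `y` lies in the component of `x` and the germ can be carried
    -- back to `x`, where `P` is empty below.
    rintro ⟨y, hy, hyg⟩
    have hxr : x ∈ FlagMeasures.regularBoundary P :=
      mem_regularBoundary_iff.2 ⟨hxP, e, hW ▸ heW, he0, by rwa [hW]⟩
    have hyP : y ∈ P := IsFacet.subset ⟨x, hxr, rfl⟩ hPc hy
    rw [eventually_affineSpan_iff hyP] at hyg
    have hyr : y ∈ FlagMeasures.regularBoundary P := by
      refine mem_regularBoundary_iff.2 ⟨hyP, -e, hW ▸ W.neg_mem heW, neg_ne_zero.2 he0, ?_⟩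
      filter_upwards [hyg] with v hv hvW
      rw [hv hvW, add_sub_cancel_left, hcone, ← hW, inner_neg_left, Left.nonneg_neg_iff]
      exact ⟨fun h => h.2, fun h => ⟨hvW, h⟩⟩
    have hyC := mem_component_of_mem_closure hxr hy hyr
    simp only [add_sub_cancel_left] at hyg
    have hgx := germ_const isPreconnected_connectedComponentIn (connectedComponentIn_subset _ _)
      hyC (mem_connectedComponentIn hxr) hyg
    have h1 := (tendsto_smul_nhdsGT (-e)).eventually hgx
    obtain ⟨t, h1, h2, ht0⟩ := (h1.and (hm.and self_mem_nhdsWithin)).exists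
    have ht0 : 0 < t := ht0
    have htW : t • -e ∈ W := W.smul_mem _ (W.neg_mem heW)
    refine h2 ((h1 (hW ▸ htW)).2 ((hcone _).2 ⟨htW, ?_⟩))
    rw [inner_smul_right, inner_neg_right, hee]
    linarith
  · refine hempty ?_ fun F hF hdir hxF => ?_
    · rw [jump, side_indicator_of_notMem hm, side_indicator_of_notMem hp, sub_self]
    · obtain ⟨_, n, hn, hn0, hng⟩ := mem_regularBoundary_iff.1 (hfacet F hF hdir hxF).1
      -- A half-space with `x` on its boundary contains one of the two rays from `x` along `e` and
      -- `-e`.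
      rcases le_total 0 ⟪n, e⟫ with h | h
      · have h1 := (tendsto_smul_nhdsGT (- -e)).eventually hng
        rw [neg_neg] at h1
        obtain ⟨t, h1, h2, ht0⟩ := (h1.and (hp.and self_mem_nhdsWithin)).exists
        have ht0 : 0 < t := ht0
        refine h2 ((h1 (hW ▸ W.smul_mem _ heW)).2 ?_)
        rw [inner_smul_right]
        positivity
      · have h1 := (tendsto_smul_nhdsGT (-e)).eventually hng
        obtain ⟨t, h1, h2, ht0⟩ := (h1.and (hm.and self_mem_nhdsWithin)).exists
        have ht0 : 0 < t := ht0
        refine h2 ((h1 (hW ▸ W.smul_mem _ (W.neg_mem heW))).2 ?_)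
        rw [inner_smul_right, inner_neg_right]
        nlinarith

end Facets

/-! ### Sequences of faces and iterated jumps -/

section Chains

variable {d : ℕ}

/-- The coordinate subspace spanned by the first `k` coordinates. -/
def coordSpace (d k : ℕ) : Submodule ℝ (EuclideanSpace ℝ (Fin d)) where
  carrier := {x | ∀ i : Fin d, k ≤ (i : ℕ) → x i = 0}
  add_mem' := fun {a b} ha hb i hi => by
    rw [PiLp.add_apply, ha i hi, hb i hi, add_zero]
  zero_mem' := fun i _ => rfl
  smul_mem' := fun c x hx i hi => by
    rw [PiLp.smul_apply, hx i hi, smul_zero]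

/-- The coordinate vectors, indexed by `ℕ` (and zero beyond the dimension). -/
noncomputable def stdVec (d k : ℕ) : EuclideanSpace ℝ (Fin d) :=
  if h : k < d then EuclideanSpace.single ⟨k, h⟩ 1 else 0

lemma stdVec_of_lt {k : ℕ} (h : k < d) : stdVec d k = EuclideanSpace.single ⟨k, h⟩ 1 := dif_pos h

lemma inner_stdVec {k : ℕ} (h : k < d) (x : EuclideanSpace ℝ (Fin d)) :
    ⟪stdVec d k, x⟫ = x ⟨k, h⟩ := by
  rw [stdVec_of_lt h, EuclideanSpace.inner_single_left]
  simp

lemma norm_stdVec {k : ℕ} (h : k < d) : ‖stdVec d k‖ = 1 := by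
  rw [stdVec_of_lt h]; simp

lemma mem_coordSpace_iff {k : ℕ} {x : EuclideanSpace ℝ (Fin d)} :
    x ∈ coordSpace d k ↔ ∀ j, k ≤ j → ⟪stdVec d j, x⟫ = 0 := by
  constructor
  · intro hx j hj
    by_cases h : j < d
    · rw [inner_stdVec h]; exact hx _ hj
    · rw [stdVec, dif_neg h, inner_zero_left]
  · intro hx i hi
    have := hx i hi
    rwa [inner_stdVec i.2] at this

lemma stdVec_mem_coordSpace {j k : ℕ} (h : j < k) : stdVec d j ∈ coordSpace d k := by
  intro i hi
  by_cases hj : j < d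
  · rw [stdVec_of_lt hj]
    have : i ≠ ⟨j, hj⟩ := by
      rintro rfl
      simp only at hi
      omega
    simp [this]
  · rw [stdVec, dif_neg hj]; rfl

lemma mem_coordSpace_succ {k : ℕ} {x : EuclideanSpace ℝ (Fin d)} :
    x ∈ coordSpace d k ↔ x ∈ coordSpace d (k + 1) ∧ ⟪stdVec d k, x⟫ = 0 := by
  simp only [mem_coordSpace_iff]
  constructor
  · exact fun h => ⟨fun j hj => h j (by omega), h k le_rfl⟩
  · rintro ⟨h1, h2⟩ j hj
    rcases hj.eq_or_lt with rfl | hj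
    · exact h2
    · exact h1 j hj

lemma coordSpace_mono {j k : ℕ} (h : j ≤ k) : coordSpace d j ≤ coordSpace d k :=
  fun _ hx i hi => hx i (h.trans hi)

lemma coordSpace_top : coordSpace d d = ⊤ := by
  rw [eq_top_iff]
  intro x _ i hi
  exact absurd i.2 (not_lt.2 hi)

lemma inner_stdVec_self {k : ℕ} (h : k < d) : ⟪stdVec d k, stdVec d k⟫ = 1 := by
  rw [real_inner_self_eq_norm_sq, norm_stdVec h]; norm_num

lemma coordSpace_decomp {k : ℕ} (hk : k < d) : ∀ w ∈ coordSpace d (k + 1),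
    ∃ v ∈ coordSpace d k, ∃ s : ℝ, w = v + s • stdVec d k := by
  intro w hw
  refine ⟨w - ⟪stdVec d k, w⟫ • stdVec d k, ?_, ⟪stdVec d k, w⟫, by simp⟩
  rw [mem_coordSpace_succ]
  refine ⟨Submodule.sub_mem _ hw (Submodule.smul_mem _ _ (stdVec_mem_coordSpace k.lt_succ_self)),
    ?_⟩
  rw [inner_sub_right, inner_smul_right, inner_stdVec_self hk, mul_one, sub_self]

/-- The iterated jumps of a function, down from the coordinate subspace of dimension `r + n`
to the one of dimension `r`. -/
noncomputable def iterJump (d r : ℕ) :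
    ℕ → (EuclideanSpace ℝ (Fin d) → ℝ) → EuclideanSpace ℝ (Fin d) → ℝ
  | 0, f => f
  | n + 1, f => iterJump d r n (jump (stdVec d (r + n)) f)

variable {ι : Type*} [Finite ι] {ℓ : ι → EuclideanSpace ℝ (Fin d) →ᵃ[ℝ] ℝ} {r : ℕ}

lemma iterJump_sum {κ : Type*} (s : Finset κ) (c : κ → ℝ) (n : ℕ)
    {f : κ → EuclideanSpace ℝ (Fin d) → ℝ} (hf : ∀ k ∈ s, Cellular ℓ (f k)) :
    iterJump d r n (fun x => ∑ k ∈ s, c k * f k x) =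
      fun x => ∑ k ∈ s, c k * iterJump d r n (f k) x := by
  induction n generalizing f with
  | zero => rfl
  | succ n ih =>
    simp only [iterJump]
    rw [jump_sum s c hf, ih fun k hk => (hf k hk).jump _]

/-- Each jump relaxes genericity by one coordinate direction, so after `n` jumps agreement on the
points generic for dimension `r + n` suffices. -/
lemma iterJump_congr (n : ℕ) (hn : r + n ≤ d) {f g : EuclideanSpace ℝ (Fin d) → ℝ}
    (hf : Cellular ℓ f) (hg : Cellular ℓ g)
    (hfg : ∀ x, Generic ℓ (coordSpace d (r + n)) x → f x = g x) {x : EuclideanSpace ℝ (Fin d)}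
    (hx : Generic ℓ (coordSpace d r) x) : iterJump d r n f x = iterJump d r n g x := by
  induction n generalizing f g with
  | zero => exact hfg x hx
  | succ n ih =>
    simp only [iterJump]
    exact ih (by omega) (hf.jump _) (hg.jump _) fun y hy =>
      jump_congr (coordSpace_decomp (by omega)) hg hfg hy

/-- The negative coordinate half-spaces, which determine the signs of the faces. -/
def lowerHalf (d k : ℕ) : Set (EuclideanSpace ℝ (Fin d)) :=
  {x | x ∈ coordSpace d (k + 1) ∧ ⟪stdVec d k, x⟫ < 0}

lemma closure_lowerHalf {k : ℕ} (hk : k < d) : closure (lowerHalf d k) =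
    {w | w ∈ coordSpace d (k + 1) ∧ ⟪stdVec d k, w⟫ ≤ 0} := by
  apply subset_antisymm
  · refine closure_minimal (fun x hx => ⟨hx.1, hx.2.le⟩) ?_
    have h : IsClosed {w : EuclideanSpace ℝ (Fin d) | ⟪stdVec d k, w⟫ ≤ 0} :=
      isClosed_le (by fun_prop) continuous_const
    exact (Submodule.closed_of_finiteDimensional (coordSpace d (k + 1))).inter h
  · rintro w ⟨hw, hw0⟩
    have hc : Tendsto (fun t : ℝ => w + t • -stdVec d k) (𝓝[>] 0) (𝓝 w) := by
      simpa using tendsto_const_nhds.add (tendsto_smul_nhdsGT (-stdVec d k))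
    refine mem_closure_of_tendsto hc ?_
    filter_upwards [self_mem_nhdsWithin] with t ht
    have ht : 0 < t := ht
    refine ⟨Submodule.add_mem _ hw (Submodule.smul_mem _ _ (Submodule.neg_mem _
      (stdVec_mem_coordSpace k.lt_succ_self))), ?_⟩
    rw [inner_add_right, inner_smul_right, inner_neg_right, inner_stdVec_self hk]
    linarith

/-- The sequences of faces parallel to the coordinate flag that end in the face `P`
of dimension `r + n`. -/
def chains (r n : ℕ) (P : Set (EuclideanSpace ℝ (Fin d))) :
    Set (ℕ → Set (EuclideanSpace ℝ (Fin d))) :=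
  {F | F (r + n) = P ∧ (∀ j, r ≤ j → j < r + n → IsFacet (F (j + 1)) (F j)) ∧
    (∀ j, r ≤ j → j < r + n → (affineSpan ℝ (F j)).direction = coordSpace d j) ∧
    (∀ j, j < r ∨ r + n < j → F j = ∅)}

lemma chains_zero (P : Set (EuclideanSpace ℝ (Fin d))) :
    chains r 0 P = {Function.update (fun _ => ∅) r P} := by
  ext F
  simp only [chains, Set.mem_ofPred_eq, add_zero, Set.mem_singleton_iff]
  constructor
  · rintro ⟨h1, -, -, h4⟩
    funext j
    rcases lt_trichotomy j r with h | rfl | h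
    · rw [Function.update_of_ne h.ne, h4 j (Or.inl h)]
    · rw [Function.update_self, h1]
    · rw [Function.update_of_ne h.ne', h4 j (Or.inr h)]
  · rintro rfl
    refine ⟨Function.update_self .., fun j h1 h2 => by omega, fun j h1 h2 => by omega, ?_⟩
    rintro j h
    exact Function.update_of_ne (by omega) _ _

/-- Sequences are sorted by the facet `Q` just below `P`. Dropping the top means resetting its entry
to `∅`, as the normalization outside the index range demands. -/
lemma chains_succ (n : ℕ) (P : Set (EuclideanSpace ℝ (Fin d))) :
    chains r (n + 1) P =
      ⋃ Q ∈ {Q | IsFacet P Q ∧ (affineSpan ℝ Q).direction = coordSpace d (r + n)},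
        (fun F => Function.update F (r + (n + 1)) P) '' chains r n Q := by
  ext F
  simp only [Set.mem_iUnion, Set.mem_image, exists_prop, Set.mem_ofPred_eq]
  constructor
  · rintro ⟨h1, h2, h3, h4⟩
    refine ⟨F (r + n), ⟨?_, h3 (r + n) (by omega) (by omega)⟩, Function.update F (r + (n + 1)) ∅,
      ⟨?_, ?_, ?_, ?_⟩, ?_⟩
    · rw [← h1]; exact h2 (r + n) (by omega) (by omega)
    · exact Function.update_of_ne (by omega) _ _
    · intro j hj hj'
      rw [Function.update_of_ne (by omega), Function.update_of_ne (by omega)]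
      exact h2 j hj (by omega)
    · intro j hj hj'
      rw [Function.update_of_ne (by omega)]
      exact h3 j hj (by omega)
    · intro j hj
      by_cases h : j = r + (n + 1)
      · rw [h, Function.update_self]
      · rw [Function.update_of_ne h]; exact h4 j (by omega)
    · rw [Function.update_idem, ← h1, Function.update_eq_self]
  · rintro ⟨Q, ⟨hQ, hQd⟩, G, ⟨h1, h2, h3, h4⟩, rfl⟩
    refine ⟨Function.update_self .., ?_, ?_, ?_⟩
    · intro j hj hj'
      by_cases h : j = r + n
      · subst h
        rw [Function.update_of_ne (show r + n ≠ r + (n + 1) by omega), h1]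
        have : r + n + 1 = r + (n + 1) := by omega
        rw [this, Function.update_self]
        exact hQ
      · rw [Function.update_of_ne (by omega), Function.update_of_ne (by omega)]
        exact h2 j hj (by omega)
    · intro j hj hj'
      rw [Function.update_of_ne (by omega)]
      by_cases h : j = r + n
      · rw [h, h1, hQd]
      · exact h3 j hj (by omega)
    · intro j hj
      rw [Function.update_of_ne (by omega)]
      exact h4 j (by omega)

omit [Finite ι] in
lemma chains_update_injOn (n : ℕ) (P Q : Set (EuclideanSpace ℝ (Fin d))) :
    Set.InjOn (fun F => Function.update F (r + (n + 1)) P) (chains r n Q) := by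
  intro F hF G hG h
  funext j
  by_cases hj : j = r + (n + 1)
  · rw [hF.2.2.2 j (by omega), hG.2.2.2 j (by omega)]
  · have := congrFun h j
    simpa only [Function.update_of_ne hj] using this

lemma finite_facets {P : Set (EuclideanSpace ℝ (Fin d))} (hP : CellularSet ℓ P)
    (W : Submodule ℝ (EuclideanSpace ℝ (Fin d))) :
    {Q | IsFacet P Q ∧ (affineSpan ℝ Q).direction = W}.Finite :=
  (finite_cellularSet (ℓ := ℓ)).subset fun _ hQ => hQ.1.cellularSet hP

lemma finite_chains (n : ℕ) {P : Set (EuclideanSpace ℝ (Fin d))} (hP : CellularSet ℓ P) :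
    (chains r n P).Finite := by
  induction n generalizing P with
  | zero => rw [chains_zero]; exact Set.finite_singleton _
  | succ n ih =>
    rw [chains_succ]
    exact (finite_facets hP _).biUnion fun Q hQ => (ih (hQ.1.cellularSet hP)).image _

lemma chains_bottom (n : ℕ) {P : Set (EuclideanSpace ℝ (Fin d))} (hP : CellularSet ℓ P)
    (hPc : IsClosed P) {F : ℕ → Set (EuclideanSpace ℝ (Fin d))} (hF : F ∈ chains r n P) :
    IsClosed (F r) ∧ F r ⊆ P := by
  induction n generalizing P F with
  | zero =>
    have : F r = P := hF.1
    rw [this]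
    exact ⟨hPc, subset_rfl⟩
  | succ n ih =>
    rw [chains_succ] at hF
    simp only [Set.mem_iUnion, Set.mem_image, exists_prop, Set.mem_ofPred_eq] at hF
    obtain ⟨Q, ⟨hQ, -⟩, G, hG, rfl⟩ := hF
    rw [Function.update_of_ne (by omega)]
    have := ih (hQ.cellularSet hP) hQ.isClosed hG
    exact ⟨this.1, this.2.trans (hQ.subset hPc)⟩

open Classical in
/-- The sign of a step in a sequence of faces. -/
noncomputable def stepSign (F : ℕ → Set (EuclideanSpace ℝ (Fin d))) (j : ℕ) : ℝ :=
  if AdjoinsFrom (F (j + 1)) (F j) (lowerHalf d j) then 1 else -1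

/-- The signed sum of the sequences of faces is given by iterated jumps. -/
theorem finsum_chains_eq_iterJump (n : ℕ) (hn : r + n ≤ d) {P : Set (EuclideanSpace ℝ (Fin d))}
    (hP : CellularSet ℓ P) (hPc : IsClosed P)
    (hdir : (affineSpan ℝ P).direction = coordSpace d (r + n)) {x : EuclideanSpace ℝ (Fin d)}
    (hx : Generic ℓ (coordSpace d r) x) :
    ∑ᶠ F ∈ chains r n P, (∏ j ∈ Finset.Ico r (r + n), stepSign F j) * (F r).indicator 1 x =
      iterJump d r n (P.indicator 1) x := by
  classical
  induction n generalizing P with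
  | zero => rw [chains_zero, finsum_mem_singleton]; simp [iterJump]
  | succ n ih =>
    have hfin := finite_facets hP (coordSpace d (r + n))
    set S := {Q | IsFacet P Q ∧ (affineSpan ℝ Q).direction = coordSpace d (r + n)} with hS
    have hdisj : S.PairwiseDisjoint
        (fun Q => (fun F => Function.update F (r + (n + 1)) P) '' chains r n Q) := by
      intro Q _ Q' _ hQQ'
      rw [Function.onFun, Set.disjoint_left]
      rintro _ ⟨F, hF, rfl⟩ ⟨G, hG, hFG⟩
      refine hQQ' ?_
      have := congrFun hFG (r + n)
      simp only [Function.update_of_ne (show r + n ≠ r + (n + 1) by omega)] at this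
      rw [← hF.1, ← hG.1, this]
    rw [chains_succ, finsum_mem_biUnion hdisj hfin
      fun Q hQ => (finite_chains n (hQ.1.cellularSet hP)).image _]
    have hterm : ∀ Q ∈ S, ∑ᶠ F ∈ (fun F => Function.update F (r + (n + 1)) P) '' chains r n Q,
        (∏ j ∈ Finset.Ico r (r + (n + 1)), stepSign F j) * (F r).indicator 1 x =
        (if AdjoinsFrom P Q (lowerHalf d (r + n)) then 1 else -1) *
          iterJump d r n (Q.indicator 1) x := by
      intro Q hQ
      rw [finsum_mem_image (chains_update_injOn n P Q),
        ← ih (by omega) (hQ.1.cellularSet hP) hQ.1.isClosed hQ.2,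
        finsum_mem_eq_finite_toFinset_sum _ (finite_chains n (hQ.1.cellularSet hP)),
        finsum_mem_eq_finite_toFinset_sum _ (finite_chains n (hQ.1.cellularSet hP)),
        Finset.mul_sum]
      refine Finset.sum_congr rfl fun F hF => ?_
      rw [Set.Finite.mem_toFinset] at hF
      rw [← add_assoc, Finset.prod_Ico_succ_top (by omega),
        Function.update_of_ne (show r ≠ r + n + 1 by omega)]
      have h1 : ∏ j ∈ Finset.Ico r (r + n), stepSign (Function.update F (r + n + 1) P) j =
          ∏ j ∈ Finset.Ico r (r + n), stepSign F j := by
        refine Finset.prod_congr rfl fun j hj => ?_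
        rw [Finset.mem_Ico] at hj
        rw [stepSign, stepSign, Function.update_of_ne (by omega), Function.update_of_ne (by omega)]
      have h2 : stepSign (Function.update F (r + n + 1) P) (r + n) =
          if AdjoinsFrom P Q (lowerHalf d (r + n)) then 1 else -1 := by
        rw [stepSign, Function.update_self, Function.update_of_ne (by omega), hF.1]
      rw [h1, h2]
      ring
    rw [finsum_mem_congr rfl hterm, finsum_mem_eq_finite_toFinset_sum _ hfin]
    have hc : ∀ Q ∈ hfin.toFinset, Cellular ℓ (Q.indicator (1 : EuclideanSpace ℝ (Fin d) → ℝ)) := by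
      intro Q hQ
      rw [Set.Finite.mem_toFinset] at hQ
      exact (hQ.1.cellularSet hP).indicator
    have hsum := congrFun (iterJump_sum (r := r) hfin.toFinset
      (fun Q => if AdjoinsFrom P Q (lowerHalf d (r + n)) then (1 : ℝ) else -1) n hc) x
    rw [← hsum, iterJump]
    -- The facet sum equals the jump of `P` only at generic points, which is enough under the
    -- remaining jumps.
    refine iterJump_congr n (by omega) (Cellular.sum _ _ hc) (hP.indicator.jump _) ?_ hx
    intro y hy
    have hn' : r + n < d := by omega
    have := finsum_facets_eq_jump (e := stdVec d (r + n)) (H := lowerHalf d (r + n)) (W₀ := coordSpace d (r + n))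
      hP hPc hdir (stdVec_mem_coordSpace (Nat.lt_succ_self _))
      (norm_stdVec hn') (fun w => mem_coordSpace_succ) (closure_lowerHalf hn') hy
    rw [← this, finsum_mem_eq_finite_toFinset_sum _ hfin]

end Chains

/-! ### Exponential integrals over simplices and the divergence theorem -/

section SimplexExp

open Complex

/-- The integral of the exponential function over a dilated standard simplex: the iterated
convolution of the functions `t ↦ exp (c * s i * t)` on the half-line, evaluated at `T`. -/
noncomputable def simplexExp (c : ℂ) : (k : ℕ) → (Fin (k + 1) → ℝ) → ℝ → ℂ
  | 0, s, T => exp (c * s 0 * T)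
  | k + 1, s, T => exp (c * s 0 * T) *
      ∫ t in (0 : ℝ)..T, exp (-(c * s 0 * t)) * simplexExp c k (Fin.tail s) t

variable {c : ℂ}

lemma continuous_simplexExp (k : ℕ) (s : Fin (k + 1) → ℝ) : Continuous (simplexExp c k s) := by
  induction k with
  | zero =>
    have : simplexExp c 0 s = fun T : ℝ => exp (c * s 0 * T) := rfl
    rw [this]; fun_prop
  | succ k ih =>
    have h := ih (Fin.tail s)
    have : simplexExp c (k + 1) s = fun T : ℝ => exp (c * s 0 * T) *
      ∫ t in (0 : ℝ)..T, exp (-(c * s 0 * t)) * simplexExp c k (Fin.tail s) t := rfl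
    rw [this]
    refine Continuous.mul (by fun_prop) ?_
    exact intervalIntegral.continuous_primitive
      (fun a b => (Continuous.mul (by fun_prop) h).intervalIntegrable a b) 0

lemma hasDerivAt_exp_mul (a : ℂ) (T : ℝ) :
    HasDerivAt (fun T : ℝ => exp (a * T)) (a * exp (a * T)) T := by
  have h : HasDerivAt (fun z : ℂ => exp (a * z)) (exp (a * T) * (a * 1)) (T : ℂ) :=
    ((hasDerivAt_id (T : ℂ)).const_mul a).cexp
  convert h.comp_ofReal using 1
  ring

lemma hasDerivAt_simplexExp_zero (s : Fin 1 → ℝ) (T : ℝ) :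
    HasDerivAt (simplexExp c 0 s) (c * s 0 * simplexExp c 0 s T) T := by
  exact hasDerivAt_exp_mul (c * s 0) T

lemma hasDerivAt_simplexExp (k : ℕ) (s : Fin (k + 2) → ℝ) (T : ℝ) :
    HasDerivAt (simplexExp c (k + 1) s)
      (c * s 0 * simplexExp c (k + 1) s T + simplexExp c k (Fin.tail s) T) T := by
  have hcont : Continuous fun t : ℝ => exp (-(c * s 0 * t)) * simplexExp c k (Fin.tail s) t :=
    Continuous.mul (by fun_prop) (continuous_simplexExp k _)
  have h1 := intervalIntegral.integral_hasDerivAt_right (hcont.intervalIntegrable 0 T)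
    (hcont.stronglyMeasurableAtFilter _ _) hcont.continuousAt
  have h2 := (hasDerivAt_exp_mul (c * s 0) T).mul h1
  have he : simplexExp c (k + 1) s = (fun T : ℝ => exp (c * s 0 * T)) *
      fun T => ∫ t in (0 : ℝ)..T, exp (-(c * s 0 * t)) * simplexExp c k (Fin.tail s) t := by
    funext T; rfl
  rw [he]
  refine h2.congr_deriv ?_
  have h3 : exp (c * s 0 * T) * exp (-(c * s 0 * T)) = 1 := by rw [← exp_add]; simp
  simp only [Pi.mul_apply]
  linear_combination (simplexExp c k (Fin.tail s) T) * h3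

lemma simplexExp_succ_zero (k : ℕ) (s : Fin (k + 2) → ℝ) : simplexExp c (k + 1) s 0 = 0 := by
  simp [simplexExp]

lemma eq_zero_of_linear_ode {R : ℝ → ℂ} {a : ℂ} (hR : ∀ T, HasDerivAt R (a * R T) T)
    (h0 : R 0 = 0) : R = 0 := by
  have h : ∀ T, HasDerivAt (fun T : ℝ => exp (-a * T) * R T) 0 T := by
    intro T
    refine ((hasDerivAt_exp_mul (-a) T).fun_mul (hR T)).congr_deriv ?_
    ring
  funext T
  have := is_const_of_deriv_eq_zero (fun T => (h T).differentiableAt) (fun T => (h T).deriv) T 0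
  simp only [h0, mul_zero] at this
  exact (mul_eq_zero.1 this).resolve_left (exp_ne_zero _)

/-- The divergence theorem for simplices: an exponential integral over a simplex, multiplied by
a directional frequency, is a combination of the integrals over the facets. -/
theorem simplexExp_facets (k : ℕ) (s : Fin (k + 2) → ℝ) (u : Fin (k + 2) → ℝ) (hu : ∑ i, u i = 0)
    (T : ℝ) : c * (∑ i, u i * s i : ℝ) * simplexExp c (k + 1) s T =
      -∑ i, (u i : ℂ) * simplexExp c k (s ∘ i.succAbove) T := by
  -- As a function of the dilation `T`, the defect of the identity solves `R' = c s₀ R` and vanishes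
  -- at `T = 0`.
  suffices h : (fun T => c * (∑ i, u i * s i : ℝ) * simplexExp c (k + 1) s T +
      ∑ i, (u i : ℂ) * simplexExp c k (s ∘ i.succAbove) T) = 0 by
    have := congrFun h T
    rw [Pi.zero_apply] at this
    linear_combination this
  induction k with
  | zero =>
    refine eq_zero_of_linear_ode (a := c * s 0) (fun T => ?_) ?_
    · have h1 := (hasDerivAt_simplexExp (c := c) 0 s T).const_mul (c * (∑ i, u i * s i : ℝ))
      have h2 : HasDerivAt (fun T => ∑ i, (u i : ℂ) * simplexExp c 0 (s ∘ i.succAbove) T) _ T :=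
        HasDerivAt.fun_sum fun i (_ : i ∈ Finset.univ) =>
          (hasDerivAt_simplexExp_zero (c := c) (s ∘ i.succAbove) T).const_mul (u i : ℂ)
      refine (h1.fun_add h2).congr_deriv ?_
      have h01 : u 1 = -u 0 := by rw [Fin.sum_univ_two] at hu; linarith
      have e1 : s ∘ Fin.succAbove 0 = Fin.tail s := by funext i; rfl
      have e2 : ((s ∘ Fin.succAbove 0) 0 : ℝ) = s 1 := rfl
      have e3 : ((s ∘ Fin.succAbove 1) 0 : ℝ) = s 0 := rfl
      rw [Fin.sum_univ_two, Fin.sum_univ_two, Fin.sum_univ_two, e2, e3, e1, h01]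
      push_cast
      ring
    · rw [simplexExp_succ_zero]
      have h01 : u 1 = -u 0 := by rw [Fin.sum_univ_two] at hu; linarith
      simp [simplexExp, Fin.sum_univ_two, h01]
  | succ k ih =>
    refine eq_zero_of_linear_ode (a := c * s 0) (fun T => ?_) ?_
    · have h1 := (hasDerivAt_simplexExp (c := c) (k + 1) s T).const_mul
        (c * (∑ i, u i * s i : ℝ))
      have h2 : HasDerivAt (fun T => ∑ i, (u i : ℂ) * simplexExp c (k + 1) (s ∘ i.succAbove) T)
          _ T :=
        HasDerivAt.fun_sum fun i (_ : i ∈ Finset.univ) =>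
          (hasDerivAt_simplexExp (c := c) k (s ∘ i.succAbove) T).const_mul (u i : ℂ)
      refine (h1.fun_add h2).congr_deriv ?_
      -- Differentiation discards vertex `0`; its weight moves to vertex `1`, so the weights still
      -- sum to zero. The defect `R` satisfies `R' - c s₀ R` equal to the defect for `Fin.tail s`
      -- with weights `v`, which is zero by induction.
      set v : Fin (k + 2) → ℝ := Fin.tail u + Pi.single 0 (u 0) with hv
      have hvsum : ∑ i, v i = 0 := by
        simp only [hv, Pi.add_apply, Finset.sum_add_distrib, Finset.sum_pi_single',
          Finset.mem_univ, if_true]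
        rw [Fin.sum_univ_succ] at hu
        simp only [Fin.tail]
        linarith
      have key := congrFun (ih (Fin.tail s) v hvsum) T
      simp only [Pi.zero_apply] at key
      have e0 : ∀ i : Fin (k + 2), Fin.tail (s ∘ i.succ.succAbove) =
          Fin.tail s ∘ i.succAbove := by
        intro i
        funext j
        simp [Fin.tail]
      have e1 : s ∘ Fin.succAbove 0 = Fin.tail s := by funext i; rfl
      have e2 : Fin.tail s 0 = s 1 := rfl
      have e3 : ∀ i : Fin (k + 2), (s ∘ i.succ.succAbove) 0 = s 0 := by intro i; simp
      have e4 : Fin.tail (Fin.tail s) = Fin.tail s ∘ Fin.succAbove 0 := by funext i; rfl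
      have f1 : ∑ i, v i * Fin.tail s i = ∑ i, u i * s i + u 0 * (s 1 - s 0) := by
        rw [Fin.sum_univ_succ (fun i => u i * s i)]
        simp only [hv, Pi.add_apply, add_mul, Finset.sum_add_distrib]
        have : ∑ i, Pi.single (M := fun _ => ℝ) 0 (u 0) i * Fin.tail s i = u 0 * s 1 := by
          rw [Finset.sum_eq_single 0]
          · rw [Pi.single_eq_same, e2]
          · intro i _ hi
            rw [Pi.single_eq_of_ne hi, zero_mul]
          · simp
        rw [this]
        simp only [Fin.tail]
        ring
      have f2 : ∑ i, (v i : ℂ) * simplexExp c k (Fin.tail s ∘ i.succAbove) T =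
          ∑ i : Fin (k + 2), (u i.succ : ℂ) * simplexExp c k (Fin.tail s ∘ i.succAbove) T +
            u 0 * simplexExp c k (Fin.tail s ∘ Fin.succAbove 0) T := by
        simp only [hv, Pi.add_apply, Complex.ofReal_add, add_mul, Finset.sum_add_distrib]
        congr 1
        rw [Finset.sum_eq_single 0]
        · rw [Pi.single_eq_same]
        · intro i _ hi
          rw [Pi.single_eq_of_ne hi]; simp
        · simp
      rw [f1, f2] at key
      have g1 : ∑ i, (u i : ℂ) * simplexExp c (k + 1) (s ∘ i.succAbove) T =
          u 0 * simplexExp c (k + 1) (Fin.tail s) T + ∑ i : Fin (k + 2),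
            (u i.succ : ℂ) * simplexExp c (k + 1) (s ∘ i.succ.succAbove) T := by
        rw [Fin.sum_univ_succ, e1]
      have g2 : ∑ i, (u i : ℂ) * (c * ((s ∘ i.succAbove) 0 : ℝ) * simplexExp c (k + 1)
          (s ∘ i.succAbove) T + simplexExp c k (Fin.tail (s ∘ i.succAbove)) T) =
          u 0 * (c * s 1 * simplexExp c (k + 1) (Fin.tail s) T +
            simplexExp c k (Fin.tail s ∘ Fin.succAbove 0) T) + ∑ i : Fin (k + 2),
            (u i.succ : ℂ) * (c * s 0 * simplexExp c (k + 1) (s ∘ i.succ.succAbove) T +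
              simplexExp c k (Fin.tail s ∘ i.succAbove) T) := by
        rw [Fin.sum_univ_succ, e1, e2, e4]
        simp only [e0, e3]
      rw [g1, g2]
      have g : ∑ i : Fin (k + 2), (u i.succ : ℂ) * (c * s 0 * simplexExp c (k + 1)
          (s ∘ i.succ.succAbove) T + simplexExp c k (Fin.tail s ∘ i.succAbove) T) =
          c * s 0 * ∑ i : Fin (k + 2), (u i.succ : ℂ) * simplexExp c (k + 1)
            (s ∘ i.succ.succAbove) T +
          ∑ i : Fin (k + 2), (u i.succ : ℂ) * simplexExp c k (Fin.tail s ∘ i.succAbove) T := by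
        rw [Finset.mul_sum, ← Finset.sum_add_distrib]
        exact Finset.sum_congr rfl fun i _ => by ring
      rw [g]
      push_cast at key ⊢
      linear_combination key
    · simp [simplexExp_succ_zero]

lemma norm_exp_mul_eq_one (hc : c.re = 0) (a b : ℝ) : ‖exp (c * a * b)‖ = 1 := by
  rw [norm_exp]
  simp [hc]

lemma norm_simplexExp_le_one (hc : c.re = 0) (k : ℕ) (s : Fin (k + 1) → ℝ) {T : ℝ} (h0 : 0 ≤ T)
    (h1 : T ≤ 1) : ‖simplexExp c k s T‖ ≤ 1 := by
  induction k generalizing T with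
  | zero => rw [simplexExp, norm_exp_mul_eq_one hc]
  | succ k ih =>
    rw [simplexExp, norm_mul, norm_exp_mul_eq_one hc, one_mul]
    have : ∀ t ∈ Set.uIoc 0 T, ‖exp (-(c * s 0 * t)) * simplexExp c k (Fin.tail s) t‖ ≤ 1 := by
      intro t ht
      rw [Set.uIoc_of_le h0] at ht
      have : -(c * s 0 * t) = c * s 0 * ((-t : ℝ) : ℂ) := by push_cast; ring
      rw [norm_mul, this, norm_exp_mul_eq_one hc, one_mul]
      exact ih _ ht.1.le (ht.2.trans h1)
    have := intervalIntegral.norm_integral_le_of_norm_le_const this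
    rw [sub_zero, abs_of_nonneg h0] at this
    linarith

end SimplexExp

/-! ### Integrals over simplices in coordinate planes, and their volumes -/

section SimplexIntegral

/-- The dilated standard simplex in `ℝᵏ`. -/
def corner (k : ℕ) (T : ℝ) : Set (Fin k → ℝ) := {t | (∀ i, 0 ≤ t i) ∧ ∑ i, t i ≤ T}

lemma isCompact_corner (k : ℕ) (T : ℝ) : IsCompact (corner k T) := by
  refine (isCompact_Icc (a := (0 : Fin k → ℝ)) (b := fun _ => T)).of_isClosed_subset ?_ ?_
  · have h1 : IsClosed {t : Fin k → ℝ | ∀ i, 0 ≤ t i} := by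
      simp only [Set.ofPred_forall]
      exact isClosed_iInter fun i => isClosed_le continuous_const (continuous_apply i)
    have h2 : IsClosed {t : Fin k → ℝ | ∑ i, t i ≤ T} :=
      isClosed_le (continuous_finsetSum _ fun i _ => continuous_apply i) continuous_const
    exact h1.inter h2
  · rintro t ⟨h0, h1⟩
    exact ⟨h0, fun i => (Finset.single_le_sum (fun j _ => h0 j) (Finset.mem_univ i)).trans h1⟩

lemma cons_mem_corner {k : ℕ} {T u : ℝ} {t : Fin k → ℝ} :
    (Fin.cons u t : Fin (k + 1) → ℝ) ∈ corner (k + 1) T ↔ 0 ≤ u ∧ t ∈ corner k (T - u) := by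
  simp only [corner, Set.mem_ofPred_eq, Fin.forall_fin_succ, Fin.cons_zero, Fin.cons_succ,
    Fin.sum_univ_succ, and_assoc]
  refine and_congr_right fun _ => and_congr_right fun _ => ?_
  constructor <;> intro h <;> linarith

/-- The exponential of a linear function in the coordinates of the standard simplex. -/
noncomputable def cornerExp (c : ℂ) (k : ℕ) (s : Fin (k + 1) → ℝ) (T : ℝ) (t : Fin k → ℝ) : ℂ :=
  Complex.exp (c * (∑ i, s i.castSucc * t i + s (Fin.last k) * (T - ∑ i, t i) : ℝ))

lemma continuous_cornerExp (c : ℂ) (k : ℕ) (s : Fin (k + 1) → ℝ) (T : ℝ) :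
    Continuous (cornerExp c k s T) := by
  unfold cornerExp
  fun_prop

lemma cornerExp_cons (c : ℂ) (k : ℕ) (s : Fin (k + 2) → ℝ) (T u : ℝ) (t : Fin k → ℝ) :
    cornerExp c (k + 1) s T (Fin.cons u t) =
      Complex.exp (c * s 0 * u) * cornerExp c k (Fin.tail s) (T - u) t := by
  unfold cornerExp
  rw [← Complex.exp_add]
  congr 1
  simp only [Fin.sum_univ_succ, Fin.cons_zero, Fin.cons_succ, Fin.castSucc_zero, Fin.tail,
    Fin.succ_castSucc, Fin.succ_last]
  push_cast
  ring

/-- Slicing by the first coordinate `u` gives a simplex of size `T - u`; Fubini and the substitution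
`u ↦ T - u` reproduce the convolution in `simplexExp`. -/
theorem setIntegral_cornerExp (c : ℂ) (k : ℕ) (s : Fin (k + 1) → ℝ) {T : ℝ} (hT : 0 ≤ T) :
    ∫ t in corner k T, cornerExp c k s T t = simplexExp c k s T := by
  induction k generalizing T with
  | zero =>
    have : corner 0 T = Set.univ := by
      ext t; simp [corner, hT]
    rw [this, setIntegral_univ, Measure.volume_pi_eq_dirac 0, integral_dirac]
    simp [cornerExp, simplexExp, mul_assoc]
  | succ k ih =>
    let e := MeasurableEquiv.piFinSuccAbove (fun _ : Fin (k + 1) => ℝ) 0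
    have he : MeasurePreserving e volume volume := volume_preserving_piFinSuccAbove _ 0
    let G : (Fin (k + 1) → ℝ) → ℂ := (corner (k + 1) T).indicator (cornerExp c (k + 1) s T)
    have hG : Integrable G volume :=
      ((continuous_cornerExp c _ s T).continuousOn.integrableOn_compact
        (isCompact_corner _ _)).integrable_indicator (isCompact_corner _ _).measurableSet
    have hes : ∀ y, e.symm y = Fin.cons y.1 y.2 := by
      intro y
      simp [e, MeasurableEquiv.piFinSuccAbove_symm_apply, Fin.insertNthEquiv]
    have h1 : ∫ t in corner (k + 1) T, cornerExp c (k + 1) s T t =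
        ∫ y : ℝ × (Fin k → ℝ), G (e.symm y) := by
      rw [← integral_indicator (isCompact_corner _ _).measurableSet]
      exact ((he.symm e).integral_comp' G).symm
    have hint : Integrable (fun y : ℝ × (Fin k → ℝ) => G (e.symm y))
        (volume.prod volume) :=
      ((he.symm e).integrable_comp_emb e.symm.measurableEmbedding).2 hG
    rw [h1, Measure.volume_eq_prod, integral_prod _ hint]
    have h2 : ∀ u : ℝ, ∫ t : Fin k → ℝ, G (e.symm (u, t)) =
        (Set.Icc 0 T).indicator
          (fun u => Complex.exp (c * s 0 * u) * simplexExp c k (Fin.tail s) (T - u)) u := by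
      intro u
      by_cases hu : u ∈ Set.Icc 0 T
      · rw [Set.indicator_of_mem hu, ← ih (Fin.tail s) (sub_nonneg.2 hu.2),
          ← integral_indicator (isCompact_corner _ _).measurableSet, ← integral_const_mul]
        refine integral_congr_ae (Eventually.of_forall fun t => ?_)
        simp only [hes, G]
        by_cases ht : t ∈ corner k (T - u)
        · rw [Set.indicator_of_mem (cons_mem_corner.2 ⟨hu.1, ht⟩), Set.indicator_of_mem ht,
            cornerExp_cons]
        · rw [Set.indicator_of_notMem (fun h => ht (cons_mem_corner.1 h).2),
            Set.indicator_of_notMem ht, mul_zero]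
      · rw [Set.indicator_of_notMem hu]
        refine integral_eq_zero_of_ae (Eventually.of_forall fun t => ?_)
        simp only [hes, G]
        rw [Set.indicator_of_notMem, Pi.zero_apply]
        intro h
        obtain ⟨h0, h3, h4⟩ := cons_mem_corner.1 h
        have : 0 ≤ ∑ i, t i := Finset.sum_nonneg fun i _ => h3 i
        exact hu ⟨h0, by linarith⟩
    simp only [h2]
    rw [integral_indicator measurableSet_Icc, integral_Icc_eq_integral_Ioc,
      ← intervalIntegral.integral_of_le hT]
    have h3 := intervalIntegral.integral_comp_sub_left (a := 0) (b := T)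
      (fun u => Complex.exp (c * s 0 * (T - u)) * simplexExp c k (Fin.tail s) u) T
    simp only [sub_zero, sub_self] at h3
    have h4 : ∀ x : ℝ, ((T : ℂ) - ((T - x : ℝ) : ℂ)) = x := by intro x; push_cast; ring
    simp only [h4] at h3
    rw [h3, simplexExp, ← intervalIntegral.integral_const_mul]
    refine intervalIntegral.integral_congr fun u _ => ?_
    rw [← mul_assoc, ← Complex.exp_add]
    congr 2
    ring

lemma mem_convexHull_range_iff {E κ : Type*} [AddCommGroup E] [Module ℝ E] [Fintype κ]
    {p : κ → E} {x : E} : x ∈ convexHull ℝ (Set.range p) ↔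
      ∃ w : κ → ℝ, (∀ i, 0 ≤ w i) ∧ ∑ i, w i = 1 ∧ ∑ i, w i • p i = x := by
  classical
  constructor
  · intro hx
    have hconv : Convex ℝ {x | ∃ w : κ → ℝ, (∀ i, 0 ≤ w i) ∧ ∑ i, w i = 1 ∧
        ∑ i, w i • p i = x} := by
      rintro _ ⟨w, hw0, hw1, rfl⟩ _ ⟨v, hv0, hv1, rfl⟩ a b ha hb hab
      refine ⟨a • w + b • v, fun i => ?_, ?_, ?_⟩
      · exact add_nonneg (mul_nonneg ha (hw0 i)) (mul_nonneg hb (hv0 i))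
      · simp [Finset.sum_add_distrib, ← Finset.mul_sum, hw1, hv1, hab]
      · simp [Finset.sum_add_distrib, Finset.smul_sum, add_smul, mul_smul]
    refine convexHull_min ?_ hconv hx
    rintro _ ⟨i, rfl⟩
    refine ⟨Pi.single i 1, fun j => ?_, by simp, ?_⟩
    · by_cases h : j = i
      · subst h; simp
      · simp [Pi.single_eq_of_ne h]
    · rw [Finset.sum_eq_single i]
      · simp
      · intro j _ hj; simp [Pi.single_eq_of_ne hj]
      · simp
  · rintro ⟨w, h0, h1, rfl⟩
    exact (convex_convexHull ℝ _).sum_mem (fun i _ => h0 i) h1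
      fun i _ => subset_convexHull ℝ _ (Set.mem_range_self i)

lemma sum_smul_eq_edges {E : Type*} [AddCommGroup E] [Module ℝ E] {k : ℕ} (p : Fin (k + 1) → E)
    (w : Fin (k + 1) → ℝ) (hw : ∑ i, w i = 1) : ∑ i, w i • p i =
      p (Fin.last k) + ∑ i : Fin k, w i.castSucc • (p i.castSucc - p (Fin.last k)) := by
  rw [Fin.sum_univ_castSucc] at hw ⊢
  have : w (Fin.last k) = 1 - ∑ i : Fin k, w i.castSucc := by linarith
  rw [this, sub_smul, one_smul, Finset.sum_smul]
  simp only [smul_sub, Finset.sum_sub_distrib]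
  abel

lemma convexHull_range_eq_image_corner {E : Type*} [AddCommGroup E] [Module ℝ E] {k : ℕ}
    (p : Fin (k + 1) → E) : convexHull ℝ (Set.range p) =
      (fun t : Fin k → ℝ => p (Fin.last k) + ∑ i, t i • (p i.castSucc - p (Fin.last k))) ''
        corner k 1 := by
  ext x
  rw [mem_convexHull_range_iff]
  constructor
  · rintro ⟨w, h0, h1, rfl⟩
    refine ⟨fun i => w i.castSucc, ⟨fun i => h0 _, ?_⟩, (sum_smul_eq_edges p w h1).symm⟩
    rw [← h1, Fin.sum_univ_castSucc]
    linarith [h0 (Fin.last k)]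
  · rintro ⟨t, ⟨h0, h1⟩, rfl⟩
    have hsum : ∑ i, (Fin.snoc t (1 - ∑ i, t i) : Fin (k + 1) → ℝ) i = 1 := by
      rw [Fin.sum_univ_castSucc]
      simp
    refine ⟨Fin.snoc t (1 - ∑ i, t i), fun i => ?_, hsum, ?_⟩
    · refine Fin.lastCases ?_ (fun j => ?_) i
      · simpa using h1
      · simpa using h0 j
    · rw [sum_smul_eq_edges p _ hsum]
      simp

variable {d : ℕ}

/-- The homogeneous coordinates of a tuple of points. -/
noncomputable def coordMatrix {k : ℕ} (p : Fin (k + 1) → EuclideanSpace ℝ (Fin d)) :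
    Matrix (Fin (k + 1)) (Fin (k + 1)) ℝ :=
  Matrix.of fun i => Fin.cons 1 fun j : Fin k => ⟪stdVec d j, p i⟫

/-- The normalized volume of a simplex parallel to a coordinate subspace. -/
noncomputable def simplexVol {k : ℕ} (p : Fin (k + 1) → EuclideanSpace ℝ (Fin d)) : ℝ :=
  |(coordMatrix p).det|

/-- The matrix of the edges of a simplex. -/
noncomputable def edgeMatrix {k : ℕ} (p : Fin (k + 1) → EuclideanSpace ℝ (Fin d)) :
    Matrix (Fin k) (Fin k) ℝ :=
  Matrix.of fun j i => ⟪stdVec d j, p i.castSucc - p (Fin.last k)⟫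

/-- Subtracting the last row from the others leaves a single nonzero entry in the column of ones. -/
lemma simplexVol_eq_abs_det_edgeMatrix {k : ℕ} (p : Fin (k + 1) → EuclideanSpace ℝ (Fin d)) :
    simplexVol p = |(edgeMatrix p).det| := by
  let B : Matrix (Fin (k + 1)) (Fin (k + 1)) ℝ := Matrix.of fun i j =>
    coordMatrix p i j - (if i = Fin.last k then 0 else coordMatrix p (Fin.last k) j)
  have h1 : (coordMatrix p).det = B.det := by
    refine Matrix.det_eq_of_forall_row_eq_smul_add_const
      (fun i => if i = Fin.last k then 0 else 1) (Fin.last k) (by simp) fun i j => ?_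
    by_cases hi : i = Fin.last k <;> simp [B, hi]
  rw [simplexVol, h1, Matrix.det_succ_column_zero, Finset.sum_eq_single (Fin.last k)]
  · have h2 : B (Fin.last k) 0 = 1 := by simp [B, coordMatrix]
    rw [h2, abs_mul, abs_mul, abs_pow, abs_neg, abs_one, one_pow, one_mul, one_mul,
      ← Matrix.det_transpose (edgeMatrix p)]
    congr 2
    ext i j
    simp [B, coordMatrix, edgeMatrix, inner_sub_right, Fin.castSucc_ne_last]
  · intro i _ hi
    have : B i 0 = 0 := by simp [B, coordMatrix, hi]
    rw [this]; ring
  · simp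

/-- Height times base: subtracting `b` times the column of ones from the last column kills all its
entries except possibly the one of vertex `i`. -/
lemma simplexVol_eq_mul_simplexVol_facet {k : ℕ} (p : Fin (k + 2) → EuclideanSpace ℝ (Fin d))
    (i : Fin (k + 2)) {b : ℝ} (hb : ∀ j, ⟪stdVec d k, p (i.succAbove j)⟫ = b) :
    simplexVol p = |⟪stdVec d k, p i⟫ - b| * simplexVol (p ∘ i.succAbove) := by
  let B : Matrix (Fin (k + 2)) (Fin (k + 2)) ℝ := Matrix.of fun j l =>
    coordMatrix p l j - (if j = Fin.last (k + 1) then b else 0)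
  have hlast : ∀ j, B (Fin.last (k + 1)) j = ⟪stdVec d k, p j⟫ - b := by
    intro j
    have : Fin.last (k + 1) = (Fin.last k).succ := rfl
    simp only [B, Matrix.of_apply, if_true, coordMatrix]
    rw [this, Fin.cons_succ]
    simp
  have h1 : (coordMatrix p).det = B.det := by
    rw [← Matrix.det_transpose]
    refine Matrix.det_eq_of_forall_row_eq_smul_add_const
      (fun i => if i = Fin.last (k + 1) then b else 0) 0 ?_ fun i j => ?_
    · simp [Fin.ext_iff]
    · have h0 : B 0 j = 1 := by simp [B, coordMatrix, Fin.ext_iff]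
      rw [h0]
      by_cases hi : i = Fin.last (k + 1) <;> simp [B, hi]
  rw [simplexVol, h1, Matrix.det_succ_row _ (Fin.last (k + 1)), Finset.sum_eq_single i]
  · rw [hlast, abs_mul, abs_mul, abs_pow, abs_neg, abs_one, one_pow, one_mul, simplexVol,
      ← Matrix.det_transpose (coordMatrix (p ∘ i.succAbove))]
    congr 3
    ext a j
    have ha : a.castSucc ≠ Fin.last (k + 1) := Fin.castSucc_ne_last a
    simp only [B, Matrix.submatrix_apply, Fin.succAbove_last, Matrix.of_apply, if_neg ha,
      Matrix.transpose_apply, coordMatrix, sub_zero, Function.comp_apply]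
    refine Fin.cases ?_ (fun a' => ?_) a
    · simp
    · rw [← Fin.succ_castSucc, Fin.cons_succ, Fin.cons_succ]
      simp
  · intro j _ hj
    obtain ⟨l, rfl⟩ := Fin.exists_succAbove_eq hj
    rw [hlast, hb l]; ring
  · simp

/-- The isometric embedding of `ℝᵏ` onto a coordinate subspace of `ℝᵈ`. -/
noncomputable def coordEmb (d k : ℕ) : EuclideanSpace ℝ (Fin k) →ₗ[ℝ] EuclideanSpace ℝ (Fin d) where
  toFun y := WithLp.toLp 2 fun j => if h : (j : ℕ) < k then y ⟨j, h⟩ else 0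
  map_add' x y := by
    ext j
    by_cases h : (j : ℕ) < k <;> simp [h]
  map_smul' a x := by
    ext j
    by_cases h : (j : ℕ) < k <;> simp [h]

lemma coordEmb_apply {k : ℕ} (y : EuclideanSpace ℝ (Fin k)) (j : Fin d) :
    coordEmb d k y j = if h : (j : ℕ) < k then y ⟨j, h⟩ else 0 := rfl

lemma isometry_coordEmb {k : ℕ} (hk : k ≤ d) : Isometry (coordEmb d k) := by
  refine AddMonoidHomClass.isometry_of_norm _ fun y => ?_
  rw [EuclideanSpace.norm_eq, EuclideanSpace.norm_eq]
  congr 1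
  refine (Fintype.sum_of_injective (Fin.castLE hk) (Fin.castLE_injective hk) _ _ ?_ ?_).symm
  · intro i hi
    have : ¬ (i : ℕ) < k := fun h => hi ⟨⟨i, h⟩, rfl⟩
    simp [coordEmb_apply, this]
  · intro i
    simp [coordEmb_apply]

lemma coordEmb_surj {k : ℕ} {w : EuclideanSpace ℝ (Fin d)}
    (hw : w ∈ coordSpace d k) :
    coordEmb d k (WithLp.toLp 2 fun j : Fin k => ⟪stdVec d j, w⟫) = w := by
  ext j
  rw [coordEmb_apply]
  split_ifs with h
  · change ⟪stdVec d j, w⟫ = w j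
    rw [inner_stdVec j.2]
  · exact (hw j (not_lt.1 h)).symm

/-- The integral over a subset of a translate of a coordinate subspace. -/
lemma setIntegral_coordPlane {k : ℕ} (hk : k ≤ d) (a : EuclideanSpace ℝ (Fin d))
    (B : Set (EuclideanSpace ℝ (Fin k))) (f : EuclideanSpace ℝ (Fin d) → ℂ) :
    ∫ x in (fun y => a + coordEmb d k y) '' B, f x ∂μHE[k] =
      ∫ y in B, f (a + coordEmb d k y) := by
  have hφ : Isometry (fun y => a + coordEmb d k y) :=
    (isometry_add_left a).comp (isometry_coordEmb hk)
  have hemb : MeasurableEmbedding (fun y => a + coordEmb d k y) :=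
    hφ.isClosedEmbedding.measurableEmbedding
  have h1 := hφ.map_euclideanHausdorffMeasure (d := k)
  rw [EuclideanSpace.euclideanHausdorffMeasure_eq_volume] at h1
  have h2 : (μHE[k] : Measure (EuclideanSpace ℝ (Fin d))).restrict
      ((fun y => a + coordEmb d k y) '' B) =
      (Measure.map (fun y => a + coordEmb d k y) volume).restrict
        ((fun y => a + coordEmb d k y) '' B) := by
    rw [h1, Measure.restrict_restrict_of_subset (Set.image_subset_range _ _)]
  rw [h2, hemb.setIntegral_map, Set.preimage_image_eq _ hφ.injective]

lemma setIntegral_linear_image {k : ℕ} (A : Matrix (Fin k) (Fin k) ℝ) {S : Set (Fin k → ℝ)}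
    (hS : MeasurableSet S) (f : (Fin k → ℝ) → ℂ) :
    ∫ y in Matrix.toLin' A '' S, f y = |A.det| * ∫ t in S, f (Matrix.toLin' A t) := by
  -- In the degenerate case the image is a null set and both sides vanish.
  by_cases hA : A.det = 0
  · have h0 : volume (Matrix.toLin' A '' S) = 0 := by
      rw [Measure.addHaar_image_linearMap, LinearMap.det_toLin', hA]
      simp
    rw [Measure.restrict_eq_zero.2 h0, hA]
    simp
  · let L : (Fin k → ℝ) →L[ℝ] (Fin k → ℝ) := LinearMap.toContinuousLinearMap (Matrix.toLin' A)
    have hinj : Function.Injective (Matrix.toLin' A) := by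
      have hu : IsUnit A := (Matrix.isUnit_iff_isUnit_det A).2 (isUnit_iff_ne_zero.2 hA)
      intro x y hxy
      rw [Matrix.toLin'_apply, Matrix.toLin'_apply] at hxy
      exact Matrix.mulVec_injective_iff_isUnit.2 hu hxy
    have := integral_image_eq_integral_abs_det_fderiv_smul volume hS
      (f := Matrix.toLin' A) (f' := fun _ => L)
      (fun x _ => (L.hasFDerivAt (x := x)).hasFDerivWithinAt) hinj.injOn f
    rw [this]
    have hdet : L.det = A.det := by
      rw [← LinearMap.det_toLin' A]
      rfl
    rw [hdet, ← integral_const_mul]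
    simp

/-- The exponential integral over a simplex parallel to a coordinate subspace. -/
theorem setIntegral_simplex {k : ℕ} (hk : k ≤ d) (p : Fin (k + 1) → EuclideanSpace ℝ (Fin d))
    (hp : vectorSpan ℝ (Set.range p) ≤ coordSpace d k) (c : ℂ) (ξ : EuclideanSpace ℝ (Fin d)) :
    ∫ x in convexHull ℝ (Set.range p), Complex.exp (c * (⟪ξ, x⟫ : ℝ)) ∂μHE[k] =
      simplexVol p * simplexExp c k (fun i => ⟪ξ, p i⟫) 1 := by
  have hmem : ∀ i : Fin k, p i.castSucc - p (Fin.last k) ∈ coordSpace d k := fun i =>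
    hp (vsub_mem_vectorSpan ℝ (Set.mem_range_self _) (Set.mem_range_self _))
  have hedge : ∀ t : Fin k → ℝ, ∑ i, t i • (p i.castSucc - p (Fin.last k)) =
      coordEmb d k (WithLp.toLp 2 (Matrix.toLin' (edgeMatrix p) t)) := by
    intro t
    have h1 : ∑ i, t i • (p i.castSucc - p (Fin.last k)) ∈ coordSpace d k :=
      Submodule.sum_mem _ fun i _ => Submodule.smul_mem _ _ (hmem i)
    rw [← coordEmb_surj h1]
    congr 2
    funext j
    rw [Matrix.toLin'_apply, Matrix.mulVec, dotProduct, inner_sum]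
    refine Finset.sum_congr rfl fun i _ => ?_
    rw [inner_smul_right, edgeMatrix, Matrix.of_apply, mul_comm]
  have himage : convexHull ℝ (Set.range p) = (fun y => p (Fin.last k) + coordEmb d k y) ''
      (WithLp.toLp 2 '' (Matrix.toLin' (edgeMatrix p) '' corner k 1)) := by
    rw [convexHull_range_eq_image_corner, Set.image_image, Set.image_image]
    exact Set.image_congr fun t _ => by rw [hedge]
  have hvol := PiLp.volume_preserving_toLp (Fin k)
  have hembL : MeasurableEmbedding (WithLp.toLp 2 : (Fin k → ℝ) → EuclideanSpace ℝ (Fin k)) :=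
    (MeasurableEquiv.toLp 2 (Fin k → ℝ)).measurableEmbedding
  rw [himage, setIntegral_coordPlane hk, hvol.setIntegral_image_emb hembL,
    setIntegral_linear_image _ (isCompact_corner k 1).measurableSet,
    simplexVol_eq_abs_det_edgeMatrix, ← setIntegral_cornerExp c k _ zero_le_one]
  congr 1
  refine integral_congr_ae (Eventually.of_forall fun t => ?_)
  simp only
  rw [← hedge, cornerExp, inner_add_right, inner_sum]
  congr 3
  simp only [inner_smul_right, inner_sub_right, mul_sub, Finset.sum_sub_distrib]
  rw [Finset.mul_sum]
  simp only [mul_comm]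
  ring

end SimplexIntegral

/-! ### Barycentric coordinates as affine functionals on the whole space -/

section DualFunctionals

variable {X : Type*} [AddCommGroup X] [Module ℝ X] {k : ℕ}

/-- The functionals `f i` restrict to the barycentric coordinates of the simplex `p`. -/
def IsDual (f : Fin (k + 1) → X →ᵃ[ℝ] ℝ) (p : Fin (k + 1) → X) : Prop :=
  ∀ i j, f i (p j) = if i = j then 1 else 0

/-- Because the functionals live on all of `X`, faces of every dimension inherit them and one
arrangement serves throughout. -/
lemma IsDual.face {f : Fin (k + 2) → X →ᵃ[ℝ] ℝ} {p : Fin (k + 2) → X} (h : IsDual f p)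
    (i : Fin (k + 2)) : IsDual (f ∘ i.succAbove) (p ∘ i.succAbove) := by
  intro a b
  simp only [Function.comp_apply]
  rw [h]
  simp

variable {f : Fin (k + 1) → X →ᵃ[ℝ] ℝ} {p : Fin (k + 1) → X}

lemma affine_sum_smul {κ : Type*} [Fintype κ] (g : X →ᵃ[ℝ] ℝ) (p : κ → X) (w : κ → ℝ)
    (hw : ∑ i, w i = 1) : g (∑ i, w i • p i) = ∑ i, w i * g (p i) := by
  have h1 := Finset.univ.affineCombination_eq_linear_combination p w hw
  have h2 := Finset.univ.affineCombination_eq_linear_combination (g ∘ p) w hw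
  rw [← h1, Finset.map_affineCombination _ _ _ hw, h2]
  simp

lemma IsDual.apply_sum (h : IsDual f p) {w : Fin (k + 1) → ℝ} (hw : ∑ i, w i = 1)
    (i : Fin (k + 1)) : f i (∑ j, w j • p j) = w i := by
  rw [affine_sum_smul _ _ _ hw]
  simp [h i]

lemma IsDual.eq_sum (h : IsDual f p) {x : X} (hx : x ∈ affineSpan ℝ (Set.range p)) :
    x = ∑ i, f i x • p i ∧ ∑ i, f i x = 1 := by
  obtain ⟨w, hw, rfl⟩ := eq_affineCombination_of_mem_affineSpan_of_fintype hx
  rw [Finset.univ.affineCombination_eq_linear_combination p w hw]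
  simp only [h.apply_sum hw]
  exact ⟨trivial, hw⟩

lemma IsDual.eq_sum_linear (h : IsDual f p) {w : X} (hw : w ∈ vectorSpan ℝ (Set.range p)) :
    w = ∑ i, (f i).linear w • p i ∧ ∑ i, (f i).linear w = 0 := by
  have h0 : p 0 ∈ affineSpan ℝ (Set.range p) := mem_affineSpan ℝ (Set.mem_range_self 0)
  have hx : w +ᵥ p 0 ∈ affineSpan ℝ (Set.range p) :=
    AffineSubspace.vadd_mem_of_mem_direction (by rwa [direction_affineSpan]) h0
  obtain ⟨h1, h2⟩ := h.eq_sum hx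
  obtain ⟨h3, h4⟩ := h.eq_sum h0
  have e : ∀ i, f i (w +ᵥ p 0) = (f i).linear w + f i (p 0) := by
    intro i; rw [AffineMap.map_vadd]; rfl
  simp only [e, add_smul, Finset.sum_add_distrib] at h1 h2
  rw [← h3, vadd_eq_add] at h1
  rw [h4] at h2
  exact ⟨add_right_cancel h1, by linarith⟩

lemma IsDual.linear_sub (h : IsDual f p) (i j l : Fin (k + 1)) :
    (f i).linear (p j - p l) = (if i = j then 1 else 0) - (if i = l then 1 else 0) := by
  have := (f i).linearMap_vsub (p j) (p l)
  rw [vsub_eq_sub, vsub_eq_sub] at this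
  rw [this, h, h]

lemma IsDual.mem_hull_iff (h : IsDual f p) {x : X} : x ∈ convexHull ℝ (Set.range p) ↔
    x ∈ affineSpan ℝ (Set.range p) ∧ ∀ i, 0 ≤ f i x := by
  constructor
  · intro hx
    refine ⟨convexHull_subset_affineSpan _ hx, ?_⟩
    obtain ⟨w, h0, h1, rfl⟩ := mem_convexHull_range_iff.1 hx
    intro i
    rw [h.apply_sum h1]
    exact h0 i
  · rintro ⟨hx, h0⟩
    obtain ⟨h1, h2⟩ := h.eq_sum hx
    exact mem_convexHull_range_iff.2 ⟨fun i => f i x, h0, h2, h1.symm⟩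

lemma IsDual.mem_hull_face_iff {f : Fin (k + 2) → X →ᵃ[ℝ] ℝ} {p : Fin (k + 2) → X}
    (h : IsDual f p) (i : Fin (k + 2)) {x : X} :
    x ∈ convexHull ℝ (Set.range (p ∘ i.succAbove)) ↔
      x ∈ convexHull ℝ (Set.range p) ∧ f i x = 0 := by
  constructor
  · intro hx
    refine ⟨convexHull_mono (Set.range_comp_subset_range _ _) hx, ?_⟩
    obtain ⟨w, h0, h1, rfl⟩ := mem_convexHull_range_iff.1 hx
    rw [affine_sum_smul _ _ _ h1]
    refine Finset.sum_eq_zero fun j _ => ?_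
    rw [Function.comp_apply, h, if_neg (Fin.succAbove_ne i j).symm, mul_zero]
  · rintro ⟨hx, h0⟩
    obtain ⟨w, hw0, hw1, rfl⟩ := mem_convexHull_range_iff.1 hx
    rw [h.apply_sum hw1] at h0
    refine mem_convexHull_range_iff.2 ⟨fun j => w (i.succAbove j), fun j => hw0 _, ?_, ?_⟩
    · rw [Fin.sum_univ_succAbove _ i, h0, zero_add] at hw1
      exact hw1
    · rw [Fin.sum_univ_succAbove _ i, h0, zero_smul, zero_add]
      rfl

lemma IsDual.mem_vectorSpan_face_iff {f : Fin (k + 2) → X →ᵃ[ℝ] ℝ} {p : Fin (k + 2) → X}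
    (h : IsDual f p) (i : Fin (k + 2)) {w : X} :
    w ∈ vectorSpan ℝ (Set.range (p ∘ i.succAbove)) ↔
      w ∈ vectorSpan ℝ (Set.range p) ∧ (f i).linear w = 0 := by
  constructor
  · intro hw
    refine ⟨vectorSpan_mono ℝ (Set.range_comp_subset_range _ _) hw, ?_⟩
    have hle : vectorSpan ℝ (Set.range (p ∘ i.succAbove)) ≤ LinearMap.ker (f i).linear := by
      rw [vectorSpan_def, Submodule.span_le]
      rintro _ ⟨_, ⟨a, rfl⟩, _, ⟨b, rfl⟩, rfl⟩
      rw [SetLike.mem_coe, LinearMap.mem_ker]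
      simp only [Function.comp_apply, vsub_eq_sub]
      rw [h.linear_sub, if_neg (Fin.succAbove_ne i a).symm, if_neg (Fin.succAbove_ne i b).symm,
        sub_zero]
    exact hle hw
  · rintro ⟨hw, h0⟩
    obtain ⟨h1, h2⟩ := h.eq_sum_linear hw
    rw [Fin.sum_univ_succAbove _ i, h0, zero_smul, zero_add] at h1
    rw [Fin.sum_univ_succAbove _ i, h0, zero_add] at h2
    have h3 : w = ∑ j, (f (i.succAbove j)).linear w •
        ((p ∘ i.succAbove) j - (p ∘ i.succAbove) 0) := by
      simp only [smul_sub, Finset.sum_sub_distrib, ← Finset.sum_smul, h2, zero_smul, sub_zero]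
      exact h1
    rw [h3]
    exact Submodule.sum_mem _ fun j _ => Submodule.smul_mem _ _
      (vsub_mem_vectorSpan ℝ (Set.mem_range_self _) (Set.mem_range_self _))

end DualFunctionals

/-! ### Pivots of a subspace -/

section Pivots

variable {d : ℕ}

open Classical in
/-- The positions of the last nonzero coordinates of the vectors of a subspace. -/
noncomputable def pivots (W : Submodule ℝ (EuclideanSpace ℝ (Fin d))) : Finset ℕ :=
  (Finset.range d).filter fun j => ∃ w ∈ W, w ∈ coordSpace d (j + 1) ∧ ⟪stdVec d j, w⟫ ≠ 0

lemma mem_pivots {W : Submodule ℝ (EuclideanSpace ℝ (Fin d))} {j : ℕ} :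
    j ∈ pivots W ↔ j < d ∧ ∃ w ∈ W, w ∈ coordSpace d (j + 1) ∧ ⟪stdVec d j, w⟫ ≠ 0 := by
  simp [pivots]

lemma pivots_nonempty {W : Submodule ℝ (EuclideanSpace ℝ (Fin d))} {w : EuclideanSpace ℝ (Fin d)}
    (hw : w ∈ W) (h0 : w ≠ 0) : (pivots W).Nonempty := by
  classical
  have hex : ∃ n, w ∈ coordSpace d n := ⟨d, by rw [coordSpace_top]; trivial⟩
  have hspec := Nat.find_spec hex
  have hmin : ∀ m, m < Nat.find hex → w ∉ coordSpace d m := fun m hm => Nat.find_min hex hm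
  have hle : Nat.find hex ≤ d := Nat.find_min' hex (by rw [coordSpace_top]; trivial)
  rcases Nat.eq_zero_or_pos (Nat.find hex) with h | h
  · rw [h] at hspec
    refine absurd ?_ h0
    ext i
    exact hspec i (Nat.zero_le _)
  · obtain ⟨m, hm⟩ : ∃ m, Nat.find hex = m + 1 := ⟨Nat.find hex - 1, by omega⟩
    rw [hm] at hspec hle
    refine ⟨m, mem_pivots.2 ⟨by omega, w, hw, hspec, fun h => ?_⟩⟩
    exact hmin m (by omega) (mem_coordSpace_succ.2 ⟨hspec, h⟩)

lemma pivots_mono {W W' : Submodule ℝ (EuclideanSpace ℝ (Fin d))} (h : W' ≤ W) :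
    pivots W' ⊆ pivots W := by
  intro j hj
  obtain ⟨hjd, w, hw, h1⟩ := mem_pivots.1 hj
  exact mem_pivots.2 ⟨hjd, w, h hw, h1⟩

/-- Cutting by a hyperplane loses at most one pivot. If `a` is lost, a vector `v` with last nonzero
coordinate `a` has `φ v ≠ 0`, and subtracting a multiple of `v` moves a vector with a later pivot
into `W'` without touching that pivot. -/
lemma pivots_subset_insert {W W' : Submodule ℝ (EuclideanSpace ℝ (Fin d))}
    {φ : EuclideanSpace ℝ (Fin d) →ₗ[ℝ] ℝ} (h : ∀ w, w ∈ W' ↔ w ∈ W ∧ φ w = 0) :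
    ∃ q, pivots W ⊆ insert q (pivots W') := by
  have key : ∀ a b, a < b → a ∈ pivots W → b ∈ pivots W → a ∉ pivots W' → b ∈ pivots W' := by
    intro a b hab ha hb ha'
    obtain ⟨had, v, hv, hv1, hv2⟩ := mem_pivots.1 ha
    obtain ⟨hbd, w, hw, hw1, hw2⟩ := mem_pivots.1 hb
    have hφv : φ v ≠ 0 := fun h0 => ha' (mem_pivots.2 ⟨had, v, (h v).2 ⟨hv, h0⟩, hv1, hv2⟩)
    have hvb : v ∈ coordSpace d b := coordSpace_mono (by omega) hv1
    refine mem_pivots.2 ⟨hbd, w - (φ w / φ v) • v, (h _).2 ⟨W.sub_mem hw (W.smul_mem _ hv), ?_⟩,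
      Submodule.sub_mem _ hw1 (Submodule.smul_mem _ _ (coordSpace_mono (by omega) hvb)), ?_⟩
    · rw [map_sub, map_smul, smul_eq_mul, div_mul_cancel₀ _ hφv, sub_self]
    · rw [inner_sub_right, inner_smul_right, mem_coordSpace_iff.1 hvb b le_rfl, mul_zero, sub_zero]
      exact hw2
  by_cases hq : ∃ q ∈ pivots W, q ∉ pivots W'
  · obtain ⟨q, hq, hq'⟩ := hq
    refine ⟨q, fun j hj => ?_⟩
    rw [Finset.mem_insert]
    rcases lt_trichotomy j q with hjq | hjq | hjq
    · by_contra hcon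
      push Not at hcon
      exact hq' (key j q hjq hj hq hcon.2)
    · exact Or.inl hjq
    · exact Or.inr (key q j hjq hq hj hq')
  · push Not at hq
    exact ⟨0, fun j hj => Finset.mem_insert_of_mem (hq j hj)⟩

lemma pivots_coordSpace {k : ℕ} (hk : k ≤ d) : pivots (coordSpace d k) = Finset.range k := by
  ext j
  rw [mem_pivots, Finset.mem_range]
  constructor
  · rintro ⟨_, w, hw, _, h⟩
    by_contra hj
    exact h (mem_coordSpace_iff.1 hw j (not_lt.1 hj))
  · intro hj
    refine ⟨by omega, stdVec d j, stdVec_mem_coordSpace hj, stdVec_mem_coordSpace (by omega), ?_⟩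
    rw [inner_stdVec_self (by omega)]
    exact one_ne_zero

/-- Without the pivot `k`, `W` lies in `coordSpace d k`, and having codimension at most one in the
next space it must equal it. -/
lemma mem_pivots_of_ne {W : Submodule ℝ (EuclideanSpace ℝ (Fin d))} {k : ℕ} (hk : k < d)
    {φ : EuclideanSpace ℝ (Fin d) →ₗ[ℝ] ℝ} (h : ∀ w, w ∈ W ↔ w ∈ coordSpace d (k + 1) ∧ φ w = 0)
    (hne : W ≠ coordSpace d k) : k ∈ pivots W := by
  by_contra hk'
  have hW : ∀ w ∈ W, ⟪stdVec d k, w⟫ = 0 := by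
    intro w hw
    by_contra h0
    exact hk' (mem_pivots.2 ⟨hk, w, hw, ((h w).1 hw).1, h0⟩)
  refine hne (le_antisymm (fun w hw => mem_coordSpace_succ.2 ⟨((h w).1 hw).1, hW w hw⟩) ?_)
  intro v hv
  have hv' : v ∈ coordSpace d (k + 1) := coordSpace_mono (by omega) hv
  rw [h]
  refine ⟨hv', ?_⟩
  by_contra hφ
  -- If `φ` were nonzero on `coordSpace d k`, this vector of `W` would have coordinate `k` equal to
  -- one.
  have hmem : stdVec d k - (φ (stdVec d k) / φ v) • v ∈ W := by
    rw [h]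
    refine ⟨Submodule.sub_mem _ (stdVec_mem_coordSpace (by omega))
      (Submodule.smul_mem _ _ hv'), ?_⟩
    rw [map_sub, map_smul, smul_eq_mul, div_mul_cancel₀ _ hφ, sub_self]
  have := hW _ hmem
  rw [inner_sub_right, inner_smul_right, inner_stdVec_self hk,
    (mem_coordSpace_succ.1 hv).2] at this
  norm_num at this

end Pivots

/-! ### Decay of character integrals in the cone region -/

section Bounds

/-- The conditions on the absolute values `a j` of the frequencies that define the cone region. -/
structure ConeBound (d r : ℕ) (α L ε : ℝ) (a : ℕ → ℝ) : Prop where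
  nonneg : ∀ j, 0 ≤ a j
  low : ∀ j, j < r → a j ≤ α * a r
  large : L ≤ a r
  step : ∀ j, r ≤ j → j + 1 < d → a j ≤ ε * a (j + 1)
  eps_pos : 0 < ε
  eps_le : ε ≤ α
  alpha_le : α ≤ 1
  one_le : 1 ≤ L

variable {d r : ℕ} {α L ε : ℝ} {a : ℕ → ℝ}

lemma ConeBound.mono (h : ConeBound d r α L ε a) {i j : ℕ} (hi : r ≤ i) (hij : i ≤ j)
    (hj : j < d) : a i ≤ a j := by
  induction j, hij using Nat.le_induction with
  | base => exact le_rfl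
  | succ j hij ih =>
    refine (ih (by omega)).trans ((h.step j (by omega) hj).trans ?_)
    have h1 : ε ≤ 1 := h.eps_le.trans h.alpha_le
    nlinarith [h.nonneg (j + 1)]

lemma ConeBound.le_eps_mul (h : ConeBound d r α L ε a) {i j : ℕ} (hi : r ≤ i) (hij : i < j)
    (hj : j < d) : a i ≤ ε * a j := by
  obtain ⟨m, rfl⟩ : ∃ m, j = m + 1 := ⟨j - 1, by omega⟩
  exact (h.mono hi (by omega) (by omega)).trans (h.step m (by omega) hj)

lemma ConeBound.le_alpha_mul (h : ConeBound d r α L ε a) {i j : ℕ} (hij : i < j) (hrj : r ≤ j)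
    (hj : j < d) : a i ≤ α * a j := by
  have hα : 0 ≤ α := h.eps_pos.le.trans h.eps_le
  rcases lt_or_ge i r with hi | hi
  · exact (h.low i hi).trans (mul_le_mul_of_nonneg_left (h.mono le_rfl hrj hj) hα)
  · exact (h.le_eps_mul hi hij hj).trans (mul_le_mul_of_nonneg_right h.eps_le (h.nonneg j))

lemma ConeBound.le_large (h : ConeBound d r α L ε a) {j : ℕ} (hj : r ≤ j) (hjd : j < d) :
    L ≤ a j := h.large.trans (h.mono le_rfl hj hjd)

/-- The product of the frequencies at the indices of `J` beyond `r`. -/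
noncomputable def upperProd (r : ℕ) (a : ℕ → ℝ) (J : Finset ℕ) : ℝ :=
  ∏ j ∈ J.filter (r ≤ ·), a j

lemma upperProd_nonneg (ha : ∀ j, 0 ≤ a j) (J : Finset ℕ) : 0 ≤ upperProd r a J :=
  Finset.prod_nonneg fun j _ => ha j

lemma upperProd_insert {q : ℕ} {J : Finset ℕ} (hq : q ∉ J) :
    upperProd r a (insert q J) = (if r ≤ q then a q else 1) * upperProd r a J := by
  unfold upperProd
  rw [Finset.filter_insert]
  split_ifs with h
  · rw [Finset.prod_insert (fun h' => hq (Finset.mem_filter.1 h').1)]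
  · rw [one_mul]

lemma upperProd_le {M : ℝ} {q : ℕ} {J J' : Finset ℕ} (ha : ∀ j, 0 ≤ a j) (hM : 1 ≤ M)
    (hJ' : J' ⊆ J) (hJ : J ⊆ insert q J') (h : ∀ j ∈ J, r ≤ j → a j ≤ M) :
    upperProd r a J ≤ M * upperProd r a J' := by
  have h0 := upperProd_nonneg (r := r) ha J'
  by_cases hq : q ∈ J ∧ q ∉ J'
  · have : J = insert q J' :=
      subset_antisymm hJ (Finset.insert_subset hq.1 hJ')
    rw [this, upperProd_insert hq.2]
    refine mul_le_mul_of_nonneg_right ?_ h0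
    split_ifs with hr
    · exact h q hq.1 hr
    · exact hM
  · have : J = J' := by
      refine subset_antisymm (fun j hj => ?_) hJ'
      rcases Finset.mem_insert.1 (hJ hj) with rfl | h'
      · by_contra hcon
        exact hq ⟨hj, hcon⟩
      · exact h'
    rw [this]
    nlinarith

/-- The product of the frequencies up to `k` is negligible against the one over a set of pivots
that contains `k` and misses at most one smaller index. -/
lemma ConeBound.prod_Ico_le (h : ConeBound d r α L ε a) {k q : ℕ} {J : Finset ℕ} (hrk : r ≤ k)
    (hk : k < d) (hkJ : k ∈ J) (hJ : J ⊆ Finset.range (k + 1))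
    (hq : Finset.range (k + 1) ⊆ insert q J) :
    ∏ j ∈ Finset.Ico r k, a j ≤ (ε + 1 / L) * upperProd r a J := by
  have h0 := upperProd_nonneg (r := r) h.nonneg J
  have hL : 0 < L := by linarith [h.one_le]
  have hfull : upperProd r a (Finset.range (k + 1)) = (∏ j ∈ Finset.Ico r k, a j) * a k := by
    rw [← Finset.prod_Ico_succ_top hrk, upperProd]
    refine Finset.prod_congr ?_ fun _ _ => rfl
    ext j
    simp only [Finset.mem_filter, Finset.mem_range, Finset.mem_Ico]
    omega
  have hP : 0 ≤ ∏ j ∈ Finset.Ico r k, a j := Finset.prod_nonneg fun j _ => h.nonneg j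
  have hak : L ≤ a k := h.le_large hrk hk
  have hak0 : 0 < a k := hL.trans_le hak
  have hεP := mul_nonneg h.eps_pos.le h0
  have hLP : 0 ≤ 1 / L * upperProd r a J := mul_nonneg (by positivity) h0
  have hlarge : upperProd r a (Finset.range (k + 1)) = upperProd r a J →
      ∏ j ∈ Finset.Ico r k, a j ≤ (ε + 1 / L) * upperProd r a J := by
    intro he
    rw [hfull] at he
    have : ∏ j ∈ Finset.Ico r k, a j ≤ 1 / L * upperProd r a J := by
      rw [← he, one_div, inv_mul_eq_div, le_div_iff₀ hL]
      exact mul_le_mul_of_nonneg_left hak hP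
    rw [add_mul]; linarith
  by_cases hqJ : q ∈ Finset.range (k + 1) ∧ q ∉ J
  · have he : Finset.range (k + 1) = insert q J :=
      subset_antisymm hq (Finset.insert_subset hqJ.1 hJ)
    have hqk : q < k := by
      have h1 := Finset.mem_range.1 hqJ.1
      rcases Nat.lt_succ_iff_lt_or_eq.1 h1 with h2 | rfl
      · exact h2
      · exact absurd hkJ hqJ.2
    have h2 := upperProd_insert (r := r) (a := a) hqJ.2
    rw [← he] at h2
    by_cases hr : r ≤ q
    · rw [if_pos hr, hfull] at h2
      have h3 : a q ≤ ε * a k := h.le_eps_mul hr hqk hk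
      have h4 : (∏ j ∈ Finset.Ico r k, a j) * a k ≤ (ε * upperProd r a J) * a k := by
        rw [h2]
        nlinarith
      have := le_of_mul_le_mul_right h4 hak0
      rw [add_mul]; linarith
    · rw [if_neg hr, one_mul] at h2
      exact hlarge h2
  · refine hlarge (congrArg _ (subset_antisymm (fun j hj => ?_) hJ))
    rcases Finset.mem_insert.1 (hq hj) with rfl | h'
    · by_contra hcon
      exact hqJ ⟨hj, hcon⟩
    · exact h'

/-- The absolute values of the coordinates of a frequency. -/
noncomputable def absCoord (ξ : EuclideanSpace ℝ (Fin d)) (j : ℕ) : ℝ := |⟪stdVec d j, ξ⟫|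

/-- The character integral of a simplex, without the volume factor. -/
noncomputable def simplexChar {k : ℕ} (p : Fin (k + 1) → EuclideanSpace ℝ (Fin d))
    (ξ : EuclideanSpace ℝ (Fin d)) : ℂ :=
  simplexExp (-(2 * (Real.pi : ℂ) * Complex.I)) k (fun i => ⟪ξ, p i⟫) 1

lemma norm_simplexChar_le_one {k : ℕ} (p : Fin (k + 1) → EuclideanSpace ℝ (Fin d))
    (ξ : EuclideanSpace ℝ (Fin d)) : ‖simplexChar p ξ‖ ≤ 1 :=
  norm_simplexExp_le_one (by simp) k _ zero_le_one le_rfl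

lemma simplexChar_facets {k : ℕ} {p : Fin (k + 2) → EuclideanSpace ℝ (Fin d)}
    {f : Fin (k + 2) → EuclideanSpace ℝ (Fin d) →ᵃ[ℝ] ℝ} (hf : IsDual f p)
    {w : EuclideanSpace ℝ (Fin d)} (hw : w ∈ vectorSpan ℝ (Set.range p))
    (ξ : EuclideanSpace ℝ (Fin d)) :
    -(2 * (Real.pi : ℂ) * Complex.I) * (⟪ξ, w⟫ : ℝ) * simplexChar p ξ =
      -∑ i, ((f i).linear w : ℂ) * simplexChar (p ∘ i.succAbove) ξ := by
  obtain ⟨h1, h2⟩ := hf.eq_sum_linear hw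
  have h3 := simplexExp_facets (c := -(2 * (Real.pi : ℂ) * Complex.I)) k (fun i => ⟪ξ, p i⟫)
    (fun i => (f i).linear w) h2 1
  have h4 : ⟪ξ, w⟫ = ∑ i, (f i).linear w * ⟪ξ, p i⟫ := by
    conv_lhs => rw [h1]
    rw [inner_sum]
    exact Finset.sum_congr rfl fun i _ => inner_smul_right _ _ _
  rw [h4]
  exact h3

lemma inner_eq_sum_coord (ξ w : EuclideanSpace ℝ (Fin d)) :
    ⟪ξ, w⟫ = ∑ j ∈ Finset.range d, ⟪stdVec d j, w⟫ * ⟪stdVec d j, ξ⟫ := by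
  rw [Finset.sum_range, PiLp.inner_apply]
  refine Finset.sum_congr rfl fun j _ => ?_
  rw [inner_stdVec j.2, inner_stdVec j.2]
  simp

lemma ConeBound.le_abs_inner {ξ w : EuclideanSpace ℝ (Fin d)} {m : ℕ}
    (h : ConeBound d r α L ε (absCoord ξ)) (hrm : r ≤ m) (hm : m < d)
    (hw : w ∈ coordSpace d (m + 1)) (hwm : ⟪stdVec d m, w⟫ = 1)
    (hα : α * ∑ j ∈ Finset.range d, |⟪stdVec d j, w⟫| ≤ 1 / 2) :
    absCoord ξ m / 2 ≤ |⟪ξ, w⟫| := by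
  have hmem : m ∈ Finset.range d := Finset.mem_range.2 hm
  have h1 : ⟪ξ, w⟫ = ⟪stdVec d m, ξ⟫ + ∑ j ∈ (Finset.range d).erase m,
      ⟪stdVec d j, w⟫ * ⟪stdVec d j, ξ⟫ := by
    rw [inner_eq_sum_coord, ← Finset.add_sum_erase _ _ hmem, hwm, one_mul]
  have hα0 : 0 ≤ α := h.eps_pos.le.trans h.eps_le
  have ham := h.nonneg m
  have h2 : |∑ j ∈ (Finset.range d).erase m, ⟪stdVec d j, w⟫ * ⟪stdVec d j, ξ⟫| ≤
      absCoord ξ m / 2 := by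
    calc |∑ j ∈ (Finset.range d).erase m, ⟪stdVec d j, w⟫ * ⟪stdVec d j, ξ⟫|
        ≤ ∑ j ∈ (Finset.range d).erase m, |⟪stdVec d j, w⟫ * ⟪stdVec d j, ξ⟫| :=
          Finset.abs_sum_le_sum_abs _ _
      _ ≤ ∑ j ∈ (Finset.range d).erase m, |⟪stdVec d j, w⟫| * (α * absCoord ξ m) := by
          refine Finset.sum_le_sum fun j hj => ?_
          rw [abs_mul]
          rcases lt_trichotomy j m with hjm | hjm | hjm
          · exact mul_le_mul_of_nonneg_left (h.le_alpha_mul hjm hrm hm) (abs_nonneg _)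
          · exact absurd hjm (Finset.ne_of_mem_erase hj)
          · rw [mem_coordSpace_iff.1 hw j hjm]; simp
      _ ≤ ∑ j ∈ Finset.range d, |⟪stdVec d j, w⟫| * (α * absCoord ξ m) :=
          Finset.sum_le_sum_of_subset_of_nonneg (Finset.erase_subset _ _) fun j _ _ =>
            mul_nonneg (abs_nonneg _) (mul_nonneg hα0 ham)
      _ = (α * ∑ j ∈ Finset.range d, |⟪stdVec d j, w⟫|) * absCoord ξ m := by
          rw [← Finset.sum_mul]; ring
      _ ≤ absCoord ξ m / 2 := by nlinarith
  rw [h1]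
  have h3 := abs_sub_abs_le_abs_sub ⟪stdVec d m, ξ⟫
    (-∑ j ∈ (Finset.range d).erase m, ⟪stdVec d j, w⟫ * ⟪stdVec d j, ξ⟫)
  rw [abs_neg, sub_neg_eq_add] at h3
  have h4 : |⟪stdVec d m, ξ⟫| = absCoord ξ m := rfl
  linarith

/-- The decay of the character integral of a simplex in the cone region. -/
theorem exists_bound_simplexChar (r : ℕ) (k : ℕ) (p : Fin (k + 1) → EuclideanSpace ℝ (Fin d))
    (f : Fin (k + 1) → EuclideanSpace ℝ (Fin d) →ᵃ[ℝ] ℝ) (hf : IsDual f p) :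
    ∃ α₀ > 0, ∃ C ≥ 0, ∀ α L ε : ℝ, ∀ ξ : EuclideanSpace ℝ (Fin d), α ≤ α₀ →
      ConeBound d r α L ε (absCoord ξ) →
      ‖simplexChar p ξ‖ * upperProd r (absCoord ξ) (pivots (vectorSpan ℝ (Set.range p))) ≤ C := by
  induction k with
  | zero =>
    refine ⟨1, one_pos, 1, zero_le_one, fun α L ε ξ _ h => ?_⟩
    have : pivots (vectorSpan ℝ (Set.range p)) = ∅ := by
      have hr : Set.range p = {p 0} := by
        ext x; simp [Fin.exists_fin_one, eq_comm]
      rw [hr, vectorSpan_singleton, Finset.eq_empty_iff_forall_notMem]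
      intro j hj
      obtain ⟨_, w, hw, _, h0⟩ := mem_pivots.1 hj
      rw [(Submodule.mem_bot ℝ).1 hw, inner_zero_right] at h0
      exact h0 rfl
    rw [this]
    simpa [upperProd] using norm_simplexChar_le_one p ξ
  | succ k ih =>
    set W := vectorSpan ℝ (Set.range p) with hW
    have hne : (pivots W).Nonempty := by
      have h01 : p 0 - p 1 ∈ W := vsub_mem_vectorSpan ℝ (Set.mem_range_self _) (Set.mem_range_self _)
      refine pivots_nonempty h01 fun h0 => ?_
      have := hf.linear_sub 0 0 1
      rw [h0, map_zero] at this
      simp at this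
    obtain ⟨m, hmJ, hmax⟩ : ∃ m ∈ pivots W, ∀ j ∈ pivots W, j ≤ m :=
      ⟨_, Finset.max'_mem _ hne, fun j hj => Finset.le_max' _ _ hj⟩
    obtain ⟨hmd, w', hw'W, hw'm, hw'0⟩ := mem_pivots.1 hmJ
    by_cases hrm : r ≤ m
    · set w := (⟪stdVec d m, w'⟫)⁻¹ • w' with hwdef
      have hwW : w ∈ W := W.smul_mem _ hw'W
      have hwm : w ∈ coordSpace d (m + 1) := Submodule.smul_mem _ _ hw'm
      have hw1 : ⟪stdVec d m, w⟫ = 1 := by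
        rw [hwdef, inner_smul_right, inv_mul_cancel₀ hw'0]
      choose α₁ hα₁ C₁ hC₁ hbound using fun i : Fin (k + 2) =>
        ih (p ∘ i.succAbove) (f ∘ i.succAbove) (hf.face i)
      set K := ∑ j ∈ Finset.range d, |⟪stdVec d j, w⟫| with hK
      have hK0 : 0 ≤ K := Finset.sum_nonneg fun j _ => abs_nonneg _
      refine ⟨min (1 / (2 * (K + 1))) (Finset.univ.inf' Finset.univ_nonempty α₁), ?_,
        ∑ i, |(f i).linear w| * C₁ i, Finset.sum_nonneg fun i _ => mul_nonneg (abs_nonneg _) (hC₁ i),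
        fun α L ε ξ hα h => ?_⟩
      · refine lt_min (by positivity) ?_
        rw [Finset.lt_inf'_iff]
        exact fun i _ => hα₁ i
      · have hαK : α * K ≤ 1 / 2 := by
          have h1 : α ≤ 1 / (2 * (K + 1)) := hα.trans (min_le_left _ _)
          have hα0 : 0 ≤ α := h.eps_pos.le.trans h.eps_le
          rw [le_div_iff₀ (by positivity)] at h1
          nlinarith
        have hαi : ∀ i, α ≤ α₁ i := fun i =>
          (hα.trans (min_le_right _ _)).trans (Finset.inf'_le _ (Finset.mem_univ i))
        have hlow := h.le_abs_inner hrm hmd hwm hw1 hαK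
        have ham : 1 ≤ absCoord ξ m := h.one_le.trans (h.le_large hrm hmd)
        have hfac := congrArg norm (simplexChar_facets hf hwW ξ)
        rw [norm_neg, norm_mul, norm_mul, Complex.norm_real, Real.norm_eq_abs] at hfac
        have hc : ‖-(2 * (Real.pi : ℂ) * Complex.I)‖ = 2 * Real.pi := by
          simp [abs_of_pos Real.pi_pos]
        rw [hc] at hfac
        set P := upperProd r (absCoord ξ) (pivots W) with hP
        have hP0 : 0 ≤ P := upperProd_nonneg h.nonneg _
        have hterm : ∀ i : Fin (k + 2), ‖simplexChar (p ∘ i.succAbove) ξ‖ * P ≤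
            absCoord ξ m * C₁ i := by
          intro i
          have hface := fun w => hf.mem_vectorSpan_face_iff i (w := w)
          obtain ⟨q, hq⟩ := pivots_subset_insert hface
          have hsub : pivots (vectorSpan ℝ (Set.range (p ∘ i.succAbove))) ⊆ pivots W :=
            pivots_mono fun w hw => ((hface w).1 hw).1
          have h1 := upperProd_le (r := r) h.nonneg ham hsub hq
            fun j hj hrj => h.mono hrj (hmax j hj) hmd
          have h2 := hbound i α L ε ξ (hαi i) h
          calc _ ≤ ‖simplexChar (p ∘ i.succAbove) ξ‖ * (absCoord ξ m * upperProd r (absCoord ξ)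
                (pivots (vectorSpan ℝ (Set.range (p ∘ i.succAbove))))) :=
                mul_le_mul_of_nonneg_left h1 (norm_nonneg _)
            _ = absCoord ξ m * (‖simplexChar (p ∘ i.succAbove) ξ‖ * upperProd r (absCoord ξ)
                (pivots (vectorSpan ℝ (Set.range (p ∘ i.succAbove))))) := by ring
            _ ≤ _ := mul_le_mul_of_nonneg_left h2 (by linarith)
        have hsum : ‖∑ i, ((f i).linear w : ℂ) * simplexChar (p ∘ i.succAbove) ξ‖ * P ≤
            absCoord ξ m * ∑ i, |(f i).linear w| * C₁ i := by
          calc _ ≤ (∑ i, ‖((f i).linear w : ℂ) * simplexChar (p ∘ i.succAbove) ξ‖) * P :=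
                mul_le_mul_of_nonneg_right (norm_sum_le _ _) hP0
            _ = ∑ i, |(f i).linear w| * (‖simplexChar (p ∘ i.succAbove) ξ‖ * P) := by
                rw [Finset.sum_mul]
                refine Finset.sum_congr rfl fun i _ => ?_
                rw [norm_mul, Complex.norm_real, Real.norm_eq_abs]; ring
            _ ≤ ∑ i, |(f i).linear w| * (absCoord ξ m * C₁ i) :=
                Finset.sum_le_sum fun i _ => mul_le_mul_of_nonneg_left (hterm i) (abs_nonneg _)
            _ = _ := by
                rw [Finset.mul_sum]
                exact Finset.sum_congr rfl fun i _ => by ring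
        rw [← hfac] at hsum
        have hpi : 1 ≤ Real.pi := by linarith [Real.pi_gt_three]
        have hEP : 0 ≤ ‖simplexChar p ξ‖ * P := mul_nonneg (norm_nonneg _) hP0
        have h5 : absCoord ξ m ≤ 2 * Real.pi * |⟪ξ, w⟫| := by nlinarith [abs_nonneg ⟪ξ, w⟫]
        have h6 : absCoord ξ m * (‖simplexChar p ξ‖ * P) ≤
            absCoord ξ m * ∑ i, |(f i).linear w| * C₁ i := by
          refine le_trans ?_ hsum
          calc _ ≤ (2 * Real.pi * |⟪ξ, w⟫|) * (‖simplexChar p ξ‖ * P) :=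
                mul_le_mul_of_nonneg_right h5 hEP
            _ = _ := by ring
        exact le_of_mul_le_mul_left h6 (by linarith)
    · refine ⟨1, one_pos, 1, zero_le_one, fun α L ε ξ _ h => ?_⟩
      have : (pivots W).filter (r ≤ ·) = ∅ := by
        rw [Finset.filter_eq_empty_iff]
        intro j hj hrj
        exact hrm (hrj.trans (hmax j hj))
      rw [upperProd, this, Finset.prod_empty, mul_one]
      exact norm_simplexChar_le_one p ξ

/-- The facets of a simplex that are not parallel to the flag are negligible. -/
theorem exists_bound_simplexChar_facet (r : ℕ) {k : ℕ} (hrk : r ≤ k) (hk : k < d)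
    {p : Fin (k + 2) → EuclideanSpace ℝ (Fin d)}
    {f : Fin (k + 2) → EuclideanSpace ℝ (Fin d) →ᵃ[ℝ] ℝ} (hf : IsDual f p)
    (hp : vectorSpan ℝ (Set.range p) = coordSpace d (k + 1)) (i : Fin (k + 2))
    (hi : vectorSpan ℝ (Set.range (p ∘ i.succAbove)) ≠ coordSpace d k) :
    ∃ α₀ > 0, ∃ C ≥ 0, ∀ α L ε : ℝ, ∀ ξ : EuclideanSpace ℝ (Fin d), α ≤ α₀ →
      ConeBound d r α L ε (absCoord ξ) →
      ‖simplexChar (p ∘ i.succAbove) ξ‖ * ∏ j ∈ Finset.Ico r k, absCoord ξ j ≤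
        C * (ε + 1 / L) := by
  obtain ⟨α₀, hα₀, C, hC, hbound⟩ := exists_bound_simplexChar r k (p ∘ i.succAbove)
    (f ∘ i.succAbove) (hf.face i)
  refine ⟨α₀, hα₀, C, hC, fun α L ε ξ hα h => ?_⟩
  have hface := fun w => hf.mem_vectorSpan_face_iff i (w := w)
  rw [hp] at hface
  obtain ⟨q, hq⟩ := pivots_subset_insert hface
  rw [pivots_coordSpace (by omega)] at hq
  have hsub := pivots_mono (W' := vectorSpan ℝ (Set.range (p ∘ i.succAbove)))
    fun w hw => ((hface w).1 hw).1
  rw [pivots_coordSpace (by omega)] at hsub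
  have h1 := h.prod_Ico_le hrk hk (mem_pivots_of_ne hk hface hi) hsub hq
  have h2 := hbound α L ε ξ hα h
  have hL : 0 < L := by linarith [h.one_le]
  have h3 : 0 ≤ ε + 1 / L := add_nonneg h.eps_pos.le (by positivity)
  calc _ ≤ ‖simplexChar (p ∘ i.succAbove) ξ‖ * ((ε + 1 / L) * upperProd r (absCoord ξ)
        (pivots (vectorSpan ℝ (Set.range (p ∘ i.succAbove))))) :=
        mul_le_mul_of_nonneg_left h1 (norm_nonneg _)
    _ = (‖simplexChar (p ∘ i.succAbove) ξ‖ * upperProd r (absCoord ξ)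
        (pivots (vectorSpan ℝ (Set.range (p ∘ i.succAbove))))) * (ε + 1 / L) := by ring
    _ ≤ _ := mul_le_mul_of_nonneg_right h2 h3

end Bounds

section SimplexJumps

variable {d : ℕ} {ι : Type*} {ℓ : ι → EuclideanSpace ℝ (Fin d) →ᵃ[ℝ] ℝ}

/-- The barycentric coordinates of the simplex `p` belong to the arrangement, and the simplex is
a union of cells. -/
def Adapted (ℓ : ι → EuclideanSpace ℝ (Fin d) →ᵃ[ℝ] ℝ) {k : ℕ}
    (p : Fin (k + 1) → EuclideanSpace ℝ (Fin d)) : Prop :=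
  (∃ lam : Fin (k + 1) → ι, IsDual (fun i => ℓ (lam i)) p) ∧
    CellularSet ℓ (convexHull ℝ (Set.range p))

lemma Adapted.face {k : ℕ} {p : Fin (k + 2) → EuclideanSpace ℝ (Fin d)} (h : Adapted ℓ p)
    (i : Fin (k + 2)) : Adapted ℓ (p ∘ i.succAbove) := by
  obtain ⟨⟨lam, hlam⟩, hc⟩ := h
  refine ⟨⟨lam ∘ i.succAbove, hlam.face i⟩, fun x y hxy hx => ?_⟩
  rw [hlam.mem_hull_face_iff i] at hx ⊢
  refine ⟨hc hxy hx.1, ?_⟩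
  have := hxy (lam i)
  rw [hx.2, sign_zero] at this
  exact sign_eq_zero_iff.1 this.symm

lemma isCompact_hull {k : ℕ} (p : Fin (k + 1) → EuclideanSpace ℝ (Fin d)) :
    IsCompact (convexHull ℝ (Set.range p)) := (Set.finite_range p).isCompact_convexHull (𝕜 := ℝ)

variable [Finite ι]

/-- The jump of a simplex is the signed sum of its parallel facets. -/
theorem jump_simplex {k : ℕ} (hk : k < d) {p : Fin (k + 2) → EuclideanSpace ℝ (Fin d)}
    {lam : Fin (k + 2) → ι} (hlam : IsDual (fun i => ℓ (lam i)) p)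
    (hW : vectorSpan ℝ (Set.range p) = coordSpace d (k + 1))
    {I : Finset (Fin (k + 2))}
    (hI : ∀ i, i ∈ I ↔ vectorSpan ℝ (Set.range (p ∘ i.succAbove)) = coordSpace d k)
    {x : EuclideanSpace ℝ (Fin d)} (hx : Generic ℓ (coordSpace d k) x) :
    jump (stdVec d k) ((convexHull ℝ (Set.range p)).indicator 1) x =
      ∑ i ∈ I, (-((SignType.sign ((ℓ (lam i)).linear (stdVec d k)) : SignType) : ℝ)) *
        (convexHull ℝ (Set.range (p ∘ i.succAbove))).indicator 1 x := by
  set e := stdVec d k with he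
  have heW : e ∈ vectorSpan ℝ (Set.range p) := by
    rw [hW]; exact stdVec_mem_coordSpace (Nat.lt_succ_self k)
  by_cases hxP : x ∈ convexHull ℝ (Set.range p)
  swap
  · have h1 : ∀ᶠ v in 𝓝 (0 : EuclideanSpace ℝ (Fin d)), x + v ∉ convexHull ℝ (Set.range p) := by
      have := (isCompact_hull p).isClosed.isOpen_compl.mem_nhds hxP
      rw [← map_add_left_nhds_zero x, mem_map] at this
      exact this
    have h2 := (tendsto_smul_nhdsGT (-e)).eventually h1
    have h3 := (tendsto_smul_nhdsGT (- -e)).eventually h1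
    rw [neg_neg] at h3
    rw [jump, side_indicator_of_notMem h2, side_indicator_of_notMem h3, sub_zero]
    refine (Finset.sum_eq_zero fun i _ => ?_).symm
    rw [Set.indicator_of_notMem fun h => hxP ((hlam.mem_hull_face_iff i).1 h).1, mul_zero]
  have hmem := hlam.mem_hull_iff.1 hxP
  have hspan : ∀ s : ℝ, x + s • e ∈ affineSpan ℝ (Set.range p) := by
    intro s
    have h := AffineSubspace.vadd_mem_of_mem_direction (v := s • e)
      (by rw [direction_affineSpan]; exact Submodule.smul_mem _ _ heW) hmem.1
    rwa [vadd_eq_add, add_comm (s • e) x] at h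
  -- a vanishing barycentric coordinate is a multiple of the last coordinate
  have hzero : ∀ i, ℓ (lam i) x = 0 → ∀ w ∈ coordSpace d (k + 1),
      (ℓ (lam i)).linear w = ⟪e, w⟫ * (ℓ (lam i)).linear e := by
    intro i hi w hw
    obtain ⟨v, hv, s, rfl⟩ := coordSpace_decomp hk w hw
    rw [map_add, map_smul, hx _ hi v hv, inner_add_right, inner_smul_right,
      (mem_coordSpace_succ.1 hv).2, inner_stdVec_self hk]
    simp [he]
  have hedge : ∀ i j, p i - p j ∈ coordSpace d (k + 1) := fun i j => by
    rw [← hW]; exact vsub_mem_vectorSpan ℝ (Set.mem_range_self _) (Set.mem_range_self _)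
  have hne : ∀ i, ℓ (lam i) x = 0 → (ℓ (lam i)).linear e ≠ 0 := by
    intro i hi h0
    obtain ⟨j, hj⟩ := exists_ne i
    have h1 := hzero i hi _ (hedge i j)
    rw [h0, mul_zero] at h1
    have h2 := hlam.linear_sub i i j
    rw [h1, if_pos rfl, if_neg hj.symm] at h2
    norm_num at h2
  have huniq : ∀ i j, ℓ (lam i) x = 0 → ℓ (lam j) x = 0 → i = j := by
    intro i j hi hj
    by_contra hij
    obtain ⟨l, hl⟩ : ∃ l, ℓ (lam l) x ≠ 0 := by
      by_contra hcon
      push Not at hcon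
      have := (hlam.eq_sum hmem.1).2
      simp [hcon] at this
    have hli : i ≠ l := by rintro rfl; exact hl hi
    have hlj : j ≠ l := by rintro rfl; exact hl hj
    have h1 := hlam.linear_sub j l i
    rw [if_neg hlj, if_neg (Ne.symm hij), sub_zero, hzero j hj _ (hedge l i)] at h1
    have h2 := (mul_eq_zero.1 h1).resolve_right (hne j hj)
    have h3 := hlam.linear_sub i l i
    rw [hzero i hi _ (hedge l i), h2, if_neg hli, if_pos rfl] at h3
    norm_num at h3
  have hT : ∀ u : EuclideanSpace ℝ (Fin d), Tendsto (fun t : ℝ => t • u) (𝓝[>] 0) (𝓝 0) := by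
    intro u
    simpa using tendsto_smul_nhdsGT (- -u)
  have hpos : ∀ u : EuclideanSpace ℝ (Fin d), ∀ᶠ t in 𝓝[>] (0 : ℝ), ∀ i, ℓ (lam i) x ≠ 0 →
      0 ≤ ℓ (lam i) (x + t • u) := by
    intro u
    filter_upwards [(hT u).eventually (eventually_sign ℓ x)] with t ht i hi
    have h1 : 0 < ℓ (lam i) x := lt_of_le_of_ne (hmem.2 i) (Ne.symm hi)
    have h2 := ht _ hi
    rw [sign_pos h1] at h2
    exact (sign_eq_one_iff.1 h2).le
  have hrest : ∀ i ∈ I, ℓ (lam i) x ≠ 0 →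
      (-((SignType.sign ((ℓ (lam i)).linear e) : SignType) : ℝ)) *
        (convexHull ℝ (Set.range (p ∘ i.succAbove))).indicator 1 x = 0 := by
    intro i _ hi
    rw [Set.indicator_of_notMem fun h => hi ((hlam.mem_hull_face_iff i).1 h).2, mul_zero]
  by_cases hZ : ∃ i, ℓ (lam i) x = 0
  · obtain ⟨i, hi⟩ := hZ
    have hother : ∀ j, j ≠ i → ℓ (lam j) x ≠ 0 := fun j hj h0 => hj (huniq j i h0 hi)
    have hiI : i ∈ I := by
      rw [hI]
      ext w
      rw [hlam.mem_vectorSpan_face_iff i, hW, mem_coordSpace_succ (k := k)]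
      refine and_congr_right fun hw => ?_
      rw [hzero i hi w hw, mul_eq_zero, or_iff_left (hne i hi)]
    rw [Finset.sum_eq_single i (fun j hj hji => hrest j hj (hother j hji))
      (fun h => absurd hiI h), Set.indicator_of_mem ((hlam.mem_hull_face_iff i).2 ⟨hxP, hi⟩)]
    have hval : ∀ (u : EuclideanSpace ℝ (Fin d)) (s : ℝ), u = s • e →
        ∀ᶠ t in 𝓝[>] (0 : ℝ), (x + t • u ∈ convexHull ℝ (Set.range p) ↔
          0 ≤ s * (ℓ (lam i)).linear e) := by
      intro u s hu
      filter_upwards [hpos u, self_mem_nhdsWithin] with t ht ht0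
      have ht0 : 0 < t := ht0
      have hli : ℓ (lam i) (x + t • u) = t * (s * (ℓ (lam i)).linear e) := by
        rw [affine_add, hi, hu, map_smul, map_smul, zero_add, smul_eq_mul, smul_eq_mul]
      have hsp : x + t • u ∈ affineSpan ℝ (Set.range p) := by
        rw [hu, smul_smul]; exact hspan _
      rw [hlam.mem_hull_iff]
      constructor
      · rintro ⟨_, h⟩
        have := h i
        rw [hli] at this
        exact nonneg_of_mul_nonneg_right this ht0
      · intro h
        refine ⟨hsp, fun j => ?_⟩
        by_cases hj : j = i
        · rw [hj, hli]; positivity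
        · exact ht j (hother j hj)
    have hm := hval (-e) (-1) (by simp)
    have hp := hval e 1 (by simp)
    rcases lt_or_gt_of_ne (hne i hi) with hs | hs
    · rw [jump, side_indicator_of_mem (hm.mono fun t ht => ht.2 (by linarith)),
        side_indicator_of_notMem (hp.mono fun t ht h => by have := ht.1 h; linarith), sign_neg hs]
      simp
    · rw [jump, side_indicator_of_notMem (hm.mono fun t ht h => by have := ht.1 h; linarith),
        side_indicator_of_mem (hp.mono fun t ht => ht.2 (by linarith)), sign_pos hs]
      simp
  · push Not at hZ
    rw [Finset.sum_eq_zero fun i hi => hrest i hi (hZ i)]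
    have hin : ∀ s : ℝ, ∀ᶠ t in 𝓝[>] (0 : ℝ),
        x + t • (s • e) ∈ convexHull ℝ (Set.range p) := by
      intro s
      filter_upwards [hpos (s • e)] with t ht
      refine hlam.mem_hull_iff.2 ⟨?_, fun i => ht i (hZ i)⟩
      rw [smul_smul]
      exact hspan _
    have h1 := hin 1
    have h2 := hin (-1)
    rw [one_smul] at h1
    rw [neg_one_smul] at h2
    rw [jump, side_indicator_of_mem h1, side_indicator_of_mem h2, sub_self]

end SimplexJumps

section Reduction

variable {d : ℕ} {ι : Type*} [Finite ι] {ℓ : ι → EuclideanSpace ℝ (Fin d) →ᵃ[ℝ] ℝ}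

omit [Finite ι] in
lemma simplexVol_facet {k : ℕ} (hk : k < d) {p : Fin (k + 2) → EuclideanSpace ℝ (Fin d)}
    {f : Fin (k + 2) → EuclideanSpace ℝ (Fin d) →ᵃ[ℝ] ℝ} (hf : IsDual f p)
    (hW : vectorSpan ℝ (Set.range p) = coordSpace d (k + 1)) (i : Fin (k + 2))
    (hi : vectorSpan ℝ (Set.range (p ∘ i.succAbove)) = coordSpace d k) :
    simplexVol p * (f i).linear (stdVec d k) =
      (SignType.sign ((f i).linear (stdVec d k)) : SignType) * simplexVol (p ∘ i.succAbove) := by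
  set u := (f i).linear (stdVec d k) with hu
  have hmem : ∀ j l, (p ∘ i.succAbove) j - (p ∘ i.succAbove) l ∈ coordSpace d k := fun j l => by
    rw [← hi]; exact vsub_mem_vectorSpan ℝ (Set.mem_range_self _) (Set.mem_range_self _)
  have hb : ∀ j, ⟪stdVec d k, p (i.succAbove j)⟫ = ⟪stdVec d k, p (i.succAbove 0)⟫ := by
    intro j
    have := (mem_coordSpace_succ.1 (hmem j 0)).2
    rw [inner_sub_right] at this
    exact sub_eq_zero.1 this
  have hv := simplexVol_eq_mul_simplexVol_facet p i hb
  rw [← inner_sub_right] at hv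
  have hedge : p i - p (i.succAbove 0) ∈ coordSpace d (k + 1) := by
    rw [← hW]; exact vsub_mem_vectorSpan ℝ (Set.mem_range_self _) (Set.mem_range_self _)
  obtain ⟨v, hvW, s, hs⟩ := coordSpace_decomp hk _ hedge
  have h1 : (f i).linear v = 0 := by
    rw [← hi] at hvW
    exact ((hf.mem_vectorSpan_face_iff i).1 hvW).2
  have h2 := hf.linear_sub i i (i.succAbove 0)
  rw [if_pos rfl, if_neg (Fin.succAbove_ne i 0).symm, sub_zero, hs, map_add, map_smul, h1,
    zero_add, smul_eq_mul, ← hu] at h2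
  have h3 : ⟪stdVec d k, p i - p (i.succAbove 0)⟫ = s := by
    rw [hs, inner_add_right, inner_smul_right, (mem_coordSpace_succ.1 hvW).2,
      inner_stdVec_self hk]
    ring
  rw [h3] at hv
  rw [hv]
  have h4 : |s| * u = (SignType.sign u : SignType) := by
    rcases lt_trichotomy u 0 with h | h | h
    · have : s < 0 := by
        by_contra hc
        nlinarith [not_lt.1 hc]
      rw [sign_neg h, abs_of_neg this]
      simp only [SignType.coe_neg, SignType.coe_one]
      linarith
    · rw [h, mul_zero] at h2; norm_num at h2
    · have : 0 < s := by
        by_contra hc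
        nlinarith [not_lt.1 hc]
      rw [sign_pos h, abs_of_pos this]
      simpa using h2
  rw [← h4]
  ring

/-- The product of the frequencies in the theorem. -/
noncomputable def freqProd (m n : ℕ) (ξ : EuclideanSpace ℝ (Fin d)) : ℂ :=
  ∏ j ∈ Finset.Ico m n, (-(2 * (Real.pi : ℂ) * Complex.I) * (⟪ξ, stdVec d j⟫ : ℝ))

lemma norm_freqProd (m n : ℕ) (ξ : EuclideanSpace ℝ (Fin d)) :
    ‖freqProd m n ξ‖ = (2 * Real.pi) ^ (n - m) * ∏ j ∈ Finset.Ico m n, absCoord ξ j := by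
  rw [freqProd, norm_prod]
  have : ∀ j ∈ Finset.Ico m n, ‖-(2 * (Real.pi : ℂ) * Complex.I) * (⟪ξ, stdVec d j⟫ : ℝ)‖ =
      2 * Real.pi * absCoord ξ j := by
    intro j _
    rw [norm_mul, Complex.norm_real, real_inner_comm]
    simp [abs_of_pos Real.pi_pos, absCoord]
  rw [Finset.prod_congr rfl this, Finset.prod_mul_distrib, Finset.prod_const, Nat.card_Ico]

/-- A simplex parallel to the flag reduces, both for iterated jumps and asymptotically for
character integrals, to a combination of simplices of dimension `r`. -/
theorem exists_reduction (r n : ℕ) (hn : r + n ≤ d)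
    (p : Fin (r + n + 1) → EuclideanSpace ℝ (Fin d)) (hp : Adapted ℓ p)
    (hW : vectorSpan ℝ (Set.range p) = coordSpace d (r + n)) :
    ∃ (κ : Type) (_ : Fintype κ) (q : κ → Fin (r + 1) → EuclideanSpace ℝ (Fin d)) (b : κ → ℝ),
      (∀ l, Adapted ℓ (q l) ∧ vectorSpan ℝ (Set.range (q l)) = coordSpace d r) ∧
      (∀ x, Generic ℓ (coordSpace d r) x →
        iterJump d r n ((convexHull ℝ (Set.range p)).indicator 1) x =
          ∑ l, b l * (convexHull ℝ (Set.range (q l))).indicator 1 x) ∧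
      ∃ α₀ > 0, ∃ C ≥ 0, ∀ α L ε : ℝ, ∀ ξ : EuclideanSpace ℝ (Fin d), α ≤ α₀ →
        ConeBound d r α L ε (absCoord ξ) →
        ‖simplexVol p * simplexChar p ξ * freqProd r (r + n) ξ -
          ∑ l, (b l : ℂ) * (simplexVol (q l) * simplexChar (q l) ξ)‖ ≤ C * (ε + 1 / L) := by
  classical
  induction n with
  | zero =>
    refine ⟨Unit, inferInstance, fun _ => p, fun _ => 1, fun _ => ⟨hp, hW⟩, fun x _ => ?_,
      1, one_pos, 0, le_rfl, fun α L ε ξ _ h => ?_⟩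
    · simp [iterJump]
    · simp [freqProd]
  | succ n ih =>
    obtain ⟨⟨lam, hlam⟩, hcell⟩ := id hp
    have hk : r + n < d := by omega
    let u : Fin (r + n + 2) → ℝ := fun i => (ℓ (lam i)).linear (stdVec d (r + n))
    let I : Finset (Fin (r + n + 2)) := Finset.univ.filter fun i =>
      vectorSpan ℝ (Set.range (p ∘ i.succAbove)) = coordSpace d (r + n)
    have hI : ∀ i, i ∈ I ↔
        vectorSpan ℝ (Set.range (p ∘ i.succAbove)) = coordSpace d (r + n) := by
      intro i; simp [I]
    choose κ hκ q b hq hjump α₁ hα₁ C₁ hC₁ hbound using fun i : I =>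
      ih (by omega) (p ∘ i.1.succAbove) (hp.face i.1) ((hI i.1).1 i.2)
    have herr : ∀ i : {i // i ∉ I}, ∃ α₀ > 0, ∃ C ≥ 0, ∀ α L ε : ℝ,
        ∀ ξ : EuclideanSpace ℝ (Fin d), α ≤ α₀ → ConeBound d r α L ε (absCoord ξ) →
        ‖simplexChar (p ∘ i.1.succAbove) ξ‖ * ∏ j ∈ Finset.Ico r (r + n), absCoord ξ j ≤
          C * (ε + 1 / L) := fun i =>
      exists_bound_simplexChar_facet r (by omega) hk hlam hW i.1 fun h => i.2 ((hI i.1).2 h)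
    choose α₂ hα₂ C₂ hC₂ hbound₂ using herr
    -- a uniform bound for all facets
    have hall : ∀ i : Fin (r + n + 2), ∃ α₀ > 0, ∃ C ≥ 0, ∀ α L ε : ℝ,
        ∀ ξ : EuclideanSpace ℝ (Fin d), α ≤ α₀ → ConeBound d r α L ε (absCoord ξ) →
        ‖-(simplexVol p * u i : ℝ) * simplexChar (p ∘ i.succAbove) ξ * freqProd r (r + n) ξ -
          (if h : i ∈ I then ∑ l, ((-((SignType.sign (u i) : SignType) : ℝ) * b ⟨i, h⟩ l : ℝ) : ℂ) *
            (simplexVol (q ⟨i, h⟩ l) * simplexChar (q ⟨i, h⟩ l) ξ) else 0)‖ ≤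
          C * (ε + 1 / L) := by
      intro i
      by_cases h : i ∈ I
      · refine ⟨α₁ ⟨i, h⟩, hα₁ _, |((SignType.sign (u i) : SignType) : ℝ)| * C₁ ⟨i, h⟩,
          mul_nonneg (abs_nonneg _) (hC₁ _), fun α L ε ξ hα hcone => ?_⟩
        have h1 := hbound ⟨i, h⟩ α L ε ξ hα hcone
        have hv : simplexVol p * u i = _ := simplexVol_facet hk hlam hW i ((hI i).1 h)
        rw [hv, dif_pos h]
        have h2 : -((((SignType.sign (u i) : SignType) : ℝ) *
            simplexVol (p ∘ i.succAbove) : ℝ) : ℂ) * simplexChar (p ∘ i.succAbove) ξ *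
            freqProd r (r + n) ξ - ∑ l, ((-((SignType.sign (u i) : SignType) : ℝ) *
              b ⟨i, h⟩ l : ℝ) : ℂ) *
              (simplexVol (q ⟨i, h⟩ l) * simplexChar (q ⟨i, h⟩ l) ξ) =
            -((((SignType.sign (u i) : SignType) : ℝ)) : ℂ) *
            (simplexVol (p ∘ i.succAbove) * simplexChar (p ∘ i.succAbove) ξ *
              freqProd r (r + n) ξ - ∑ l, (b ⟨i, h⟩ l : ℂ) *
              (simplexVol (q ⟨i, h⟩ l) * simplexChar (q ⟨i, h⟩ l) ξ)) := by
          rw [mul_sub, Finset.mul_sum]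
          congr 1
          · push_cast; ring
          · exact Finset.sum_congr rfl fun l _ => by push_cast; ring
        rw [h2, norm_mul, norm_neg, Complex.norm_real, Real.norm_eq_abs]
        exact (mul_le_mul_of_nonneg_left h1 (abs_nonneg _)).trans_eq (by ring)
      · refine ⟨α₂ ⟨i, h⟩, hα₂ _, |simplexVol p * u i| * ((2 * Real.pi) ^ (r + n - r) * C₂ ⟨i, h⟩),
          mul_nonneg (abs_nonneg _) (mul_nonneg (by positivity) (hC₂ _)),
          fun α L ε ξ hα hcone => ?_⟩
        have h1 := hbound₂ ⟨i, h⟩ α L ε ξ hα hcone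
        rw [dif_neg h, sub_zero, norm_mul, norm_mul, norm_neg, Complex.norm_real,
          Real.norm_eq_abs, norm_freqProd, mul_assoc, mul_assoc]
        refine mul_le_mul_of_nonneg_left ?_ (abs_nonneg _)
        calc _ = (2 * Real.pi) ^ (r + n - r) * (‖simplexChar (p ∘ i.succAbove) ξ‖ *
              ∏ j ∈ Finset.Ico r (r + n), absCoord ξ j) := by ring
          _ ≤ (2 * Real.pi) ^ (r + n - r) * (C₂ ⟨i, h⟩ * (ε + 1 / L)) :=
            mul_le_mul_of_nonneg_left h1 (by positivity)
          _ = _ := by ring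
    choose α₃ hα₃ C₃ hC₃ hbound₃ using hall
    refine ⟨Σ i : I, κ i, inferInstance, fun l => q l.1 l.2,
      fun l => -((SignType.sign (u l.1.1) : SignType) : ℝ) * b l.1 l.2,
      fun l => hq l.1 l.2, fun x hx => ?_,
      Finset.univ.inf' Finset.univ_nonempty α₃, ?_, ∑ i, C₃ i,
      Finset.sum_nonneg fun i _ => hC₃ i, fun α L ε ξ hα hcone => ?_⟩
    · rw [iterJump]
      have hc : ∀ i ∈ I, Cellular ℓ ((convexHull ℝ (Set.range (p ∘ i.succAbove))).indicator
          (1 : EuclideanSpace ℝ (Fin d) → ℝ)) := fun i _ => (hp.face i).2.indicator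
      rw [iterJump_congr n (by omega) (hcell.indicator.jump _)
        (Cellular.sum I (fun i => -((SignType.sign (u i) : SignType) : ℝ)) hc)
        (fun y hy => jump_simplex hk hlam hW hI hy) hx, iterJump_sum I _ n hc]
      beta_reduce
      rw [Fintype.sum_sigma, ← Finset.sum_coe_sort I]
      refine Finset.sum_congr rfl fun i _ => ?_
      rw [hjump i x hx, Finset.mul_sum]
      exact Finset.sum_congr rfl fun l _ => by ring
    · rw [gt_iff_lt, Finset.lt_inf'_iff]
      exact fun i _ => hα₃ i
    · have hαi : ∀ i, α ≤ α₃ i := fun i => hα.trans (Finset.inf'_le _ (Finset.mem_univ i))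
      have hfac : -(2 * (Real.pi : ℂ) * Complex.I) * (⟪ξ, stdVec d (r + n)⟫ : ℝ) *
          simplexChar p ξ = -∑ i, (u i : ℂ) * simplexChar (p ∘ i.succAbove) ξ :=
        simplexChar_facets hlam (w := stdVec d (r + n))
        (by rw [hW]; exact stdVec_mem_coordSpace (by omega)) ξ
      have hprod : freqProd r (r + (n + 1)) ξ = freqProd r (r + n) ξ *
          (-(2 * (Real.pi : ℂ) * Complex.I) * (⟪ξ, stdVec d (r + n)⟫ : ℝ)) := by
        rw [freqProd, ← add_assoc, Finset.prod_Ico_succ_top (by omega)]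
        rfl
      have hmain : simplexVol p * simplexChar p ξ * freqProd r (r + (n + 1)) ξ =
          ∑ i, -(simplexVol p * u i : ℝ) * simplexChar (p ∘ i.succAbove) ξ *
            freqProd r (r + n) ξ := by
        calc _ = simplexVol p * freqProd r (r + n) ξ *
              (-(2 * (Real.pi : ℂ) * Complex.I) * (⟪ξ, stdVec d (r + n)⟫ : ℝ) *
                simplexChar p ξ) := by rw [hprod]; ring
          _ = _ := by
            rw [hfac, mul_neg, Finset.mul_sum, ← Finset.sum_neg_distrib]
            refine Finset.sum_congr rfl fun i _ => ?_
            push_cast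
            ring
      have hsum : ∑ l : Σ i : I, κ i,
          ((-((SignType.sign (u l.1.1) : SignType) : ℝ) * b l.1 l.2 : ℝ) : ℂ) *
            (simplexVol (q l.1 l.2) * simplexChar (q l.1 l.2) ξ) =
          ∑ i, if h : i ∈ I then ∑ l, ((-((SignType.sign (u i) : SignType) : ℝ) *
            b ⟨i, h⟩ l : ℝ) : ℂ) *
            (simplexVol (q ⟨i, h⟩ l) * simplexChar (q ⟨i, h⟩ l) ξ) else 0 := by
        rw [Fintype.sum_sigma, Finset.sum_dite, Finset.sum_const_zero, add_zero]
        refine Finset.sum_bij (fun i _ => ⟨i.1, by simp [i.2]⟩) (fun _ _ => Finset.mem_attach _ _)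
          (fun i _ j _ hij => Subtype.ext (by simpa using hij)) ?_ fun i _ => rfl
        rintro ⟨i, hi⟩ _
        exact ⟨⟨i, by simpa using hi⟩, Finset.mem_univ _, rfl⟩
      rw [hmain, hsum, ← Finset.sum_sub_distrib, Finset.sum_mul]
      refine (norm_sum_le _ _).trans (Finset.sum_le_sum fun i _ => ?_)
      exact hbound₃ i α L ε ξ (hαi i) hcone

end Reduction

section Flat

variable {d r : ℕ} {S : Set (EuclideanSpace ℝ (Fin d))}

/-- A compact subset of a translate of the coordinate subspace of dimension `r`. -/
def Flat (r : ℕ) (S : Set (EuclideanSpace ℝ (Fin d))) : Prop :=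
  IsCompact S ∧ ∃ a, ∀ x ∈ S, x - a ∈ coordSpace d r

lemma isometry_translate_coordEmb (hr : r ≤ d) (a : EuclideanSpace ℝ (Fin d)) :
    Isometry (fun y => a + coordEmb d r y) :=
  (isometry_add_left a).comp (isometry_coordEmb hr)

lemma Flat.exists_subset_range (h : Flat r S) :
    ∃ a, S ⊆ Set.range (fun y => a + coordEmb d r y) := by
  obtain ⟨-, a, ha⟩ := h
  exact ⟨a, fun x hx => ⟨_, by beta_reduce; rw [coordEmb_surj (ha x hx)]; abel⟩⟩

lemma map_translate_coordEmb (hr : r ≤ d) (a : EuclideanSpace ℝ (Fin d)) :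
    Measure.map (fun y => a + coordEmb d r y) volume =
      (μHE[r] : Measure (EuclideanSpace ℝ (Fin d))).restrict
        (Set.range (fun y => a + coordEmb d r y)) := by
  have h1 := (isometry_translate_coordEmb hr a).map_euclideanHausdorffMeasure (d := r)
  rwa [EuclideanSpace.euclideanHausdorffMeasure_eq_volume] at h1

lemma Flat.measure_lt_top (hr : r ≤ d) (h : Flat r S) :
    (μHE[r] : Measure (EuclideanSpace ℝ (Fin d))) S < ⊤ := by
  obtain ⟨a, ha⟩ := h.exists_subset_range
  have hc := (isometry_translate_coordEmb hr a).isClosedEmbedding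
  rw [← Measure.restrict_eq_self _ ha, ← map_translate_coordEmb hr,
    Measure.map_apply hc.continuous.measurable h.1.measurableSet]
  exact (hc.isCompact_preimage h.1).measure_lt_top

lemma Flat.integrableOn (hr : r ≤ d) (h : Flat r S) {f : EuclideanSpace ℝ (Fin d) → ℂ}
    (hf : Continuous f) : IntegrableOn f S μHE[r] := by
  obtain ⟨C, hC⟩ := h.1.exists_bound_of_continuousOn hf.continuousOn
  exact IntegrableOn.of_bound (h.measure_lt_top hr)
    hf.aestronglyMeasurable C ((ae_restrict_iff' h.1.measurableSet).2 (ae_of_all _ hC))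

variable {ι : Type*} [Finite ι] {ℓ : ι → EuclideanSpace ℝ (Fin d) →ᵃ[ℝ] ℝ}

lemma ae_generic_translate (a : EuclideanSpace ℝ (Fin d)) :
    ∀ᵐ y : EuclideanSpace ℝ (Fin r), Generic ℓ (coordSpace d r) (a + coordEmb d r y) := by
  refine ae_all_iff.2 fun i => ?_
  by_cases h : ∀ w ∈ coordSpace d r, (ℓ i).linear w = 0
  · exact ae_of_all _ fun _ _ => h
  let g : EuclideanSpace ℝ (Fin r) →ᵃ[ℝ] ℝ :=
    (ℓ i).comp (AffineMap.const ℝ _ a + (coordEmb d r).toAffineMap)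
  have hg : ∀ y, g y = ℓ i (a + coordEmb d r y) := fun y => rfl
  let s : AffineSubspace ℝ (EuclideanSpace ℝ (Fin r)) :=
    (AffineSubspace.mk' (0 : ℝ) ⊥).comap g
  have hs : ∀ y, y ∈ s ↔ g y = 0 := by
    intro y
    simp [s, AffineSubspace.mem_comap, AffineSubspace.mem_mk']
  have htop : s ≠ ⊤ := by
    intro htop
    refine h fun w hw => ?_
    have h0 : ∀ y, g y = 0 := fun y => (hs y).1 (htop ▸ AffineSubspace.mem_top ℝ _ y)
    have h1 := h0 (WithLp.toLp 2 fun j : Fin r => ⟪stdVec d j, w⟫)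
    have h2 := h0 0
    rw [hg, affine_add] at h1 h2
    rw [coordEmb_surj hw] at h1
    rw [map_zero, map_zero, add_zero] at h2
    rwa [h2, zero_add] at h1
  have := Measure.addHaar_affineSubspace volume s htop
  refine measure_mono_null (fun y hy => ?_) this
  rw [SetLike.mem_coe, hs, hg]
  by_contra hne
  exact hy fun h0 => absurd h0 hne

lemma Flat.ae_generic (hr : r ≤ d) (h : Flat r S) :
    ∀ᵐ x ∂(μHE[r] : Measure (EuclideanSpace ℝ (Fin d))).restrict S,
      Generic ℓ (coordSpace d r) x := by
  obtain ⟨a, ha⟩ := h.exists_subset_range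
  refine ae_mono (Measure.restrict_mono_set _ ha) ?_
  rw [← map_translate_coordEmb hr]
  exact (isometry_translate_coordEmb hr a).isClosedEmbedding.measurableEmbedding.ae_map_iff.2
    (ae_generic_translate a)

lemma sum_setIntegral {μ : Measure (EuclideanSpace ℝ (Fin d))} {κ : Type*} (s : Finset κ)
    (c : κ → ℝ) {T : κ → Set (EuclideanSpace ℝ (Fin d))} {U : Set (EuclideanSpace ℝ (Fin d))}
    {f : EuclideanSpace ℝ (Fin d) → ℂ} (hf : IntegrableOn f U μ)
    (hT : ∀ k ∈ s, MeasurableSet (T k)) (hTU : ∀ k ∈ s, T k ⊆ U) :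
    ∑ k ∈ s, (c k : ℂ) * ∫ x in T k, f x ∂μ =
      ∫ x in U, ((∑ k ∈ s, c k * (T k).indicator 1 x : ℝ) : ℂ) * f x ∂μ := by
  have h1 : ∀ x, ((∑ k ∈ s, c k * (T k).indicator 1 x : ℝ) : ℂ) * f x =
      ∑ k ∈ s, (c k : ℂ) * (T k).indicator f x := by
    intro x
    push_cast
    rw [Finset.sum_mul]
    refine Finset.sum_congr rfl fun k _ => ?_
    by_cases hx : x ∈ T k <;> simp [hx]
  simp only [h1]
  rw [integral_finsetSum _ fun k hk => ((IntegrableOn.integrable hf).indicator (hT k hk)).const_mul _]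
  refine Finset.sum_congr rfl fun k hk => ?_
  rw [integral_const_mul, setIntegral_indicator (hT k hk), Set.inter_eq_right.2 (hTU k hk)]

/-- Two combinations of flat pieces that agree at generic points have the same integrals. -/
theorem sum_setIntegral_congr (hr : r ≤ d) {κ κ' : Type*} (s : Finset κ) (s' : Finset κ')
    (c : κ → ℝ) (c' : κ' → ℝ) {T : κ → Set (EuclideanSpace ℝ (Fin d))}
    {T' : κ' → Set (EuclideanSpace ℝ (Fin d))} (hT : ∀ k ∈ s, Flat r (T k))
    (hT' : ∀ k ∈ s', Flat r (T' k))
    (h : ∀ x, Generic ℓ (coordSpace d r) x → ∑ k ∈ s, c k * (T k).indicator 1 x =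
      ∑ k ∈ s', c' k * (T' k).indicator 1 x)
    {f : EuclideanSpace ℝ (Fin d) → ℂ} (hf : Continuous f) :
    ∑ k ∈ s, (c k : ℂ) * ∫ x in T k, f x ∂μHE[r] =
      ∑ k ∈ s', (c' k : ℂ) * ∫ x in T' k, f x ∂μHE[r] := by
  set U := (⋃ k ∈ s, T k) ∪ ⋃ k ∈ s', T' k with hU
  have hint : IntegrableOn f U μHE[r] := by
    rw [hU, integrableOn_union, integrableOn_finset_iUnion, integrableOn_finset_iUnion]
    exact ⟨fun k hk => (hT k hk).integrableOn hr hf, fun k hk => (hT' k hk).integrableOn hr hf⟩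
  have hgen : ∀ᵐ x ∂(μHE[r] : Measure (EuclideanSpace ℝ (Fin d))).restrict U,
      Generic ℓ (coordSpace d r) x := by
    rw [hU, ae_restrict_union_iff, ae_restrict_biUnion_finset_iff, ae_restrict_biUnion_finset_iff]
    exact ⟨fun k hk => (hT k hk).ae_generic hr, fun k hk => (hT' k hk).ae_generic hr⟩
  rw [sum_setIntegral s c hint (fun k hk => (hT k hk).1.measurableSet)
      (fun k hk => (Set.subset_biUnion_of_mem (u := T) hk).trans Set.subset_union_left),
    sum_setIntegral s' c' hint (fun k hk => (hT' k hk).1.measurableSet)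
      (fun k hk => (Set.subset_biUnion_of_mem (u := T') hk).trans Set.subset_union_right)]
  refine integral_congr_ae (hgen.mono fun x hx => ?_)
  beta_reduce
  rw [h x hx]

lemma flat_hull (p : Fin (r + 1) → EuclideanSpace ℝ (Fin d))
    (hp : vectorSpan ℝ (Set.range p) ≤ coordSpace d r) :
    Flat r (convexHull ℝ (Set.range p)) := by
  refine ⟨isCompact_hull p, p 0, fun x hx => hp ?_⟩
  rw [← direction_affineSpan]
  exact AffineSubspace.vsub_mem_direction (convexHull_subset_affineSpan _ hx)
    (mem_affineSpan ℝ (Set.mem_range_self 0))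

lemma setIntegral_char_simplex (hr : r ≤ d) (p : Fin (r + 1) → EuclideanSpace ℝ (Fin d))
    (hp : vectorSpan ℝ (Set.range p) ≤ coordSpace d r) (ξ : EuclideanSpace ℝ (Fin d)) :
    ∫ x in convexHull ℝ (Set.range p),
        Complex.exp (-(2 * (Real.pi : ℂ) * Complex.I * ((⟪ξ, x⟫ : ℝ) : ℂ))) ∂μHE[r] =
      simplexVol p * simplexChar p ξ := by
  rw [simplexChar, ← setIntegral_simplex hr p hp]
  simp only [neg_mul]

end Flat

section Polytope

variable {d : ℕ}

/-- The structure of a polytope with respect to the arrangement of all the hyperplanes spanned by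
facets of its simplices. -/
theorem IsPolytope.exists_arrangement (hd : 0 < d) {A : Set (EuclideanSpace ℝ (Fin d))}
    (hA : IsPolytope A) :
    ∃ (N : ℕ) (p : Fin N → Fin (d + 1) → EuclideanSpace ℝ (Fin d))
      (ℓ : Fin N × Fin (d + 1) → EuclideanSpace ℝ (Fin d) →ᵃ[ℝ] ℝ),
      (∀ k, Adapted ℓ (p k) ∧ vectorSpan ℝ (Set.range (p k)) = ⊤) ∧ CellularSet ℓ A ∧
      IsCompact A ∧ (A.Nonempty → affineSpan ℝ A = ⊤) ∧
      ∀ x, Generic ℓ ⊤ x → A.indicator (1 : EuclideanSpace ℝ (Fin d) → ℝ) x =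
        ∑ k, (1 : ℝ) * (convexHull ℝ (Set.range (p k))).indicator 1 x := by
  obtain ⟨N, p, hp, hdis, rfl⟩ := hA
  have hspan : ∀ k, affineSpan ℝ (Set.range (p k)) = ⊤ := fun k =>
    (hp k).affineSpan_eq_top_iff_card_eq_finrank_add_one.2 (by simp)
  let B : Fin N → AffineBasis (Fin (d + 1)) ℝ (EuclideanSpace ℝ (Fin d)) := fun k =>
    ⟨p k, hp k, hspan k⟩
  let ℓ : Fin N × Fin (d + 1) → EuclideanSpace ℝ (Fin d) →ᵃ[ℝ] ℝ := fun i => (B i.1).coord i.2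
  have hdual : ∀ k, IsDual (fun i => ℓ (k, i)) (p k) := fun k i j => (B k).coord_apply i j
  have hmem : ∀ k x, x ∈ convexHull ℝ (Set.range (p k)) ↔ ∀ i, 0 ≤ ℓ (k, i) x := by
    intro k x
    rw [(hdual k).mem_hull_iff, hspan]
    simp [AffineSubspace.mem_top]
  have hcell : ∀ k, CellularSet ℓ (convexHull ℝ (Set.range (p k))) := by
    intro k x y hxy hx
    rw [hmem] at hx ⊢
    intro i
    rw [← sign_nonneg_iff, ← hxy (k, i), sign_nonneg_iff]
    exact hx i
  have hne : ∀ k i x, Generic ℓ ⊤ x → ℓ (k, i) x ≠ 0 := by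
    intro k i x hx h0
    have : Nontrivial (Fin (d + 1)) := Fin.nontrivial_iff_two_le.2 (by omega)
    obtain ⟨j, hj⟩ := exists_ne i
    have h1 := hx (k, i) h0 (p k i - p k j) Submodule.mem_top
    rw [(hdual k).linear_sub, if_pos rfl, if_neg hj.symm] at h1
    norm_num at h1
  have hint : ∀ k x, Generic ℓ ⊤ x → x ∈ convexHull ℝ (Set.range (p k)) →
      x ∈ interior (convexHull ℝ (Set.range (p k))) := by
    intro k x hx hxk
    have := (B k).interior_convexHull
    change interior (convexHull ℝ (Set.range (p k))) = _ at this
    rw [this]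
    exact fun i => lt_of_le_of_ne ((hmem k x).1 hxk i) (hne k i x hx).symm
  refine ⟨N, p, ℓ, fun k => ⟨⟨⟨fun i => (k, i), hdual k⟩, hcell k⟩, ?_⟩, ?_, ?_, ?_, ?_⟩
  · rw [← direction_affineSpan, hspan, AffineSubspace.direction_top]
  · intro x y hxy hx
    obtain ⟨k, hk⟩ := Set.mem_iUnion.1 hx
    exact Set.mem_iUnion.2 ⟨k, hcell k hxy hk⟩
  · exact isCompact_iUnion fun k => isCompact_hull (p k)
  · rintro ⟨x, hx⟩
    obtain ⟨k, hk⟩ := Set.mem_iUnion.1 hx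
    rw [eq_top_iff, ← hspan k]
    refine affineSpan_mono ℝ ((subset_convexHull ℝ _).trans ?_)
    exact Set.subset_iUnion (fun k => convexHull ℝ (Set.range (p k))) k
  · intro x hx
    by_cases h : ∃ k, x ∈ convexHull ℝ (Set.range (p k))
    · obtain ⟨k, hk⟩ := h
      rw [Set.indicator_of_mem (Set.mem_iUnion.2 ⟨k, hk⟩), Finset.sum_eq_single k]
      · rw [Set.indicator_of_mem hk, one_mul]
      · intro l _ hl
        rw [Set.indicator_of_notMem, mul_zero]
        exact fun hxl => Set.disjoint_left.1 (hdis l k hl) (hint l x hx hxl) (hint k x hx hk)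
      · simp
    · rw [Set.indicator_of_notMem fun h' => h (Set.mem_iUnion.1 h'), Finset.sum_eq_zero]
      intro k _
      rw [Set.indicator_of_notMem fun h' => h ⟨k, h'⟩, mul_zero]

end Polytope

section FourierTransforms

variable {d r : ℕ}

lemma continuous_char (ξ : EuclideanSpace ℝ (Fin d)) : Continuous fun x =>
    Complex.exp (-(2 * (Real.pi : ℂ) * Complex.I * ((⟪ξ, x⟫ : ℝ) : ℂ))) := by fun_prop

lemma fourierIndicator_eq {A : Set (EuclideanSpace ℝ (Fin d))} (hA : MeasurableSet A)
    (ξ : EuclideanSpace ℝ (Fin d)) : fourierIndicator A ξ =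
      ∫ x in A, Complex.exp (-(2 * (Real.pi : ℂ) * Complex.I * ((⟪ξ, x⟫ : ℝ) : ℂ))) ∂μHE[d] := by
  rw [fourierIndicator, Real.fourier_eq', EuclideanSpace.euclideanHausdorffMeasure_eq_volume,
    ← integral_indicator hA]
  refine integral_congr_ae (ae_of_all _ fun x => ?_)
  by_cases hx : x ∈ A
  · simp only [Set.indicator_of_mem hx, smul_eq_mul, mul_one]
    rw [real_inner_comm]
    congr 1
    push_cast
    ring
  · simp [hx]

lemma fourierMeasure_sum_volOn (hr : r ≤ d) {κ : Type*} (s : Finset κ) (c : κ → ℝ)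
    {S : κ → Set (EuclideanSpace ℝ (Fin d))} (hS : ∀ k ∈ s, Flat r (S k))
    (ξ : EuclideanSpace ℝ (Fin d)) : fourierMeasure (∑ k ∈ s, c k • volOn r (S k)) ξ =
      ∑ k ∈ s, (c k : ℂ) * ∫ x in S k,
        Complex.exp (-(2 * (Real.pi : ℂ) * Complex.I * ((⟪ξ, x⟫ : ℝ) : ℂ))) ∂μHE[r] := by
  have hfin : ∀ k ∈ s, IsFiniteMeasure
      ((μHE[r] : Measure (EuclideanSpace ℝ (Fin d))).restrict (S k)) := fun k hk =>
    ⟨by rw [Measure.restrict_apply_univ]; exact (hS k hk).measure_lt_top hr⟩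
  rw [fourierMeasure, VectorMeasure.integral_finsetSum_vectorMeasure]
  · refine Finset.sum_congr rfl fun k hk => ?_
    have := hfin k hk
    rw [VectorMeasure.integral_smul_vectorMeasure, volOn, dif_pos this,
      VectorMeasure.integral_toSignedMeasure, Complex.real_smul]
  · intro k hk
    have := hfin k hk
    refine VectorMeasure.Integrable.smul_vectorMeasure ?_ _
    rw [volOn, dif_pos this, VectorMeasure.Integrable, Measure.variation_toSignedMeasure]
    exact (hS k hk).integrableOn hr (continuous_char ξ)

end FourierTransforms

section StandardFlag

variable {d r n : ℕ}

lemma Flag.IsStandard.V_eq {Φ : Flag d r} (hΦ : Φ.IsStandard) {j : ℕ} (hj : r ≤ j) (hjd : j ≤ d) :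
    Φ.V j = coordSpace d j := by
  rcases hjd.eq_or_lt with rfl | h
  · rw [coordSpace_top]
    exact Submodule.eq_top_of_finrank_eq (by simpa using Φ.finrank_V j hj le_rfl)
  · ext x
    exact hΦ.1 j hj h x

lemma Flag.IsStandard.eps_eq {Φ : Flag d r} (hΦ : Φ.IsStandard)
    (F : ℕ → Set (EuclideanSpace ℝ (Fin d))) {j : ℕ} (hj : r ≤ j) (hjd : j < d) :
    eps Φ F j = stepSign F j := by
  have : Φ.pos j = lowerHalf d j := by
    rw [hΦ.2 j hj hjd, hΦ.V_eq (hj.trans (Nat.le_succ j)) hjd, lowerHalf]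
    simp only [inner_stdVec hjd]
  rw [eps, stepSign, this]

lemma Flag.IsStandard.parallelSequences_eq {Φ : Flag (r + n) r} (hΦ : Φ.IsStandard)
    (A : Set (EuclideanSpace ℝ (Fin (r + n)))) : parallelSequences A Φ = chains r n A := by
  ext F
  refine and_congr Iff.rfl (and_congr Iff.rfl (and_congr (forall_congr' fun j =>
    forall_congr' fun hj => forall_congr' fun hjd => ?_) Iff.rfl))
  rw [hΦ.V_eq hj hjd.le]

lemma chains_empty (hn : 0 < n) : chains r n (∅ : Set (EuclideanSpace ℝ (Fin d))) = ∅ := by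
  obtain ⟨n, rfl⟩ := Nat.exists_eq_succ_of_ne_zero hn.ne'
  refine Set.eq_empty_iff_forall_notMem.2 fun F hF => ?_
  obtain ⟨x, hx, -⟩ := hF.2.1 (r + n) (by omega) (by omega)
  rw [show r + n + 1 = r + (n + 1) by omega, hF.1] at hx
  exact hx.1

lemma flat_of_mem_chains {ι : Type*} [Finite ι] {ℓ : ι → EuclideanSpace ℝ (Fin d) →ᵃ[ℝ] ℝ}
    (hn : 0 < n) {A : Set (EuclideanSpace ℝ (Fin d))} (hA : CellularSet ℓ A) (hAc : IsCompact A)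
    {F : ℕ → Set (EuclideanSpace ℝ (Fin d))} (hF : F ∈ chains r n A) : Flat r (F r) := by
  obtain ⟨h1, h2⟩ := chains_bottom n hA hAc.isClosed hF
  refine ⟨hAc.of_isClosed_subset h1 h2, ?_⟩
  rcases (F r).eq_empty_or_nonempty with h | ⟨a, ha⟩
  · exact ⟨0, fun x hx => by simp [h] at hx⟩
  · refine ⟨a, fun x hx => ?_⟩
    rw [← hF.2.2.1 r le_rfl (by omega)]
    exact sub_mem_direction ha hx

lemma freqProd_eq (r : ℕ) (ξ : EuclideanSpace ℝ (Fin d)) :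
    ∏ j ∈ Finset.univ.filter (fun j : Fin d => r ≤ (j : ℕ)),
      (-(2 * (Real.pi : ℂ) * Complex.I * ((ξ j : ℝ) : ℂ))) = freqProd r d ξ := by
  refine Finset.prod_nbij (fun j => (j : ℕ)) ?_ (fun i _ j _ h => Fin.ext h) ?_ ?_
  · intro j hj
    simpa using hj
  · intro j hj
    have hj := Finset.mem_Ico.1 (Finset.mem_coe.1 hj)
    exact ⟨⟨j, hj.2⟩, by simpa using hj.1, rfl⟩
  · intro j _
    rw [real_inner_comm, inner_stdVec j.2, neg_mul]

lemma coneBound_of_mem_coneRegion (hr : r < d) {α L δ : ℝ} {ξ : EuclideanSpace ℝ (Fin d)}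
    (hξ : ξ ∈ coneRegion r hr α L δ) (hδ : 0 < δ) (hδα : 2 * δ ≤ α) (hα : α ≤ 1) (hL : 1 ≤ L) :
    ConeBound d r α L (2 * δ) (absCoord ξ) := by
  have habs : ∀ j (hj : j < d), absCoord ξ j = |ξ ⟨j, hj⟩| := fun j hj => by
    rw [absCoord, inner_stdVec hj]
  refine ⟨fun j => abs_nonneg _, fun j hj => ?_, ?_, fun j hj hjd => ?_, by linarith, hδα, hα, hL⟩
  · rw [habs j (hj.trans hr), habs r hr]
    exact hξ.1 ⟨j, _⟩ hj
  · rw [habs r hr]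
    exact hξ.2.1
  · rw [habs j (by omega), habs (j + 1) hjd]
    exact hξ.2.2 ⟨j, _⟩ ⟨j + 1, _⟩ hj rfl

/-- The Fourier transform of the flag measure, in terms of the simplices to which the
characteristic function of the polytope reduces. -/
lemma fourierMeasure_flagMeasure {ι : Type*} [Finite ι]
    {ℓ : ι → EuclideanSpace ℝ (Fin (r + n)) →ᵃ[ℝ] ℝ} (hn : 0 < n)
    {A : Set (EuclideanSpace ℝ (Fin (r + n)))} (hA : CellularSet ℓ A) (hAc : IsCompact A)
    (htop : affineSpan ℝ A = ⊤) {Φ : Flag (r + n) r} (hΦ : Φ.IsStandard)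
    {κ : Type*} [Fintype κ] {b : κ → ℝ} {q : κ → Fin (r + 1) → EuclideanSpace ℝ (Fin (r + n))}
    (hq : ∀ l, vectorSpan ℝ (Set.range (q l)) ≤ coordSpace (r + n) r)
    (hjump : ∀ x, Generic ℓ (coordSpace (r + n) r) x →
      iterJump (r + n) r n (A.indicator 1) x =
        ∑ l, b l * (convexHull ℝ (Set.range (q l))).indicator 1 x)
    (ξ : EuclideanSpace ℝ (Fin (r + n))) :
    fourierMeasure (flagMeasure A Φ) ξ =
      ∑ l, (b l : ℂ) * (simplexVol (q l) * simplexChar (q l) ξ) := by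
  have hfin : (chains r n A).Finite := finite_chains n hA
  have hflat : ∀ F ∈ hfin.toFinset, Flat r (F r) := fun F hF =>
    flat_of_mem_chains hn hA hAc (hfin.mem_toFinset.1 hF)
  have h1 : flagMeasure A Φ = ∑ F ∈ hfin.toFinset,
      (∏ j ∈ Finset.Ico r (r + n), stepSign F j) • volOn r (F r) := by
    rw [flagMeasure, hΦ.parallelSequences_eq, finsum_mem_eq_finite_toFinset_sum _ hfin]
    refine Finset.sum_congr rfl fun F _ => ?_
    congr 1
    refine Finset.prod_congr rfl fun j hj => ?_
    exact hΦ.eps_eq F (Finset.mem_Ico.1 hj).1 (Finset.mem_Ico.1 hj).2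
  rw [h1, fourierMeasure_sum_volOn (by omega) _ _ hflat,
    sum_setIntegral_congr (ℓ := ℓ) (T' := fun l => convexHull ℝ (Set.range (q l)))
      (s' := Finset.univ) (c' := b) (by omega) _ _ hflat (fun l _ => flat_hull _ (hq l)) ?_
      (continuous_char ξ)]
  · exact Finset.sum_congr rfl fun l _ => by rw [setIntegral_char_simplex (by omega) _ (hq l)]
  · intro x hx
    rw [← hjump x hx, ← finsum_chains_eq_iterJump n le_rfl hA hAc.isClosed
      (by rw [htop, AffineSubspace.direction_top, coordSpace_top]) hx,
      finsum_mem_eq_finite_toFinset_sum _ hfin]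

/-- The asymptotic comparison of the two Fourier transforms, with an explicit error term. -/
theorem exists_bound_fourier (hn : 0 < n) {A : Set (EuclideanSpace ℝ (Fin (r + n)))}
    (hA : IsPolytope A) {Φ : Flag (r + n) r} (hΦ : Φ.IsStandard) :
    ∃ α₀ > 0, ∃ C ≥ 0, ∀ α L ε : ℝ, ∀ ξ : EuclideanSpace ℝ (Fin (r + n)), α ≤ α₀ →
      ConeBound (r + n) r α L ε (absCoord ξ) →
      ‖fourierIndicator A ξ * freqProd r (r + n) ξ - fourierMeasure (flagMeasure A Φ) ξ‖ ≤
        C * (ε + 1 / L) := by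
  rcases A.eq_empty_or_nonempty with rfl | hAne
  · refine ⟨1, one_pos, 0, le_rfl, fun α L ε ξ _ _ => ?_⟩
    have h1 : flagMeasure ∅ Φ = 0 := by
      rw [flagMeasure, hΦ.parallelSequences_eq, chains_empty hn, finsum_mem_empty]
    rw [fourierIndicator_eq MeasurableSet.empty, h1, fourierMeasure]
    simp
  obtain ⟨N, p, ℓ, hp, hcell, hcomp, htop, hind⟩ := hA.exists_arrangement (by omega)
  choose κ hκ q b hq hjump α₁ hα₁ C hC hbound using fun k =>
    exists_reduction r n le_rfl (p k) (hp k).1 (by rw [(hp k).2, coordSpace_top])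
  obtain ⟨α₀, hα₀, hle⟩ : ∃ α₀ > 0, ∀ k, α₀ ≤ α₁ k := by
    have h : ∀ᶠ a in 𝓝[>] (0 : ℝ), ∀ k, a ≤ α₁ k := eventually_all.2 fun k =>
      mem_of_superset (Ioc_mem_nhdsGT (hα₁ k)) fun _ h => h.2
    obtain ⟨a, ha, ha0⟩ := (h.and self_mem_nhdsWithin).exists
    exact ⟨a, ha0, ha⟩
  have hμ : ∀ ξ, fourierMeasure (flagMeasure A Φ) ξ =
      ∑ k, ∑ l, (b k l : ℂ) * (simplexVol (q k l) * simplexChar (q k l) ξ) := by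
    intro ξ
    rw [fourierMeasure_flagMeasure (κ := Σ k, κ k) (b := fun l => b l.1 l.2)
      (q := fun l => q l.1 l.2) hn hcell hcomp (htop hAne) hΦ
      (fun l => (hq l.1 l.2).2.le) ?_ ξ, Fintype.sum_sigma]
    intro x hx
    have hc : ∀ k ∈ Finset.univ, Cellular ℓ ((convexHull ℝ (Set.range (p k))).indicator
        (1 : EuclideanSpace ℝ (Fin (r + n)) → ℝ)) := fun k _ => (hp k).1.2.indicator
    rw [iterJump_congr n le_rfl hcell.indicator (Cellular.sum Finset.univ (fun _ => 1) hc)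
      (fun y hy => hind y (by rwa [coordSpace_top] at hy)) hx, iterJump_sum _ _ n hc,
      Fintype.sum_sigma]
    exact Finset.sum_congr rfl fun k _ => by rw [one_mul, hjump k x hx]
  have hone : ∀ ξ, fourierIndicator A ξ = ∑ k, simplexVol (p k) * simplexChar (p k) ξ := by
    intro ξ
    have htop' : ∀ k, vectorSpan ℝ (Set.range (p k)) ≤ coordSpace (r + n) (r + n) := fun k => by
      rw [coordSpace_top]; exact le_top
    have h := sum_setIntegral_congr (ℓ := ℓ) (le_refl (r + n)) {()} Finset.univ (fun _ => 1)
      (fun _ => 1) (T := fun _ => A) (T' := fun k => convexHull ℝ (Set.range (p k)))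
      (fun _ _ => ⟨hcomp, 0, fun x _ => by rw [coordSpace_top]; exact Submodule.mem_top⟩)
      (fun k _ => flat_hull _ (htop' k))
      (fun x hx => by
        rw [Finset.sum_singleton, one_mul]
        exact hind x (by rwa [coordSpace_top] at hx)) (continuous_char ξ)
    rw [Finset.sum_singleton, Complex.ofReal_one, one_mul] at h
    rw [fourierIndicator_eq hcomp.measurableSet, h]
    exact Finset.sum_congr rfl fun k _ => by
      rw [one_mul, setIntegral_char_simplex le_rfl _ (htop' k)]
  refine ⟨α₀, hα₀, ∑ k, C k, Finset.sum_nonneg fun k _ => hC k, fun α L ε ξ hα hcone => ?_⟩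
  rw [hμ, hone, Finset.sum_mul, ← Finset.sum_sub_distrib, Finset.sum_mul]
  exact (norm_sum_le _ _).trans
    (Finset.sum_le_sum fun k _ => hbound k α L ε ξ (hα.trans (hle k)) hcone)

end StandardFlag

end FlagMeasures

theorem theorem4p1 {d r : ℕ} (hr : r < d) (A : Set (EuclideanSpace ℝ (Fin d)))
    (hA : FlagMeasures.IsPolytope A) (Φ : FlagMeasures.Flag d r) (hΦ : Φ.IsStandard) :
    ∃ α : ℝ, 0 < α ∧ α < 1 ∧ ∀ η : ℝ, 0 < η → ∃ δ L : ℝ, 0 < δ ∧ 2 * δ < α ∧ 0 < L ∧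
      ∀ ξ ∈ FlagMeasures.coneRegion r hr α L δ,
        ‖FlagMeasures.fourierIndicator A ξ *
            (∏ j ∈ Finset.univ.filter (fun j : Fin d => r ≤ (j : ℕ)), (-(2 * (Real.pi : ℂ) * Complex.I * ((ξ j : ℝ) : ℂ)))) -
          FlagMeasures.fourierMeasure (FlagMeasures.flagMeasure A Φ) ξ‖ < η := by
  obtain ⟨n, rfl⟩ : ∃ n, d = r + n := ⟨d - r, by omega⟩
  obtain ⟨α₀, hα₀, C, hC, hbound⟩ := FlagMeasures.exists_bound_fourier (by omega) hA hΦ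
  refine ⟨min α₀ (1 / 2), by positivity, (min_le_right _ _).trans_lt (by norm_num),
    fun η hη => ?_⟩
  have hα : 0 < min α₀ (1 / 2) := by positivity
  have hlim : Filter.Tendsto (fun δ : ℝ => C * (2 * δ + 1 / (1 / δ))) (nhdsWithin 0 (Set.Ioi 0))
      (nhds 0) := by
    have : Continuous fun δ : ℝ => C * (2 * δ + 1 / (1 / δ)) := by
      simp only [one_div, inv_inv]
      fun_prop
    have h := this.tendsto 0
    simp only [mul_zero, div_zero, add_zero] at h
    exact h.mono_left nhdsWithin_le_nhds
  obtain ⟨δ, ⟨hδη, hδα⟩, hδ⟩ := ((hlim.eventually_lt_const hη).and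
    (mem_nhdsWithin_of_mem_nhds (Iio_mem_nhds (half_pos hα)))).and self_mem_nhdsWithin |>.exists
  have hδ : 0 < δ := hδ
  have hδα : δ < min α₀ (1 / 2) / 2 := hδα
  have hα1 : min α₀ (1 / 2) ≤ 1 / 2 := min_le_right _ _
  refine ⟨δ, 1 / δ, hδ, by linarith, by positivity, fun ξ hξ => ?_⟩
  rw [FlagMeasures.freqProd_eq]
  refine (hbound _ _ _ ξ (min_le_left _ _) (FlagMeasures.coneBound_of_mem_coneRegion hr hξ hδ
    (by linarith) (by linarith) ?_)).trans_lt hδη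
  rw [le_div_iff₀ hδ]
  linarith
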